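/- Let $n \ge 5$ and $k \ge 3$, and let $\{n,k+1\}$ be the regular tiling of the hyperbolic plane by regular $n$-gons, $k+1$ of which meet at every vertex. Its edges can be split into solid and dashed edges such that 1. the solid edges form a spanning tree of the edge graph of $\{n,k+1\}$, and every vertex meets exactly $k$ solid edges, so that this spanning tree is the regular tree of valence $k$; 2. every vertex meets exactly one dashed edge; 3. every tile has one or two dashed sides; 4. the tiles can be enumerated without repetition as $T_0, T_1, T_2, \dots$ such that for every $m \ge 0$ exactly one dashed side of $T_m$ is not a side of any of $T_0, \dots, T_{m-1}$, and the corners of $T_0, \dots, T_m$ together with the solid sides of these tiles form a tree. Moreover, let $p$ be a prime and let $\mathbf{k}$ be a finite extension of $\mathbb{Q}_p$, with ring of integers $\mathcal{O}$, whose residue field has $q$ elements. If $k = q+1$, then the spanning tree in 1 is isomorphic to the Bruhat–Tits tree of $\mathbf{k}$ (vertices: homothety classes of rank-two $\mathcal{O}$-lattices in $\mathbf{k}^2$; two classes are adjacent if they have representatives $M_2 \subset M_1$ with $M_1/M_2$ isomorphic to the residue field). Thus the Bruhat–Tits tree is a spanning tree of the tiling $\{n,q+2\}$. -/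

import Mathlib

/-!
# The regular hyperbolic tilings `{n, q}` and the Bruhat–Tits tree of a `p`-adic field
-/

open scoped Pointwise UpperHalfPlane

noncomputable section

namespace HyperbolicTiling

/-- The group `SL(2, ℝ)`, acting on the hyperbolic plane `ℍ` by Möbius transformations, i.e. by
orientation preserving isometries. -/
abbrev SL2R : Type := Matrix.SpecialLinearGroup (Fin 2) ℝ

/-- The counterclockwise hyperbolic rotation about the point `i ∈ ℍ` by the angle `θ`. -/
def rotation (θ : ℝ) : SL2R :=
  ⟨!![Real.cos (θ / 2), Real.sin (θ / 2); -Real.sin (θ / 2), Real.cos (θ / 2)], by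
    rw [Matrix.det_fin_two_of]
    nlinarith [Real.sin_sq_add_cos_sq (θ / 2)]⟩

/-- The hyperbolic translation `z ↦ eᵗ z`, which moves `i` by the distance `t ≥ 0` along the
imaginary axis. -/
def translation (t : ℝ) : SL2R :=
  ⟨!![Real.exp (t / 2), 0; 0, Real.exp (-(t / 2))], by
    rw [Matrix.det_fin_two_of, ← Real.exp_add]
    simp⟩

/-- The circumradius of a regular hyperbolic `n`-gon all of whose interior angles are `2π / q`:
the hypotenuse of the hyperbolic triangle with angles `π / n`, `π / q`, `π / 2`. -/
def circumradius (n q : ℕ) : ℝ :=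
  Real.arcosh (Real.cot (Real.pi / n) * Real.cot (Real.pi / q))

/-- One corner of the base tile. The base tile is the regular `n`-gon with centre `i` and interior
angles `2π / q` that has a corner at this point. -/
def baseVertex (n q : ℕ) : ℍ := translation (circumradius n q) • UpperHalfPlane.I

/-- The rotation by `2π / n` about the centre of the base tile. -/
def tileRotation (n : ℕ) : SL2R := rotation (2 * Real.pi / n)

/-- The rotation by `2π / q` about the corner `baseVertex n q` of the base tile. -/
def vertexRotation (n q : ℕ) : SL2R :=
  translation (circumradius n q) * rotation (2 * Real.pi / q) *
    (translation (circumradius n q))⁻¹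

/-- The group of orientation preserving symmetries of the tiling `{n, q}`. The tiles of `{n, q}`
are the images of the base tile under this group. -/
def rotationGroup (n q : ℕ) : Subgroup SL2R :=
  Subgroup.closure {tileRotation n, vertexRotation n q}

/-- The vertices of the tiling `{n, q}`, as points of the hyperbolic plane. -/
def Vertex (n q : ℕ) : Type :=
  {z : ℍ // ∃ g : SL2R, g ∈ rotationGroup n q ∧ z = g • baseVertex n q}

/-- The `j`-th corner (in counterclockwise order) of the image of the base tile under the
symmetry `g`. -/
def corner {n q : ℕ} (g : rotationGroup n q) (j : ℕ) : Vertex n q :=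
  ⟨((g : SL2R) * tileRotation n ^ j) • baseVertex n q, (g : SL2R) * tileRotation n ^ j,
    mul_mem g.2 (pow_mem (Subgroup.subset_closure (Set.mem_insert _ _)) j), rfl⟩

/-- The set of the sides of the image of the base tile under the symmetry `g`; a side is given by
its two endpoints. -/
def sides {n q : ℕ} (g : rotationGroup n q) : Set (Sym2 (Vertex n q)) :=
  {e | ∃ j : ℕ, e = s(corner g j, corner g (j + 1))}

/-- The tiles of the tiling `{n, q}`; a tile is given by the set of its sides. -/
def tiles (n q : ℕ) : Set (Set (Sym2 (Vertex n q))) :=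
  Set.range fun g : rotationGroup n q => sides g

/-- The edge graph of the tiling `{n, q}`: its edges are the sides of the tiles. -/
def edgeGraph (n q : ℕ) : SimpleGraph (Vertex n q) :=
  SimpleGraph.fromEdgeSet (⋃ t ∈ tiles n q, t)

/-- The set of the corners of a tile. -/
def corners {n q : ℕ} (t : Set (Sym2 (Vertex n q))) : Set (Vertex n q) :=
  {v | ∃ e ∈ t, v ∈ e}

/-- The graph formed by those edges of `G` that are sides of one of the tiles `T 0, …, T m`, on
the set of the corners of these tiles. -/
def graphOfFirstTiles {n q : ℕ} (G : SimpleGraph (Vertex n q))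
    (T : ℕ → Set (Sym2 (Vertex n q))) (m : ℕ) :
    SimpleGraph (⋃ i ∈ Set.Iic m, corners (T i) : Set (Vertex n q)) :=
  (SimpleGraph.fromEdgeSet (G.edgeSet ∩ ⋃ i ∈ Set.Iic m, T i)).induce
    (⋃ i ∈ Set.Iic m, corners (T i))

end HyperbolicTiling

namespace BruhatTits

variable (K : Type*) [NormedField K] [IsUltrametricDist K]

/-- The ring of integers `{x : K | ‖x‖ ≤ 1}` of a field with an ultrametric norm. -/
abbrev Integers : ValuationSubring K := (NormedField.valuation (K := K)).valuationSubring

/-- The residue field of `K`. -/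
abbrev Residue : Type _ := IsLocalRing.ResidueField (Integers K)

/-- The lattices in `K²`. If `Integers K` is a discrete valuation ring, these are the free
submodules of rank two. -/
def Lattice : Type _ :=
  {M : Submodule (Integers K) (Fin 2 → K) // M.IsLattice K}

/-- Two lattices are homothetic if `M₁ = c M₂` for some `c ∈ Kˣ`. -/
def homothety : Setoid (Lattice K) where
  r M₁ M₂ := ∃ c : Kˣ, M₁.1 = c • M₂.1
  iseqv :=
    { refl := fun M => ⟨1, (one_smul Kˣ M.1).symm⟩
      symm := by
        rintro M₁ M₂ ⟨c, hc⟩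
        exact ⟨c⁻¹, by rw [hc, inv_smul_smul]⟩
      trans := by
        rintro M₁ M₂ M₃ ⟨c, hc⟩ ⟨d, hd⟩
        exact ⟨c * d, by rw [hc, hd, mul_smul]⟩ }

/-- The vertices of the Bruhat–Tits tree of `PGL(2, K)`: homothety classes of lattices in `K²`. -/
def Vertex : Type _ := Quotient (homothety K)

/-- The Bruhat–Tits tree of `PGL(2, K)`: two homothety classes are adjacent if they have
representatives `M₂ ⊆ M₁` such that `M₁ / M₂` is isomorphic to the residue field. -/
def tree : SimpleGraph (Vertex K) :=
  SimpleGraph.fromRel fun x y => ∃ M₁ M₂ : Lattice K,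
    Quotient.mk (homothety K) M₁ = x ∧ Quotient.mk (homothety K) M₂ = y ∧ M₂.1 ≤ M₁.1 ∧
      Nonempty ((M₁.1 ⧸ M₂.1.submoduleOf M₁.1) ≃ₗ[Integers K] Residue K)

end BruhatTits

end

/-!
# A spanning tree of the tiling `{n, k + 1}`

Choose a point `P` in general position inside the base tile and order the tiles by the distances
of their centres from `P`. This discrete Morse function shells the tiling: every tile other than
the base tile has a side that separates it from `P`; there are at most two such sides, these are
adjacent, and they are the sides shared with lower tiles. At every vertex exactly one of the tiles
around it is lower than its two neighbours there, and the heights still increase in the second step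
counterclockwise. These facts and the stabilizers of tiles and vertices are the fields of
`MorseTiling`; everything about solid and dashed edges is deduced from them alone.

When a tile other than the base tile is added, its sides that are not yet present form a path whose
inner vertices are new. Exactly one of them becomes dashed: the last one in counterclockwise order
if the old vertex at its end is not yet met by a dashed edge although its lowest tile is the
neighbouring one (`MorseTiling.Open`), and otherwise the one before it. So every vertex is met by a
dashed edge of its lowest tile or of the next tile around it, and never by both
(`MorseTiling.existsUnique_dashed`). The rest of the path attaches the new corners to the old graph
as one or two paths, so the solid edges form a tree at every stage (`MorseTiling.isTree_induce`)
and in the end (`MorseTiling.isTree_solid`). Both follow from `SimpleGraph.isTree_of_parent`, where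
the parent of a vertex is the next vertex on the way to the old graph.

The geometry takes place in the hyperboloid model, where the tiling is the orbit of a triangle
under three reflections. Tits' argument for Coxeter groups
(`ReflectionSystem.eq_and_mem_closure_of_mem_chamber`) shows that the triangle meets every
orbit at most once, which determines the stabilizers and keeps the centres of tiles apart. The
Morse properties are then inequalities between cosines (`HyperbolicTiling.IsGeneric.dvd_of_lower`,
`HyperbolicTiling.dvd_of_local_min`, `HyperbolicTiling.lt_of_local_min`), where `n ≥ 5` and
`k + 1 ≥ 4` enter.

For the last claim, homothety classes of lattices in `K²` correspond to balls in `K`, and adjacent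
classes to balls one of which is maximal in the other. The next larger ball serves as the parent,
so the Bruhat–Tits tree is a tree, of valence one more than the cardinality of the residue field
(`BruhatTits.IsUniformizer.isTree_tree`, `BruhatTits.IsUniformizer.ncard_neighborSet`). Two trees
of the same positive finite valence are isomorphic
(`SimpleGraph.IsTree.nonempty_iso_of_regular`).
-/

open scoped Pointwise UpperHalfPlane

noncomputable section

/-! ### Regular trees -/

namespace SimpleGraph

variable {V : Type*}

/-- A graph whose edges join every vertex `x` to its parent `par x` is a tree, if parents have
smaller rank and any two vertices have a common ancestor. A vertex may be its own parent. -/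
theorem isTree_of_parent {α : Type*} [Preorder α] [Nonempty V] (G : SimpleGraph V) (par : V → V)
    (rk : V → α) (hG : ∀ x y, G.Adj x y ↔ x ≠ y ∧ (par x = y ∨ par y = x))
    (hrk : ∀ x, par x ≠ x → rk (par x) < rk x)
    (hmeet : ∀ x y, ∃ i j : ℕ, par^[i] x = par^[j] y) : G.IsTree := by
  have hle : ∀ (k : ℕ) x, rk (par^[k] x) ≤ rk x := by
    intro k
    induction k with
    | zero => intro x; simp
    | succ k ih =>
      intro x
      rw [Function.iterate_succ_apply]
      by_cases h : par x = x
      · rw [h]; exact ih x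
      · exact (ih (par x)).trans (hrk x h).le
  have hreach : ∀ (k : ℕ) x, G.Reachable x (par^[k] x) := by
    intro k
    induction k with
    | zero => intro x; simp
    | succ k ih =>
      intro x
      rw [Function.iterate_succ_apply]
      by_cases h : par x = x
      · rw [h]; exact ih x
      · exact (Adj.reachable ((hG _ _).2 ⟨fun h' => h h'.symm, Or.inl rfl⟩)).trans (ih (par x))
  -- deleting the edge between `x` and its parent separates the descendants of `x` from the rest
  have hbr : ∀ x, par x ≠ x → ¬ (G \ fromEdgeSet {s(x, par x)}).Reachable x (par x) := by
    rintro x hx ⟨p⟩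
    have key : ∀ z w : V, (G \ fromEdgeSet {s(x, par x)}).Walk z w →
        (∃ k : ℕ, par^[k] z = x) → ∃ k : ℕ, par^[k] w = x := by
      intro z w p
      induction p with
      | nil => exact id
      | @cons u v w h p ih =>
        rintro ⟨k, hk⟩
        apply ih
        rw [sdiff_adj, fromEdgeSet_adj, hG] at h
        obtain ⟨⟨hne, h1 | h1⟩, h2⟩ := h
        · rcases k with _ | k
          · refine absurd ⟨?_, hne⟩ h2
            rw [Function.iterate_zero, id] at hk
            subst hk h1
            rfl
          · exact ⟨k, by rw [Function.iterate_succ_apply, h1] at hk; exact hk⟩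
        · exact ⟨k + 1, by rw [Function.iterate_succ_apply, h1, hk]⟩
    obtain ⟨k, hk⟩ := key _ _ p ⟨0, rfl⟩
    have h1 := hle k (par x)
    rw [hk] at h1
    exact lt_irrefl _ (h1.trans_lt (hrk x hx))
  refine ⟨?_, ?_⟩
  · rw [connected_iff]
    refine ⟨fun x y => ?_, inferInstance⟩
    obtain ⟨i, j, h⟩ := hmeet x y
    exact (h ▸ hreach i x).trans (hreach j y).symm
  · rw [isAcyclic_iff_forall_adj_isBridge]
    intro x y hxy
    rw [isBridge_iff]
    obtain ⟨hne, rfl | rfl⟩ := (hG _ _).1 hxy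
    · exact hbr x hne.symm
    · intro h
      rw [Sym2.eq_swap] at h
      exact hbr y hne h.symm

/-- The words that address the vertices of the rooted tree in which the root has `k` children and
all other vertices have `k - 1` children. The letter at the head belongs to the last step. -/
def RegularWord (k : ℕ) : List ℕ → Prop
  | [] => True
  | i :: w => RegularWord k w ∧ i < if w = [] then k else k - 1

/-- The `k`-regular tree, on the words that address its vertices. -/
def regularTree (k : ℕ) : SimpleGraph {w : List ℕ // RegularWord k w} where
  Adj u w := (∃ i, u.1 = i :: w.1) ∨ ∃ i, w.1 = i :: u.1
  symm := ⟨fun _ _ h => h.symm⟩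
  loopless := ⟨fun u h => by
    rcases h with ⟨i, h⟩ | ⟨i, h⟩ <;> simpa using congrArg List.length h⟩

/-- A tree in which all vertices have `k` neighbours is isomorphic to the `k`-regular tree. -/
theorem IsTree.nonempty_iso_regularTree {G : SimpleGraph V} (hG : G.IsTree) {k : ℕ} (hk : 0 < k)
    (hdeg : ∀ v, (G.neighborSet v).ncard = k) : Nonempty (regularTree k ≃g G) := by
  classical
  obtain ⟨o⟩ := hG.1.nonempty
  choose p hp hpu using fun v => hG.existsUnique_path v o
  -- The parent of a vertex is the next vertex on the path to the root `o`.
  let par : V → V := fun v => (p v).snd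
  have hlen : ∀ v, v ≠ o → G.Adj v (par v) ∧ (p (par v)).length < (p v).length := by
    intro v hv
    have hnil : ¬ (p v).Nil := fun h => hv h.eq
    refine ⟨(p v).adj_snd hnil, ?_⟩
    have h1 : p (par v) = (p v).tail := (hpu _ _ (hp v).tail).symm
    rw [h1, ← Walk.length_tail_add_one hnil]
    exact Nat.lt_succ_self _
  have hadj : ∀ v w, G.Adj v w → (v ≠ o ∧ par v = w) ∨ (w ≠ o ∧ par w = v) := by
    intro v w h
    by_cases hw : w ∈ (p v).support
    · left
      have hvo : v ≠ o := by
        rintro rfl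
        have : p v = Walk.nil := (hpu _ _ Walk.IsPath.nil).symm
        rw [this] at hw
        simp at hw
        exact h.ne hw.symm
      exact ⟨hvo, (hG.2.eq_snd_of_adj_start (hp v) h hw).symm⟩
    · right
      have h1 : p w = Walk.cons h.symm (p v) :=
        (hpu _ _ ((hp v).cons hw)).symm
      refine ⟨?_, ?_⟩
      · rintro rfl
        exact hw (Walk.end_mem_support _)
      · simp only [par]
        rw [h1]; simp
  have hfin : ∀ v, (G.neighborSet v).Finite := fun v =>
    Set.finite_of_ncard_pos (by rw [hdeg]; exact hk)
  -- the set of the children of a vertex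
  let ch : V → Set V := fun v => {w | w ≠ o ∧ par w = v}
  have hch : ∀ v, ch v = if v = o then G.neighborSet v else G.neighborSet v \ {par v} := by
    intro v
    ext w
    simp only [ch, Set.mem_ofPred_eq]
    constructor
    · rintro ⟨h1, rfl⟩
      have h2 := hlen w h1
      split_ifs with h3
      · exact h2.1.symm
      · refine ⟨h2.1.symm, ?_⟩
        intro h4
        have h5 := (hlen _ h3).2
        rw [← Set.mem_singleton_iff.1 h4] at h5
        exact lt_asymm h2.2 h5
    · split_ifs with h3
      · intro h
        rcases hadj _ _ h with h4 | h4
        · exact absurd h3 h4.1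
        · exact h4
      · rintro ⟨h, h'⟩
        rcases hadj _ _ h with h4 | h4
        · exact absurd h4.2.symm h'
        · exact h4
  have hcard : ∀ v, (ch v).ncard = if v = o then k else k - 1 := by
    intro v
    rw [hch]
    split_ifs with h
    · exact hdeg v
    · rw [Set.ncard_sdiff_singleton_of_mem (show par v ∈ G.neighborSet v from (hlen v h).1), hdeg]
  have hchfin : ∀ v, (ch v).Finite := by
    intro v
    rw [hch]
    split_ifs
    · exact hfin v
    · exact (hfin v).sdiff
  have henum : ∀ v, ∃ f : ℕ → V, Set.BijOn f (Set.Iio (if v = o then k else k - 1)) (ch v) := by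
    intro v
    have h := (hchfin v).fintype
    have hc : Fintype.card (ch v) = if v = o then k else k - 1 := by
      rw [← hcard v, Set.ncard_eq_toFinset_card', Set.toFinset_card]
    let e := (Fintype.equivFinOfCardEq hc).symm
    refine ⟨fun i => if hi : i < (if v = o then k else k - 1) then e ⟨i, hi⟩ else v, ?_, ?_, ?_⟩
    · intro i hi
      rw [Set.mem_Iio] at hi
      simp only [hi, dif_pos]
      exact (e _).2
    · intro i hi j hj hij
      rw [Set.mem_Iio] at hi hj
      simp only [hi, hj, dif_pos] at hij
      simpa using e.injective (Subtype.ext hij)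
    · intro w hw
      obtain ⟨i, hi⟩ := e.surjective ⟨w, hw⟩
      refine ⟨i, i.2, ?_⟩
      have := i.2
      simp only [this, dif_pos, Fin.eta, hi]
  choose f hf using henum
  -- A word is mapped to the vertex reached from the root by the numbers of the successive children.
  let φ : List ℕ → V := fun w => w.rec o (fun i _ v => f v i)
  have hφc : ∀ i w, φ (i :: w) = f (φ w) i := fun i w => rfl
  have hmem : ∀ i w, RegularWord k (i :: w) → (φ w = o ↔ w = []) → φ (i :: w) ∈ ch (φ w) := by
    intro i w h h'
    rw [hφc]
    apply (hf (φ w)).mapsTo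
    have := h.2
    simp only [h', Set.mem_Iio]
    exact this
  have hroot : ∀ w, RegularWord k w → (φ w = o ↔ w = []) := by
    intro w
    induction w with
    | nil => intro _; exact ⟨fun _ => rfl, fun _ => rfl⟩
    | cons i w ih =>
      intro h
      have h1 := hmem i w h (ih h.1)
      simp only [reduceCtorEq, iff_false]
      exact h1.1
  have hinj : ∀ u w, RegularWord k u → RegularWord k w → φ u = φ w → u = w := by
    intro u
    induction u with
    | nil => intro w _ h2 h; exact ((hroot w h2).1 h.symm).symm
    | cons i u ih =>
      rintro (_ | ⟨j, w⟩) h1 h2 h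
      · exact (hroot _ h1).1 h
      · have h3 := hmem i u h1 (hroot _ h1.1)
        have h4 := hmem j w h2 (hroot _ h2.1)
        have h5 : u = w := ih w h1.1 h2.1 (by rw [← h3.2, ← h4.2, h])
        subst h5
        rw [hφc, hφc] at h
        have h6 := (hf (φ u)).injOn (x₁ := i) (x₂ := j)
          (by have := h1.2; simp only [hroot u h1.1, Set.mem_Iio]; exact this)
          (by have := h2.2; simp only [hroot u h1.1, Set.mem_Iio]; exact this) h
        rw [h6]
  have hsurj : ∀ (m : ℕ) v, (p v).length = m → ∃ w, RegularWord k w ∧ φ w = v := by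
    intro m
    induction m using Nat.strong_induction_on with
    | _ m ih =>
      intro v hv
      by_cases hvo : v = o
      · exact ⟨[], trivial, hvo.symm⟩
      · obtain ⟨w, hw, hw'⟩ := ih _ (hv ▸ (hlen v hvo).2) (par v) rfl
        obtain ⟨i, hi, hi'⟩ := (hf (par v)).surjOn (show v ∈ ch (par v) from ⟨hvo, rfl⟩)
        refine ⟨i :: w, ⟨hw, ?_⟩, ?_⟩
        · have := hroot w hw
          rw [hw'] at this
          simp only [Set.mem_Iio, this] at hi
          exact hi
        · rw [hφc, hw', hi']
  have hbij : Function.Bijective (fun w : {w : List ℕ // RegularWord k w} => φ w.1) := by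
    refine ⟨fun u w h => Subtype.ext (hinj _ _ u.2 w.2 h), fun v => ?_⟩
    obtain ⟨w, hw, h⟩ := hsurj _ v rfl
    exact ⟨⟨w, hw⟩, h⟩
  have hpar : ∀ i w, RegularWord k (i :: w) → φ (i :: w) ≠ o ∧ par (φ (i :: w)) = φ w :=
    fun i w h => hmem i w h (hroot w h.1)
  have hword : ∀ u w : {w : List ℕ // RegularWord k w}, φ u.1 ≠ o → par (φ u.1) = φ w.1 →
      ∃ i, u.1 = i :: w.1 := by
    rintro ⟨_ | ⟨i, u⟩, hu⟩ ⟨w, hw⟩ h1 h2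
    · exact absurd rfl h1
    · refine ⟨i, ?_⟩
      exact congrArg (i :: ·) (hinj u w hu.1 hw ((hpar i u hu).2.symm.trans h2))
  refine ⟨⟨Equiv.ofBijective _ hbij, ?_⟩⟩
  intro u w
  simp only [Equiv.ofBijective_apply]
  constructor
  · intro h
    rcases hadj _ _ h with h | h
    · exact Or.inl (hword u w h.1 h.2)
    · exact Or.inr (hword w u h.1 h.2)
  · rintro (⟨i, h⟩ | ⟨i, h⟩)
    · have h1 := hpar i w.1 (h ▸ u.2)
      rw [h, ← h1.2]
      exact (hlen _ h1.1).1
    · have h1 := hpar i u.1 (h ▸ w.2)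
      rw [h, ← h1.2]
      exact (hlen _ h1.1).1.symm

/-- Two trees in which all vertices have `k` neighbours are isomorphic. -/
theorem IsTree.nonempty_iso_of_regular {V' : Type*} {G : SimpleGraph V} {G' : SimpleGraph V'}
    (hG : G.IsTree) (hG' : G'.IsTree) {k : ℕ} (hk : 0 < k)
    (hdeg : ∀ v, (G.neighborSet v).ncard = k) (hdeg' : ∀ v, (G'.neighborSet v).ncard = k) :
    Nonempty (G ≃g G') := by
  obtain ⟨e⟩ := hG.nonempty_iso_regularTree hk hdeg
  obtain ⟨e'⟩ := hG'.nonempty_iso_regularTree hk hdeg'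
  exact ⟨e.symm.trans e'⟩

end SimpleGraph

/-! ### Reflection groups -/

/-- Reflections `s i` of a set `X`, with functions `f i` that vanish on the mirrors, whose relations
are those of the roots of a Coxeter group: the mirrors of `s i` and `s j` meet at the angle
`π / m i j`. -/
structure ReflectionSystem (ι X : Type*) where
  /-- the reflections -/
  s : ι → Equiv.Perm X
  /-- the functions that are nonnegative on the half spaces bounding the fundamental chamber -/
  f : ι → X → ℝ
  /-- the orders of the products of two reflections -/
  m : ι → ι → ℕ
  s_mul_self : ∀ i, s i * s i = 1
  f_s_self : ∀ i x, f i (s i x) = -f i x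
  f_s : ∀ i j x, i ≠ j → f i (s j x) = f i x + 2 * Real.cos (Real.pi / m i j) * f j x
  m_symm : ∀ i j, m i j = m j i
  two_le_m : ∀ i j, i ≠ j → 2 ≤ m i j
  s_mul_s_pow : ∀ i j, i ≠ j → (s i * s j) ^ m i j = 1
  s_apply : ∀ i x, f i x = 0 → s i x = x

namespace ReflectionSystem

variable {ι X : Type*} (R : ReflectionSystem ι X)

/-- The product of the reflections in a word. -/
def word (l : List ι) : Equiv.Perm X := (l.map R.s).prod

/-- The length of the shortest word for `w`. The value is `0` if there is none. -/
def len (w : Equiv.Perm X) : ℕ := sInf {k | ∃ l : List ι, l.length = k ∧ R.word l = w}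

/-- The group generated by the reflections. -/
def group : Subgroup (Equiv.Perm X) := Subgroup.closure (Set.range R.s)

/-- The fundamental chamber. -/
def chamber : Set X := {x | ∀ i, 0 ≤ R.f i x}

@[simp] lemma word_nil : R.word [] = 1 := rfl

lemma word_cons (i : ι) (l : List ι) : R.word (i :: l) = R.s i * R.word l := by simp [word]

lemma word_append (l l' : List ι) : R.word (l ++ l') = R.word l * R.word l' := by simp [word]

@[simp] lemma word_singleton (i : ι) : R.word [i] = R.s i := by simp [word]

lemma s_inv (i : ι) : (R.s i)⁻¹ = R.s i := inv_eq_of_mul_eq_one_right (R.s_mul_self i)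

lemma mul_s_mul_s (w : Equiv.Perm X) (i : ι) : w * R.s i * R.s i = w := by
  rw [mul_assoc, R.s_mul_self, mul_one]

lemma exists_word {w : Equiv.Perm X} (hw : w ∈ R.group) : ∃ l, R.word l = w := by
  refine Subgroup.closure_induction (p := fun w _ => ∃ l, R.word l = w) ?_ ⟨[], rfl⟩ ?_ ?_ hw
  · rintro _ ⟨i, rfl⟩
    exact ⟨[i], R.word_singleton i⟩
  · rintro _ _ _ _ ⟨l, rfl⟩ ⟨l', rfl⟩
    exact ⟨l ++ l', R.word_append l l'⟩
  · rintro _ h ⟨l, rfl⟩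
    refine ⟨l.reverse, ?_⟩
    clear h
    induction l with
    | nil => simp
    | cons i l ih => rw [List.reverse_cons, word_append, ih, word_singleton, word_cons, mul_inv_rev,
        s_inv]

lemma s_mem (i : ι) : R.s i ∈ R.group := Subgroup.subset_closure ⟨i, rfl⟩

lemma len_word_le (l : List ι) : R.len (R.word l) ≤ l.length := Nat.sInf_le ⟨l, rfl, rfl⟩

lemma exists_reduced_word {w : Equiv.Perm X} (hw : w ∈ R.group) :
    ∃ l : List ι, l.length = R.len w ∧ R.word l = w := by
  obtain ⟨l, hl⟩ := R.exists_word hw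
  exact Nat.sInf_mem (s := {k | ∃ l : List ι, l.length = k ∧ R.word l = w}) ⟨_, l, rfl, hl⟩

lemma len_mul_word_le {u : Equiv.Perm X} (hu : u ∈ R.group) (l : List ι) :
    R.len (u * R.word l) ≤ R.len u + l.length := by
  obtain ⟨l', h1, h2⟩ := R.exists_reduced_word hu
  rw [← h1, ← h2, ← word_append, ← List.length_append]
  exact R.len_word_le _

lemma exists_len_mul_s_lt {w : Equiv.Perm X} (hw : w ∈ R.group) (hw1 : w ≠ 1) :
    ∃ i, R.len (w * R.s i) + 1 ≤ R.len w := by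
  obtain ⟨l, h1, h2⟩ := R.exists_reduced_word hw
  rcases List.eq_nil_or_concat l with rfl | ⟨l, i, rfl⟩
  · exact absurd h2.symm hw1
  · refine ⟨i, ?_⟩
    rw [← h1, ← h2, List.concat_eq_append, word_append, word_singleton, mul_s_mul_s,
      List.length_append]
    exact Nat.succ_le_succ (R.len_word_le l)

/-- The alternating word in `i` and `j` of length `k` that ends in `j`. -/
def alternating (i j : ι) : ℕ → List ι
  | 0 => []
  | k + 1 => alternating j i k ++ [j]

@[simp] lemma length_alternating (i j : ι) (k : ℕ) : (alternating i j k).length = k := by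
  induction k generalizing i j with
  | zero => rfl
  | succ k ih => simp [alternating, ih]

lemma exists_alternating_add (i j : ι) (d k : ℕ) :
    ∃ p : List ι, p.length = d ∧ alternating i j (k + d) = p ++ alternating i j k := by
  induction k generalizing i j with
  | zero => exact ⟨alternating i j d, by simp, by simp [alternating]⟩
  | succ k ih =>
    obtain ⟨p, hp, h⟩ := ih j i
    refine ⟨p, hp, ?_⟩
    rw [Nat.add_right_comm]
    simp [alternating, h]

lemma word_alternating_two_mul (i j : ι) (t : ℕ) :
    R.word (alternating i j (2 * t)) = (R.s i * R.s j) ^ t := by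
  induction t with
  | zero => rfl
  | succ t ih =>
    rw [Nat.mul_succ]
    simp only [alternating, word_append, word_singleton, ih, pow_succ, mul_assoc]

lemma word_alternating_two_mul_add_one (i j : ι) (t : ℕ) :
    R.word (alternating i j (2 * t + 1)) = (R.s j * R.s i) ^ t * R.s j := by
  simp only [alternating, word_append, word_singleton, word_alternating_two_mul]

/-- The braid relation. -/
lemma word_alternating_m {i j : ι} (hij : i ≠ j) :
    R.word (alternating i j (R.m i j)) = R.word (alternating j i (R.m i j)) := by
  have hinv : R.s j * R.s i = (R.s i * R.s j)⁻¹ := by rw [mul_inv_rev, s_inv, s_inv]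
  have h := R.s_mul_s_pow i j hij
  obtain ⟨t, ht⟩ := Nat.even_or_odd' (R.m i j)
  rcases ht with ht | ht
  · rw [ht] at h ⊢
    rw [word_alternating_two_mul, word_alternating_two_mul, hinv, inv_pow, eq_inv_iff_mul_eq_one,
      ← pow_add, ← two_mul, h]
  · rw [ht] at h ⊢
    rw [word_alternating_two_mul_add_one, word_alternating_two_mul_add_one, ← eq_mul_inv_iff_mul_eq,
      s_inv, mul_assoc, ← pow_succ, hinv, inv_pow, inv_eq_iff_mul_eq_one, ← pow_add]
    rw [← h]
    congr 1
    ring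

/-- The values of `f i` after an alternating word in two reflections are given by the values of
Chebyshev polynomials of the second kind at the cosine of the angle between the mirrors. -/
lemma f_word_alternating (k : ℕ) : ∀ i j : ι, i ≠ j → ∀ x : X,
    Real.sin (Real.pi / R.m i j) * R.f i ((R.word (alternating i j k))⁻¹ x) =
      Real.sin ((k + 1) * (Real.pi / R.m i j)) * R.f (if Even k then i else j) x +
        Real.sin (k * (Real.pi / R.m i j)) * R.f (if Even k then j else i) x := by
  have hstep : ∀ (k : ℕ) (i j : ι) (x : X), (R.word (alternating i j (k + 1)))⁻¹ x =
      R.s j ((R.word (alternating j i k))⁻¹ x) := by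
    intro k i j x
    rw [alternating, word_append, word_singleton, mul_inv_rev, s_inv, Equiv.Perm.mul_apply]
  induction k using Nat.strong_induction_on with
  | _ k ih =>
    intro i j hij x
    rcases k with _ | _ | k
    · simp [alternating]
    · rw [hstep, R.f_s i j _ hij]
      have h2 := Real.sin_two_mul (Real.pi / R.m i j)
      norm_num [alternating]
      rw [h2]
      ring
    · have h1 := ih (k + 1) (by omega) j i hij.symm x
      have h2 := ih k (by omega) i j hij x
      rw [R.m_symm j i] at h1
      rw [hstep, R.f_s i j _ hij, hstep, R.f_s_self, ← hstep]
      have e1 : Even (k + 1 + 1) ↔ Even k := by simp [Nat.even_add_one]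
      have e2 : Even (k + 1) ↔ ¬ Even k := Nat.even_add_one
      have hs : Real.sin (((k + 1 + 1 : ℕ) + 1) * (Real.pi / R.m i j)) =
          2 * Real.cos (Real.pi / R.m i j) * Real.sin (((k + 1 : ℕ) + 1) * (Real.pi / R.m i j)) -
            Real.sin ((k + 1) * (Real.pi / R.m i j)) := by
        push_cast
        rw [show ((k : ℝ) + 1 + 1 + 1) * (Real.pi / R.m i j) =
          (k + 1 + 1) * (Real.pi / R.m i j) + Real.pi / R.m i j by ring,
          show ((k : ℝ) + 1) * (Real.pi / R.m i j) =
          (k + 1 + 1) * (Real.pi / R.m i j) - Real.pi / R.m i j by ring, Real.sin_add, Real.sin_sub]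
        ring
      have hs' : Real.sin (((k + 1 + 1 : ℕ)) * (Real.pi / R.m i j)) =
          2 * Real.cos (Real.pi / R.m i j) * Real.sin (((k + 1 : ℕ)) * (Real.pi / R.m i j)) -
            Real.sin (k * (Real.pi / R.m i j)) := by
        push_cast
        rw [show ((k : ℝ) + 1 + 1) * (Real.pi / R.m i j) =
          (k + 1) * (Real.pi / R.m i j) + Real.pi / R.m i j by ring,
          show (k : ℝ) * (Real.pi / R.m i j) =
          (k + 1) * (Real.pi / R.m i j) - Real.pi / R.m i j by ring, Real.sin_add, Real.sin_sub]
        ring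
      simp only [e1]
      simp only [e2, ite_not] at h1
      rw [hs, hs', mul_add, mul_neg, h2]
      linear_combination 2 * Real.cos (Real.pi / R.m i j) * h1

/-- The case of two reflections of the positivity lemma `f_nonneg_of_len_le`. -/
lemma f_nonneg_of_dihedral {i j : ι} (hij : i ≠ j) (l : List ι) (hl : ∀ a ∈ l, a = i ∨ a = j)
    (hmin : ∀ l', R.word l' = R.word l → l.length ≤ l'.length)
    (hmin' : ∀ l', R.word l' = R.word l * R.s i → l.length ≤ l'.length)
    {x : X} (hi : 0 ≤ R.f i x) (hj : 0 ≤ R.f j x) : 0 ≤ R.f i ((R.word l)⁻¹ x) := by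
  have halt : ∀ (k : ℕ) (i j : ι) (l : List ι), l.length = k → (∀ a ∈ l, a = i ∨ a = j) →
      (∀ l', R.word l' = R.word l → l.length ≤ l'.length) →
      (∀ l', R.word l' = R.word l * R.s i → l.length ≤ l'.length) → l = alternating i j k := by
    intro k
    induction k with
    | zero => intro i j l hk _ _ _; exact List.length_eq_zero_iff.1 hk
    | succ k ih =>
      intro i j l hk hl h1 h2
      rcases List.eq_nil_or_concat l with rfl | ⟨l, c, rfl⟩
      · simp at hk
      rw [List.concat_eq_append] at *
      simp only [word_append, word_singleton, List.length_append, List.length_singleton] at h1 h2 hk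
      rcases hl c (by simp) with rfl | rfl
      · have := h2 l (by rw [mul_s_mul_s])
        omega
      · rw [ih c i l (by omega) (fun a ha => (hl a (by simp [ha])).symm), alternating]
        · intro l' h
          have := h1 (l' ++ [c]) (by rw [word_append, word_singleton, h])
          simp only [List.length_append, List.length_singleton] at this
          omega
        · intro l' h
          have := h1 l' h
          omega
  have hk := halt _ i j l rfl hl hmin hmin'
  have h2m := R.two_le_m i j hij
  have hlt : l.length + 1 ≤ R.m i j := by
    by_contra hcon
    obtain ⟨d, hd⟩ := Nat.exists_eq_add_of_le (show R.m i j ≤ l.length by omega)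
    obtain ⟨p, hp, h⟩ := exists_alternating_add i j d (R.m i j)
    obtain ⟨m', hm'⟩ : ∃ m', R.m i j = m' + 1 := ⟨R.m i j - 1, by omega⟩
    have := hmin' (p ++ alternating i j m') (by
      rw [hk, hd, h, word_append, word_append, R.word_alternating_m hij, hm', alternating,
        word_append, word_singleton, ← mul_assoc, mul_s_mul_s])
    rw [List.length_append, length_alternating] at this
    omega
  have hm0 : (0 : ℝ) < R.m i j := by exact_mod_cast (by omega : 0 < R.m i j)
  have hlt' : (l.length : ℝ) + 1 ≤ R.m i j := by exact_mod_cast hlt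
  have hs : 0 < Real.sin (Real.pi / R.m i j) := by
    apply Real.sin_pos_of_pos_of_lt_pi (by positivity)
    rw [div_lt_iff₀ hm0]
    have : (2 : ℝ) ≤ R.m i j := by exact_mod_cast h2m
    nlinarith [Real.pi_pos]
  have hsin : ∀ t : ℝ, 0 ≤ t → t ≤ R.m i j → 0 ≤ Real.sin (t * (Real.pi / R.m i j)) := by
    intro t h0 h1
    apply Real.sin_nonneg_of_nonneg_of_le_pi (by positivity)
    rw [mul_div_assoc', div_le_iff₀ hm0]
    nlinarith [Real.pi_pos]
  have hf := R.f_word_alternating l.length i j hij x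
  rw [← hk] at hf
  refine nonneg_of_mul_nonneg_right ?_ hs
  rw [hf]
  refine add_nonneg (mul_nonneg (hsin _ (by positivity) hlt') ?_)
    (mul_nonneg (hsin _ (by positivity) (by linarith)) ?_) <;> split_ifs <;> assumption

/-- If `w` does not become shorter by multiplication with `s i`, then the image under `w` of the
half space `0 ≤ f i` contains the fundamental chamber. -/
theorem f_nonneg_of_len_le {w : Equiv.Perm X} (hw : w ∈ R.group) {i : ι}
    (hi : R.len w ≤ R.len (w * R.s i)) {x : X} (hx : x ∈ R.chamber) : 0 ≤ R.f i (w⁻¹ x) := by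
  classical
  obtain ⟨N, hN⟩ : ∃ N, R.len w = N := ⟨_, rfl⟩
  induction N using Nat.strong_induction_on generalizing w i with
  | _ N ih =>
    subst hN
    by_cases hw1 : w = 1
    · rw [hw1]
      simpa using hx i
    obtain ⟨j, hj⟩ := R.exists_len_mul_s_lt hw hw1
    have hij : i ≠ j := by
      rintro rfl
      omega
    -- `w = u * word l` with `u` as short as possible, where `l` is a word in `i` and `j`
    have hex : ∃ k, ∃ (u : Equiv.Perm X) (l : List ι), R.len u = k ∧ u ∈ R.group ∧
        (∀ a ∈ l, a = i ∨ a = j) ∧ w = u * R.word l ∧ R.len u + l.length ≤ R.len w :=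
      ⟨_, w * R.s j, [j], rfl, mul_mem hw (R.s_mem j), by simp,
        by rw [word_singleton, mul_s_mul_s], by simpa using hj⟩
    obtain ⟨u, l, hk, hu, hl, hul, hlen⟩ := Nat.find_spec hex
    have hklt : R.len u < R.len w := by
      rw [hk]
      exact lt_of_le_of_lt (Nat.find_min' hex ⟨w * R.s j, [j], rfl, mul_mem hw (R.s_mem j), by simp,
        by rw [word_singleton, mul_s_mul_s], by simpa using hj⟩) (by omega)
    have hmin : ∀ l', R.word l' = R.word l → l.length ≤ l'.length := by
      intro l' h
      have := R.len_mul_word_le hu l'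
      rw [h, ← hul] at this
      omega
    have hmin' : ∀ l', R.word l' = R.word l * R.s i → l.length ≤ l'.length := by
      intro l' h
      have := R.len_mul_word_le hu l'
      rw [h, ← mul_assoc, ← hul] at this
      omega
    have hu' : ∀ c, c = i ∨ c = j → R.len u ≤ R.len (u * R.s c) := by
      intro c hc
      by_contra hcon
      refine Nat.find_min hex (m := R.len (u * R.s c)) (by omega)
        ⟨u * R.s c, c :: l, rfl, mul_mem hu (R.s_mem c), ?_, ?_, ?_⟩
      · intro a ha
        rcases List.mem_cons.1 ha with rfl | ha
        · exact hc
        · exact hl a ha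
      · rw [word_cons, ← mul_assoc, mul_s_mul_s, hul]
      · simp only [List.length_cons]
        omega
    have hfin := R.f_nonneg_of_dihedral hij l hl hmin hmin'
      (ih _ hklt hu (hu' i (Or.inl rfl)) rfl) (ih _ hklt hu (hu' j (Or.inr rfl)) rfl)
    rwa [hul, mul_inv_rev, Equiv.Perm.mul_apply]

/-- The fundamental chamber meets every orbit at most once, and the stabilizers of its points are
generated by the reflections that they contain. -/
theorem eq_and_mem_closure_of_mem_chamber {w : Equiv.Perm X} (hw : w ∈ R.group) {x : X}
    (hx : x ∈ R.chamber) (hwx : w x ∈ R.chamber) :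
    w x = x ∧ w ∈ Subgroup.closure (R.s '' {i | R.f i x = 0}) := by
  obtain ⟨N, hN⟩ : ∃ N, R.len w = N := ⟨_, rfl⟩
  induction N using Nat.strong_induction_on generalizing w with
  | _ N ih =>
    subst hN
    by_cases hw1 : w = 1
    · rw [hw1]
      exact ⟨rfl, one_mem _⟩
    obtain ⟨i, hi⟩ := R.exists_len_mul_s_lt hw hw1
    have h1 := R.f_nonneg_of_len_le (mul_mem hw (R.s_mem i)) (i := i)
      (by rw [mul_s_mul_s]; omega) hwx
    rw [mul_inv_rev, s_inv, Equiv.Perm.mul_apply, ← Equiv.Perm.mul_apply w⁻¹, inv_mul_cancel,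
      Equiv.Perm.one_apply, f_s_self] at h1
    have h0 : R.f i x = 0 := le_antisymm (by linarith) (hx i)
    have hfix : (w * R.s i) x = w x := by rw [Equiv.Perm.mul_apply, R.s_apply i x h0]
    obtain ⟨h2, h3⟩ := ih _ (by omega) (mul_mem hw (R.s_mem i)) (by rw [hfix]; exact hwx) rfl
    refine ⟨by rw [← hfix, h2], ?_⟩
    have := mul_mem h3 (Subgroup.subset_closure (Set.mem_image_of_mem R.s h0))
    rwa [mul_s_mul_s] at this

end ReflectionSystem

/-! ### Tilings with a height function -/

/-- The combinatorial description of a tiling by `n`-gons, `q` of which meet at each vertex, with a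
height function on the tiles. The elements of the group `D` are the oriented edges ("darts") of the
tiling. The dart `g` has its tile to the left and starts at the vertex `v g`; the next dart of the
tile is `g * a`, the next dart that starts at the same vertex is `g * b`, and `g * a * b` is the
dart `g` with the opposite orientation. -/
structure MorseTiling (n q : ℕ) (D V : Type*) [Group D] where
  /-- the rotation about a tile -/
  a : D
  /-- the rotation about a vertex -/
  b : D
  /-- the initial vertex of a dart -/
  v : D → V
  /-- the height of the tile to the left of a dart -/
  h : D → ℝ
  five_le_n : 5 ≤ n
  four_le_q : 4 ≤ q
  a_pow : a ^ n = 1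
  b_pow : b ^ q = 1
  a_mul_b : a * b * (a * b) = 1
  v_surj : Function.Surjective v
  v_eq_iff : ∀ g g', v g = v g' ↔ ∃ i : ℤ, g' = g * b ^ i
  dvd_of_v_mul_a_zpow : ∀ g (i : ℤ), v (g * a ^ i) = v g → (n : ℤ) ∣ i
  dvd_of_v_mul_b_zpow_mul_a : ∀ g (i : ℤ), v (g * b ^ i * a) = v (g * a) → (q : ℤ) ∣ i
  h_eq_iff : ∀ g g', h g = h g' ↔ ∃ i : ℤ, g' = g * a ^ i
  finite_h_le : ∀ C, (Set.range h ∩ Set.Iic C).Finite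
  /-- only the base tile has no lower neighbour -/
  exists_eq_a_zpow : ∀ g, (∀ i : ℤ, ¬ h (g * a ^ i * a * b) < h (g * a ^ i)) → ∃ i : ℤ, g = a ^ i
  /-- the sides of a tile that separate it from lower tiles are pairwise adjacent -/
  dvd_of_lower : ∀ g (i : ℤ), h (g * a * b) < h g → h (g * a ^ i * a * b) < h (g * a ^ i) →
    (n : ℤ) ∣ i ∨ (n : ℤ) ∣ i - 1 ∨ (n : ℤ) ∣ i + 1
  /-- only one of the tiles around a vertex is lower than the two next to it -/
  dvd_of_local_min : ∀ g (i : ℤ), h g < h (g * b) → h g < h (g * b⁻¹) →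
    h (g * b ^ i) < h (g * b ^ i * b) → h (g * b ^ i) < h (g * b ^ i * b⁻¹) → (q : ℤ) ∣ i
  /-- the tile next to the lowest one at a vertex is not the highest one -/
  lt_of_local_min : ∀ g, h g < h (g * b) → h g < h (g * b⁻¹) → h (g * b) < h (g * b * b)

namespace MorseTiling

variable {n q : ℕ} {D V : Type*} [Group D] (M : MorseTiling n q D V)

/-- The undirected edge of a dart. -/
def edge (g : D) : Sym2 V := s(M.v g, M.v (g * M.a))

/-- A dart is visible if its tile is higher than the tile on the other side of the edge. -/
def Visible (g : D) : Prop := M.h (g * M.a * M.b) < M.h g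

/-- A dart is fresh if its tile is the lowest one at its initial vertex. -/
def Fresh (g : D) : Prop := ¬ M.Visible g ∧ ¬ M.Visible (g * M.a⁻¹)

/-- The first visible dart of a tile. -/
def Front (g : D) : Prop := M.Visible g ∧ ¬ M.Visible (g * M.a⁻¹)

lemma aba : M.a * M.b * M.a = M.b⁻¹ := by
  rw [eq_inv_iff_mul_eq_one, mul_assoc _ M.a, M.a_mul_b]

lemma mul_ab_ab (g : D) : g * M.a * M.b * M.a * M.b = g := by
  rw [mul_assoc, mul_assoc, mul_assoc g, ← mul_assoc M.b, ← mul_assoc, mul_assoc, mul_assoc,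
    ← mul_assoc M.a, M.a_mul_b, mul_one]

lemma v_mul_b_zpow (g : D) (i : ℤ) : M.v (g * M.b ^ i) = M.v g :=
  ((M.v_eq_iff _ _).2 ⟨i, rfl⟩).symm

lemma v_mul_b (g : D) : M.v (g * M.b) = M.v g := by simpa using M.v_mul_b_zpow g 1

lemma v_mul_b_inv (g : D) : M.v (g * M.b⁻¹) = M.v g := by simpa using M.v_mul_b_zpow g (-1)

lemma h_mul_a_zpow (g : D) (i : ℤ) : M.h (g * M.a ^ i) = M.h g :=
  ((M.h_eq_iff _ _).2 ⟨i, rfl⟩).symm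

lemma h_mul_a (g : D) : M.h (g * M.a) = M.h g := by simpa using M.h_mul_a_zpow g 1

lemma h_mul_a_inv (g : D) : M.h (g * M.a⁻¹) = M.h g := by simpa using M.h_mul_a_zpow g (-1)

lemma a_zpow_eq_one {i : ℤ} (hi : (n : ℤ) ∣ i) : M.a ^ i = 1 := by
  obtain ⟨c, rfl⟩ := hi
  rw [zpow_mul, zpow_natCast, M.a_pow, one_zpow]

lemma b_zpow_eq_one {i : ℤ} (hi : (q : ℤ) ∣ i) : M.b ^ i = 1 := by
  obtain ⟨c, rfl⟩ := hi
  rw [zpow_mul, zpow_natCast, M.b_pow, one_zpow]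

lemma dvd_of_a_zpow_eq_one {i : ℤ} (hi : M.a ^ i = 1) : (n : ℤ) ∣ i :=
  M.dvd_of_v_mul_a_zpow 1 i (by rw [hi, one_mul])

lemma dvd_of_b_zpow_eq_a_zpow {i j : ℤ} (h : M.b ^ i = M.a ^ j) : (q : ℤ) ∣ i := by
  have h1 : (n : ℤ) ∣ j := M.dvd_of_v_mul_a_zpow 1 j (by rw [← h, M.v_mul_b_zpow])
  rw [M.a_zpow_eq_one h1] at h
  exact M.dvd_of_v_mul_b_zpow_mul_a 1 i (by rw [h, one_mul])

lemma not_dvd_n (M : MorseTiling n q D V) {i : ℤ} (h0 : i ≠ 0) (h1 : -5 < i) (h2 : i < 5) :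
    ¬ (n : ℤ) ∣ i := by
  have := M.five_le_n
  intro h
  have := Int.le_of_dvd (abs_pos.2 h0) ((dvd_abs _ _).2 h)
  rw [le_abs'] at this
  omega

lemma not_dvd_q (M : MorseTiling n q D V) {i : ℤ} (h0 : i ≠ 0) (h1 : -4 < i) (h2 : i < 4) :
    ¬ (q : ℤ) ∣ i := by
  have := M.four_le_q
  intro h
  have := Int.le_of_dvd (abs_pos.2 h0) ((dvd_abs _ _).2 h)
  rw [le_abs'] at this
  omega

lemma h_mul_b_zpow_ne (g : D) {i : ℤ} (hi : ¬ (q : ℤ) ∣ i) : M.h g ≠ M.h (g * M.b ^ i) := by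
  intro h
  obtain ⟨j, hj⟩ := (M.h_eq_iff _ _).1 h
  exact hi (M.dvd_of_b_zpow_eq_a_zpow (mul_left_cancel hj))

lemma h_mul_b_ne (g : D) : M.h g ≠ M.h (g * M.b) := by
  simpa using M.h_mul_b_zpow_ne g (M.not_dvd_q (i := 1) (by norm_num) (by norm_num) (by norm_num))

lemma visible_mul_a_inv_iff (g : D) : M.Visible (g * M.a⁻¹) ↔ M.h (g * M.b) < M.h g := by
  rw [Visible, inv_mul_cancel_right, h_mul_a_inv]

lemma visible_iff (g : D) : M.Visible g ↔ M.h (g * M.b⁻¹) < M.h g := by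
  rw [Visible, ← M.h_mul_a (g * M.a * M.b), mul_assoc g, mul_assoc g, M.aba]

lemma not_visible_iff (g : D) : ¬ M.Visible g ↔ M.h g < M.h (g * M.b⁻¹) := by
  rw [visible_iff, not_lt, lt_iff_le_and_ne, and_iff_left]
  have := (M.h_mul_b_ne (g * M.b⁻¹)).symm
  rwa [inv_mul_cancel_right] at this

lemma not_visible_mul_a_inv_iff (g : D) : ¬ M.Visible (g * M.a⁻¹) ↔ M.h g < M.h (g * M.b) := by
  rw [visible_mul_a_inv_iff, not_lt, lt_iff_le_and_ne, and_iff_left (M.h_mul_b_ne g)]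

lemma visible_mul_b_iff (g : D) : M.Visible (g * M.b) ↔ ¬ M.Visible (g * M.a⁻¹) := by
  rw [visible_iff, not_visible_mul_a_inv_iff, mul_inv_cancel_right]

/-- Exactly one of the two darts of an edge is visible. -/
lemma visible_mul_ab_iff (g : D) : M.Visible (g * M.a * M.b) ↔ ¬ M.Visible g := by
  rw [visible_mul_b_iff, mul_inv_cancel_right]

lemma fresh_iff (g : D) : M.Fresh g ↔ M.h g < M.h (g * M.b⁻¹) ∧ M.h g < M.h (g * M.b) := by
  rw [Fresh, not_visible_iff, not_visible_mul_a_inv_iff]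

lemma Visible.dvd {g : D} {i : ℤ} (h : M.Visible g) (h' : M.Visible (g * M.a ^ i)) :
    (n : ℤ) ∣ i ∨ (n : ℤ) ∣ i - 1 ∨ (n : ℤ) ∣ i + 1 := M.dvd_of_lower g i h h'

lemma Visible.not_visible {g : D} (h : M.Visible g) (i : ℤ) (h2 : 2 ≤ |i|) (h3 : |i| ≤ 3) :
    ¬ M.Visible (g * M.a ^ i) := by
  intro h'
  have h4 := abs_le.1 h3
  rw [le_abs] at h2
  rcases h.dvd M h' with h | h | h <;> revert h <;> apply M.not_dvd_n <;> omega

lemma Front.not_visible_two {r : D} (h : M.Front r) : ¬ M.Visible (r * M.a⁻¹ * M.a⁻¹) := by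
  have := h.1.not_visible M (-2) (by norm_num) (by norm_num)
  rwa [zpow_neg, zpow_two, mul_inv_rev, ← mul_assoc] at this

lemma Front.not_visible_three {r : D} (h : M.Front r) :
    ¬ M.Visible (r * M.a⁻¹ * M.a⁻¹ * M.a⁻¹) := by
  have := h.1.not_visible M (-3) (by norm_num) (by norm_num)
  rwa [show r * M.a ^ (-3 : ℤ) = r * M.a⁻¹ * M.a⁻¹ * M.a⁻¹ by group] at this

/-- A tile has only one front dart. -/
lemma Front.eq {r : D} {i : ℤ} (h : M.Front r) (h' : M.Front (r * M.a ^ i)) :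
    r * M.a ^ i = r := by
  rcases h.1.dvd M h'.1 with h1 | h1 | h1
  · rw [M.a_zpow_eq_one h1, mul_one]
  · refine absurd h.1 ?_
    have h2 := M.a_zpow_eq_one h1
    have : r * M.a ^ i * M.a⁻¹ = r := by
      rw [zpow_sub_one] at h2
      rw [mul_assoc, h2, mul_one]
    rw [← this]
    exact h'.2
  · refine absurd h'.1 ?_
    have h2 := M.a_zpow_eq_one h1
    have : M.a ^ i = M.a⁻¹ := by
      rw [zpow_add_one] at h2
      exact eq_inv_of_mul_eq_one_left h2
    rw [this]
    exact h.2

lemma exists_front {g : D} (hg : ∃ i : ℤ, M.Visible (g * M.a ^ i)) :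
    ∃ i : ℤ, M.Front (g * M.a ^ i) := by
  obtain ⟨i, hi⟩ := hg
  by_cases h : M.Visible (g * M.a ^ i * M.a⁻¹)
  · refine ⟨i - 1, ?_, ?_⟩
    · rwa [zpow_sub_one, ← mul_assoc]
    · have := hi.not_visible M (-2) (by norm_num) (by norm_num)
      rwa [show g * M.a ^ (i - 1) * M.a⁻¹ = g * M.a ^ i * M.a ^ (-2 : ℤ) by group]
  · exact ⟨i, hi, h⟩

/-! ### The lowest tile at a vertex -/

lemma Fresh.eq {g g' : D} (h : M.Fresh g) (h' : M.Fresh g') (hv : M.v g = M.v g') : g = g' := by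
  obtain ⟨i, rfl⟩ := (M.v_eq_iff _ _).1 hv
  rw [fresh_iff] at h h'
  rw [M.b_zpow_eq_one (M.dvd_of_local_min g i h.2 h.1 h'.2 h'.1), mul_one]

lemma exists_min (g : D) :
    ∃ g', M.v g' = M.v g ∧ M.Fresh g' ∧ ∀ i : ℤ, M.h g' ≤ M.h (g * M.b ^ i) := by
  have hfin : (Set.range fun i : ℤ => M.h (g * M.b ^ i)).Finite := by
    have hq : (0 : ℤ) < q := by have := M.four_le_q; omega
    refine ((Set.finite_Ico (0 : ℤ) q).image fun i : ℤ => M.h (g * M.b ^ i)).subset ?_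
    rintro _ ⟨i, rfl⟩
    refine ⟨i % q, ⟨Int.emod_nonneg _ hq.ne', Int.emod_lt_of_pos _ hq⟩, ?_⟩
    have : M.b ^ (i % q) = M.b ^ i := by
      conv_rhs => rw [← Int.emod_add_mul_ediv i q, zpow_add, M.b_zpow_eq_one (dvd_mul_right _ _),
        mul_one]
    simp only [this]
  obtain ⟨_, ⟨⟨i, rfl⟩, hi⟩⟩ := hfin.exists_minimal (Set.range_nonempty _)
  have hmin : ∀ j : ℤ, M.h (g * M.b ^ i) ≤ M.h (g * M.b ^ j) := by
    intro j
    by_contra hcon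
    exact hcon (hi ⟨j, rfl⟩ (le_of_not_ge hcon))
  refine ⟨g * M.b ^ i, M.v_mul_b_zpow _ _, ?_, hmin⟩
  rw [fresh_iff]
  constructor
  · refine lt_of_le_of_ne ?_ ?_
    · rw [mul_assoc, ← zpow_sub_one]
      exact hmin _
    · have := (M.h_mul_b_ne (g * M.b ^ i * M.b⁻¹)).symm
      rwa [inv_mul_cancel_right] at this
  · refine lt_of_le_of_ne ?_ (M.h_mul_b_ne _)
    rw [mul_assoc, ← zpow_add_one]
    exact hmin _

lemma Fresh.h_le {g g' : D} (h : M.Fresh g) (hv : M.v g = M.v g') : M.h g ≤ M.h g' := by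
  obtain ⟨i, rfl⟩ := (M.v_eq_iff _ _).1 hv
  obtain ⟨g', h1, h2, h3⟩ := M.exists_min g
  have := h3 i
  rwa [h2.eq M h h1] at this

lemma Fresh.h_lt {g g' : D} (h : M.Fresh g) (hv : M.v g = M.v g') (hne : g ≠ g') :
    M.h g < M.h g' := by
  refine lt_of_le_of_ne (h.h_le M hv) ?_
  obtain ⟨i, rfl⟩ := (M.v_eq_iff _ _).1 hv
  apply M.h_mul_b_zpow_ne
  intro h'
  exact hne (by rw [M.b_zpow_eq_one h', mul_one])

lemma exists_fresh (x : V) : ∃ g, M.v g = x ∧ M.Fresh g := by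
  obtain ⟨g, rfl⟩ := M.v_surj x
  obtain ⟨g', h1, h2, -⟩ := M.exists_min g
  exact ⟨g', h1, h2⟩

/-- The fresh dart that starts at a vertex. -/
def first (x : V) : D := (M.exists_fresh x).choose

@[simp] lemma v_first (x : V) : M.v (M.first x) = x := (M.exists_fresh x).choose_spec.1

lemma fresh_first (x : V) : M.Fresh (M.first x) := (M.exists_fresh x).choose_spec.2

lemma Fresh.first_eq {g : D} (h : M.Fresh g) : M.first (M.v g) = g :=
  (M.fresh_first _).eq M h (M.v_first _)

/-- The base tile is the lowest one, so that none of its darts is visible. -/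
lemma not_visible_a_zpow (i : ℤ) : ¬ M.Visible (M.a ^ i) := by
  have hne : (Set.range M.h ∩ Set.Iic (M.h 1)).Nonempty := ⟨M.h 1, ⟨1, rfl⟩, Set.mem_Iic.2 le_rfl⟩
  obtain ⟨_, ⟨⟨⟨g, rfl⟩, hg1⟩, hg⟩⟩ := (M.finite_h_le (M.h 1)).exists_minimal hne
  have hmin : ∀ g', M.h g ≤ M.h g' := by
    intro g'
    by_contra hcon
    have h1 := le_of_not_ge hcon
    exact hcon (hg ⟨⟨g', rfl⟩, h1.trans hg1⟩ h1)
  obtain ⟨j, rfl⟩ := M.exists_eq_a_zpow g (fun i => not_lt.2 (by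
    rw [M.h_mul_a_zpow]; exact hmin _))
  have h1 : M.h (M.a ^ i) = M.h (M.a ^ j) :=
    (M.h_eq_iff _ _).2 ⟨j - i, by rw [← zpow_add]; congr 1; ring⟩
  rw [Visible, h1, not_lt]
  exact hmin _

lemma not_visible_one : ¬ M.Visible 1 := by simpa using M.not_visible_a_zpow 0

lemma fresh_one : M.Fresh 1 := by
  refine ⟨M.not_visible_one, ?_⟩
  rw [one_mul, ← zpow_neg_one]
  exact M.not_visible_a_zpow _

lemma h_one_le (g : D) : M.h 1 ≤ M.h g := by
  have hne : (Set.range M.h ∩ Set.Iic (M.h g)).Nonempty := ⟨M.h g, ⟨g, rfl⟩, Set.mem_Iic.2 le_rfl⟩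
  obtain ⟨_, ⟨⟨⟨g', rfl⟩, hg1⟩, hg⟩⟩ := (M.finite_h_le (M.h g)).exists_minimal hne
  obtain ⟨j, rfl⟩ := M.exists_eq_a_zpow g' (fun i hi => by
    rw [M.h_mul_a_zpow] at hi
    exact absurd (hg ⟨⟨_, rfl⟩, hi.le.trans hg1⟩ hi.le) (not_le.2 hi))
  have h1 : M.h 1 = M.h (M.a ^ j) := (M.h_eq_iff _ _).2 ⟨j, by rw [one_mul]⟩
  rw [h1]
  exact hg1

/-! ### The dashed edges -/

/-- The condition on the front dart `r` of a tile that the tile of `r * b⁻¹` is the lowest one at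
the initial vertex of `r`, and that the dashed dart of that tile does not meet this vertex. If
`r * b⁻¹ * a * a` is the front dart of that tile, the position of the dashed dart depends on the
same condition for `r * b⁻¹ * a * a`; the quantifier over `k` unfolds this recursion, see
`open_iff`. -/
def Open (r : D) : Prop :=
  ∀ k : ℕ, (∀ i < k, M.Front ((fun r => r * M.b⁻¹ * M.a * M.a)^[i + 1] r)) →
    (fun r => M.Fresh (r * M.b⁻¹) ∧ r * M.b⁻¹ ≠ 1 ∧ r * M.b⁻¹ * M.a ≠ 1 ∧
      ¬ M.Front (r * M.b⁻¹ * M.a)) ((fun r => r * M.b⁻¹ * M.a * M.a)^[k] r)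

lemma open_iff (r : D) : M.Open r ↔ (M.Fresh (r * M.b⁻¹) ∧ r * M.b⁻¹ ≠ 1 ∧ r * M.b⁻¹ * M.a ≠ 1 ∧
    ¬ M.Front (r * M.b⁻¹ * M.a)) ∧
      (M.Front (r * M.b⁻¹ * M.a * M.a) → M.Open (r * M.b⁻¹ * M.a * M.a)) := by
  constructor
  · intro h
    refine ⟨h 0 (by simp), fun hf k hk => ?_⟩
    have := h (k + 1) (fun i hi => ?_)
    · rwa [Function.iterate_succ_apply] at this
    · rw [Function.iterate_succ_apply]
      rcases i with _ | i
      · exact hf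
      · exact hk i (by omega)
  · rintro ⟨h1, h2⟩ k hk
    rcases k with _ | k
    · exact h1
    · rw [Function.iterate_succ_apply]
      refine h2 (hk 0 (by omega)) k fun i hi => ?_
      have := hk (i + 1) (by omega)
      rwa [Function.iterate_succ_apply] at this

/-- The dashed dart of a tile: if the condition `Open` holds for the front dart, the dart that
precedes the front dart, and otherwise the dart before that. It is `a⁻¹` in the base tile. -/
def Dashed (g : D) : Prop :=
  g * M.a = 1 ∨ (M.Front (g * M.a) ∧ M.Open (g * M.a)) ∨
    (M.Front (g * M.a * M.a) ∧ ¬ M.Open (g * M.a * M.a))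

/-- A fresh dart is covered if its initial vertex is met by the dashed dart of its tile. -/
def Covered (g : D) : Prop := M.Dashed g ∨ M.Dashed (g * M.a⁻¹)

lemma Fresh.covered_iff {g : D} (h : M.Fresh g) : M.Covered g ↔ g = 1 ∨ g * M.a = 1 ∨
    M.Front (g * M.a) ∨ (M.Front (g * M.a * M.a) ∧ ¬ M.Open (g * M.a * M.a)) := by
  have h1 : ¬ M.Front g := fun h' => h.1 h'.1
  simp only [Covered, Dashed, inv_mul_cancel_right]
  tauto

lemma Fresh.open_mul_b_iff {g : D} (h : M.Fresh g) : M.Open (g * M.b) ↔ ¬ M.Covered g := by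
  rw [open_iff, mul_inv_cancel_right, h.covered_iff]
  grind

lemma Open.fresh {r : D} (h : M.Open r) : M.Fresh (r * M.b⁻¹) := ((M.open_iff r).1 h).1.1

/-- The initial vertex of a dashed dart is fresh. The final vertex is fresh, unless the dart
precedes the front dart of the tile. -/
lemma Dashed.fresh {g : D} (h : M.Dashed g) :
    M.Fresh g ∧ (M.Fresh (g * M.a) ∨ (M.Front (g * M.a) ∧ M.Open (g * M.a))) := by
  rcases h with h | h | h
  · have hg : g = M.a⁻¹ := eq_inv_of_mul_eq_one_left h
    refine ⟨?_, Or.inl (by rw [h]; exact M.fresh_one)⟩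
    rw [hg]
    refine ⟨?_, ?_⟩
    · rw [← zpow_neg_one]; exact M.not_visible_a_zpow _
    · rw [← mul_inv_rev, ← zpow_two, ← zpow_neg]; exact M.not_visible_a_zpow _
  · refine ⟨⟨?_, ?_⟩, Or.inr h⟩
    · have := h.1.2
      rwa [mul_inv_cancel_right] at this
    · have := h.1.not_visible_two
      rwa [mul_inv_cancel_right] at this
  · have h1 := h.1.2
    have h2 := h.1.not_visible_two
    have h3 := h.1.not_visible_three
    rw [mul_inv_cancel_right] at h1 h2 h3
    rw [mul_inv_cancel_right] at h2 h3
    exact ⟨⟨h2, h3⟩, Or.inl ⟨h1, by rwa [mul_inv_cancel_right]⟩⟩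

lemma Dashed.not_visible {g : D} (h : M.Dashed g) : ¬ M.Visible g := (h.fresh M).1.1

/-- Every tile has a dashed dart. -/
lemma exists_dashed (g : D) : ∃ i : ℤ, M.Dashed (g * M.a ^ i) := by
  by_cases h : ∃ i : ℤ, M.Visible (g * M.a ^ i)
  · obtain ⟨i, hi⟩ := M.exists_front h
    by_cases ho : M.Open (g * M.a ^ i)
    · refine ⟨i - 1, Or.inr (Or.inl ?_)⟩
      rw [show g * M.a ^ (i - 1) * M.a = g * M.a ^ i by group]
      exact ⟨hi, ho⟩
    · refine ⟨i - 2, Or.inr (Or.inr ?_)⟩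
      rw [show g * M.a ^ (i - 2) * M.a * M.a = g * M.a ^ i by group]
      exact ⟨hi, ho⟩
  · push Not at h
    obtain ⟨i, rfl⟩ := M.exists_eq_a_zpow g h
    exact ⟨-i - 1, Or.inl (by group)⟩

lemma a_ne_one : M.a ≠ 1 := by
  intro h
  exact M.not_dvd_n (i := 1) (by norm_num) (by norm_num) (by norm_num)
    (M.dvd_of_a_zpow_eq_one (by rw [h, one_zpow]))

/-- A tile has only one dashed dart. -/
lemma Dashed.eq {g : D} {i : ℤ} (h : M.Dashed g) (h' : M.Dashed (g * M.a ^ i)) :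
    g * M.a ^ i = g := by
  have e1 : g * M.a ^ i * M.a = g * M.a * M.a ^ i := by group
  have e2 : g * M.a ^ i * M.a * M.a = g * M.a * M.a * M.a ^ i := by group
  have e3 : g * M.a ^ i * M.a = g * M.a * M.a * M.a ^ (i - 1) := by group
  have e4 : g * M.a ^ i * M.a * M.a = g * M.a * M.a ^ (i + 1) := by group
  have hbase : ∀ g : D, ∀ j : ℤ, g * M.a = 1 → ¬ M.Visible (g * M.a ^ j) := by
    intro g j hg
    rw [eq_inv_of_mul_eq_one_left hg, ← zpow_neg_one, ← zpow_add]
    exact M.not_visible_a_zpow _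
  have hb1 : ∀ g : D, g * M.a = 1 → ∀ i : ℤ, ¬ M.Front (g * M.a ^ i * M.a) := by
    intro g hg i h
    refine hbase g (i + 1) hg ?_
    rw [zpow_add_one, ← mul_assoc]
    exact h.1
  have hb2 : ∀ g : D, g * M.a = 1 → ∀ i : ℤ, ¬ M.Front (g * M.a ^ i * M.a * M.a) := by
    intro g hg i h
    refine hbase g (i + 2) hg ?_
    rw [show g * M.a ^ (i + 2) = g * M.a ^ i * M.a * M.a by group]
    exact h.1
  have hg : g * M.a ^ i * M.a ^ (-i) = g := by group
  rcases h with h | h | h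
  · rcases h' with h' | h' | h'
    · exact mul_right_cancel (h'.trans h.symm)
    · exact absurd h'.1 (hb1 g h i)
    · exact absurd h'.1 (hb2 g h i)
  · rcases h' with h' | h' | h'
    · exact absurd h.1 (by have := hb1 _ h' (-i); rwa [hg] at this)
    · rw [e1] at h'
      exact mul_right_cancel (e1.trans (h.1.eq M h'.1))
    · rw [e4] at h'
      have := h.1.eq M h'.1
      rw [this] at h'
      exact absurd h.2 h'.2
  · rcases h' with h' | h' | h'
    · exact absurd h.1 (by have := hb2 _ h' (-i); rwa [hg] at this)
    · rw [e3] at h'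
      have := h.1.eq M h'.1
      rw [this] at h'
      exact absurd h'.2 h.2
    · rw [e2] at h'
      exact mul_right_cancel (mul_right_cancel (e2.trans (h.1.eq M h'.1)))

/-- The dashed edges form a perfect matching. -/
theorem existsUnique_dashed (x : V) :
    ∃! d, M.Dashed d ∧ (M.v d = x ∨ M.v (d * M.a) = x) := by
  obtain ⟨g, rfl, hg⟩ := M.exists_fresh x
  have key : ∀ d, M.Dashed d → (M.v d = M.v g ∨ M.v (d * M.a) = M.v g) →
      (d = g ∧ M.Dashed g) ∨ (d = g * M.a⁻¹ ∧ M.Dashed (g * M.a⁻¹)) ∨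
        (d = g * M.b * M.a⁻¹ ∧ ¬ M.Covered g) := by
    rintro d hd (h | h)
    · have := (hd.fresh M).1.eq M hg h
      subst this
      exact Or.inl ⟨rfl, hd⟩
    · rcases (hd.fresh M).2 with h' | h'
      · have := h'.eq M hg h
        subst this
        refine Or.inr (Or.inl ⟨by rw [mul_inv_cancel_right], by rwa [mul_inv_cancel_right]⟩)
      · have := (h'.2.fresh M).eq M hg (by rw [v_mul_b_inv, h])
        have hb : d * M.a = g * M.b := by rw [← this, inv_mul_cancel_right]
        refine Or.inr (Or.inr ⟨by rw [← hb, mul_inv_cancel_right], ?_⟩)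
        rw [hb] at h'
        exact (hg.open_mul_b_iff M).1 h'.2
  have hnot : M.Dashed g → ¬ M.Dashed (g * M.a⁻¹) := by
    intro h h'
    rw [← zpow_neg_one] at h'
    have := h.eq M h'
    rw [zpow_neg_one, mul_eq_left, inv_eq_one] at this
    exact M.a_ne_one this
  have hex : ∃ d, M.Dashed d ∧ (M.v d = M.v g ∨ M.v (d * M.a) = M.v g) := by
    by_cases hc : M.Covered g
    · rcases hc with hc | hc
      · exact ⟨_, hc, Or.inl rfl⟩
      · exact ⟨_, hc, Or.inr (by rw [inv_mul_cancel_right])⟩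
    · refine ⟨g * M.b * M.a⁻¹, Or.inr (Or.inl ?_), Or.inr ?_⟩
      · rw [inv_mul_cancel_right]
        refine ⟨⟨(M.visible_mul_b_iff g).2 hg.2, ?_⟩, (hg.open_mul_b_iff M).2 hc⟩
        rw [not_visible_mul_a_inv_iff]
        have := (M.fresh_iff g).1 hg
        exact M.lt_of_local_min g this.2 this.1
      · rw [inv_mul_cancel_right, v_mul_b]
  obtain ⟨d, hd⟩ := hex
  refine ⟨d, hd, fun d' hd' => ?_⟩
  have h1 := key d hd.1 hd.2
  have h2 := key d' hd'.1 hd'.2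
  rcases h1 with ⟨rfl, h1⟩ | ⟨rfl, h1⟩ | ⟨rfl, h1⟩ <;>
    rcases h2 with ⟨rfl, h2⟩ | ⟨rfl, h2⟩ | ⟨rfl, h2⟩ <;> first | rfl | skip
  · exact absurd h2 (hnot h1)
  · exact absurd (Or.inl h1) h2
  · exact absurd h1 (hnot h2)
  · exact absurd (Or.inr h1) h2
  · exact absurd (Or.inl h2) h1
  · exact absurd (Or.inr h2) h1

end MorseTiling

namespace MorseTiling

variable {n q : ℕ} {D V : Type*} [Group D] (M : MorseTiling n q D V)

/-! ### The graphs of solid and of dashed edges -/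

lemma v_mul_a_ne (g : D) : M.v (g * M.a) ≠ M.v g := by
  intro h
  exact M.not_dvd_n (i := 1) (by norm_num) (by norm_num) (by norm_num)
    (M.dvd_of_v_mul_a_zpow g 1 (by rwa [zpow_one]))

lemma edge_mul_ab (g : D) : M.edge (g * M.a * M.b) = M.edge g := by
  have h : g * M.a * M.b * M.a = g * M.b⁻¹ := by rw [mul_assoc g, mul_assoc g, M.aba]
  rw [edge, edge, h, v_mul_b, v_mul_b_inv, Sym2.eq_swap]

lemma edge_eq_iff (g g' : D) : M.edge g = M.edge g' ↔ g' = g ∨ g' = g * M.a * M.b := by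
  have key : ∀ g g' : D, M.v g = M.v g' → M.v (g * M.a) = M.v (g' * M.a) → g' = g := by
    intro g g' h1 h2
    obtain ⟨i, rfl⟩ := (M.v_eq_iff _ _).1 h1
    rw [M.b_zpow_eq_one (M.dvd_of_v_mul_b_zpow_mul_a g i h2.symm), mul_one]
  constructor
  · intro h
    rcases Sym2.eq_iff.1 h with ⟨h1, h2⟩ | ⟨h1, h2⟩
    · exact Or.inl (key _ _ h1 h2)
    · refine Or.inr (key _ _ ?_ ?_)
      · rw [v_mul_b, h2]
      · rw [← h1, mul_assoc g, mul_assoc g, M.aba, v_mul_b_inv]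
  · rintro (rfl | rfl)
    · rfl
    · exact (M.edge_mul_ab g).symm

lemma eq_of_edge_eq {g g' : D} (h : M.edge g = M.edge g') (hg : ¬ M.Visible g)
    (hg' : ¬ M.Visible g') : g = g' := by
  rcases (M.edge_eq_iff _ _).1 h with rfl | rfl
  · rfl
  · exact absurd ((M.visible_mul_ab_iff g).2 hg) hg'

/-- The graph of the edges of the darts that satisfy `P`. -/
def graph (P : D → Prop) : SimpleGraph V where
  Adj x y := ∃ d, P d ∧ M.edge d = s(x, y)
  symm := ⟨fun x y ⟨d, h1, h2⟩ => ⟨d, h1, by rw [h2, Sym2.eq_swap]⟩⟩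
  loopless := ⟨fun x ⟨d, _, h2⟩ => by
    rcases Sym2.eq_iff.1 h2 with h | h <;> exact M.v_mul_a_ne d (h.2.trans h.1.symm)⟩

lemma mem_edgeSet_graph {P : D → Prop} {e : Sym2 V} :
    e ∈ (M.graph P).edgeSet ↔ ∃ d, P d ∧ M.edge d = e := by
  induction e with | h x y => rfl

/-- The graph of the dashed edges. -/
def dashed : SimpleGraph V := M.graph M.Dashed

/-- The graph of the solid edges. -/
def solid : SimpleGraph V := M.graph fun d => ¬ M.Visible d ∧ ¬ M.Dashed d

lemma solid_sup_dashed : M.solid ⊔ M.dashed = M.graph fun _ => True := by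
  ext x y
  rw [SimpleGraph.sup_adj]
  constructor
  · rintro (⟨d, -, h⟩ | ⟨d, -, h⟩) <;> exact ⟨d, trivial, h⟩
  · rintro ⟨d, -, h⟩
    obtain ⟨d, hd, h⟩ : ∃ d, ¬ M.Visible d ∧ M.edge d = s(x, y) := by
      by_cases hd : M.Visible d
      · refine ⟨d * M.a * M.b, ?_, by rw [edge_mul_ab, h]⟩
        rwa [visible_mul_ab_iff, not_not]
      · exact ⟨d, hd, h⟩
    by_cases h' : M.Dashed d
    · exact Or.inr ⟨d, h', h⟩
    · exact Or.inl ⟨d, ⟨hd, h'⟩, h⟩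

lemma disjoint_solid_dashed : Disjoint M.solid M.dashed := by
  rw [SimpleGraph.disjoint_left]
  rintro x y ⟨d, hd, h⟩ ⟨d', hd', h'⟩
  have := M.eq_of_edge_eq (h.trans h'.symm) hd.1 hd'.not_visible
  exact hd.2 (this ▸ hd')

theorem existsUnique_dashed_adj (x : V) : ∃! y, M.dashed.Adj x y := by
  obtain ⟨d, ⟨hd, hx⟩, hu⟩ := M.existsUnique_dashed x
  have hu' : ∀ d' y, M.Dashed d' → M.edge d' = s(x, y) → d' = d := by
    intro d' y h h'
    refine hu d' ⟨h, ?_⟩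
    rcases Sym2.eq_iff.1 h' with h' | h'
    · exact Or.inl h'.1
    · exact Or.inr h'.2
  obtain ⟨y, hy⟩ : ∃ y, M.edge d = s(x, y) := by
    rcases hx with hx | hx
    · exact ⟨M.v (d * M.a), by rw [edge, hx]⟩
    · exact ⟨M.v d, by rw [edge, hx, Sym2.eq_swap]⟩
  refine ⟨y, ⟨d, hd, hy⟩, ?_⟩
  rintro y' ⟨d', hd', h'⟩
  rw [hu' d' y' hd' h', hy] at h'
  exact (Sym2.congr_right.1 h').symm

lemma ncard_neighborSet (x : V) : ((M.graph fun _ => True).neighborSet x).ncard = q := by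
  obtain ⟨g, rfl⟩ := M.v_surj x
  have hq : (0 : ℤ) < q := by have := M.four_le_q; omega
  have h : (M.graph fun _ => True).neighborSet (M.v g) =
      (fun i : ℤ => M.v (g * M.b ^ i * M.a)) '' Set.Ico (0 : ℤ) q := by
    ext y
    constructor
    · rintro ⟨d, -, h⟩
      obtain ⟨d, h1, h2⟩ : ∃ d, M.v g = M.v d ∧ M.v (d * M.a) = y := by
        rcases Sym2.eq_iff.1 h with h | h
        · exact ⟨d, h.1.symm, h.2⟩
        · refine ⟨d * M.a * M.b, by rw [v_mul_b, h.2], ?_⟩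
          rw [mul_assoc d, mul_assoc d, M.aba, v_mul_b_inv, h.1]
      obtain ⟨i, rfl⟩ := (M.v_eq_iff _ _).1 h1
      refine ⟨i % q, ⟨Int.emod_nonneg _ hq.ne', Int.emod_lt_of_pos _ hq⟩, ?_⟩
      have : M.b ^ (i % q) = M.b ^ i := by
        conv_rhs => rw [← Int.emod_add_mul_ediv i q, zpow_add, M.b_zpow_eq_one (dvd_mul_right _ _),
          mul_one]
      simp only [this, h2]
    · rintro ⟨i, -, rfl⟩
      exact ⟨g * M.b ^ i, trivial, by rw [edge, v_mul_b_zpow]⟩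
  rw [h, Set.InjOn.ncard_image, Set.ncard_eq_toFinset_card']
  · simp
  · intro i hi j hj hij
    have : M.v (g * M.b ^ j * M.b ^ (i - j) * M.a) = M.v (g * M.b ^ j * M.a) := by
      rw [mul_assoc g, ← zpow_add, add_sub_cancel]
      exact hij
    have h1 := M.dvd_of_v_mul_b_zpow_mul_a _ _ this
    have h2 := Int.eq_zero_of_abs_lt_dvd h1 (by
      rw [Set.mem_Ico] at hi hj
      rw [abs_lt]
      constructor <;> omega)
    omega

theorem ncard_solid_neighborSet (x : V) : (M.solid.neighborSet x).ncard = q - 1 := by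
  obtain ⟨y, hy, hu⟩ := M.existsUnique_dashed_adj x
  have h : M.solid.neighborSet x = (M.graph fun _ => True).neighborSet x \ {y} := by
    ext z
    rw [← solid_sup_dashed]
    simp only [SimpleGraph.mem_neighborSet, Set.mem_sdiff, SimpleGraph.sup_adj,
      Set.mem_singleton_iff]
    constructor
    · intro h
      refine ⟨Or.inl h, ?_⟩
      rintro rfl
      exact SimpleGraph.disjoint_left.1 M.disjoint_solid_dashed _ _ h hy
    · rintro ⟨h | h, h'⟩
      · exact h
      · exact absurd (hu z h) h'
  rw [h, Set.ncard_sdiff_singleton_of_mem, ncard_neighborSet]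
  rw [← solid_sup_dashed]
  exact Or.inr hy

/-! ### The enumeration of the tiles by height -/

lemma exists_h_lt (g : D) : ∃ g', M.h g < M.h g' := by
  obtain ⟨i, hi⟩ : ∃ i : ℤ, ¬ M.Visible (g * M.a ^ i) := by
    by_contra hcon
    push Not at hcon
    exact (hcon 0).not_visible M 2 (by norm_num) (by norm_num)
      (by rw [mul_assoc, ← zpow_add]; exact hcon _)
  rw [not_visible_iff, h_mul_a_zpow] at hi
  exact ⟨_, hi⟩

lemma exists_index : ∃ f : D → ℕ, Function.Surjective f ∧ ∀ g g', f g < f g' ↔ M.h g < M.h g' := by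
  let S := {r : ℝ // r ∈ Set.range M.h}
  have hfin : ∀ x y : S, (Set.Icc x y).Finite := by
    intro x y
    refine Set.Finite.of_finite_image (f := Subtype.val) ((M.finite_h_le y.1).subset ?_)
      Subtype.val_injective.injOn
    rintro _ ⟨z, hz, rfl⟩
    exact ⟨z.2, hz.2⟩
  let _ : LocallyFiniteOrder S := LocallyFiniteOrder.ofFiniteIcc hfin
  let _ : SuccOrder S := LinearLocallyFiniteOrder.succOrder S
  let _ : PredOrder S := LinearLocallyFiniteOrder.predOrder S
  let _ : OrderBot S :=
    { bot := ⟨M.h 1, 1, rfl⟩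
      bot_le := by
        rintro ⟨_, g, rfl⟩
        exact M.h_one_le g }
  have : NoMaxOrder S := ⟨by
    rintro ⟨_, g, rfl⟩
    obtain ⟨g', hg'⟩ := M.exists_h_lt g
    exact ⟨⟨_, g', rfl⟩, hg'⟩⟩
  let e : S ≃o ℕ := orderIsoNatOfLinearSuccPredArch
  refine ⟨fun g => e ⟨M.h g, g, rfl⟩, ?_, fun g g' => e.lt_iff_lt⟩
  intro m
  obtain ⟨⟨_, g, rfl⟩, hg⟩ := e.surjective m
  exact ⟨g, hg⟩

/-- The position of the tile of a dart in the order of the tiles by their heights. -/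
def index : D → ℕ := M.exists_index.choose

lemma index_surjective : Function.Surjective M.index := M.exists_index.choose_spec.1

lemma index_lt_iff {g g' : D} : M.index g < M.index g' ↔ M.h g < M.h g' :=
  M.exists_index.choose_spec.2 g g'

lemma index_le_iff {g g' : D} : M.index g ≤ M.index g' ↔ M.h g ≤ M.h g' := by
  rw [← not_lt, index_lt_iff, not_lt]

lemma index_eq_iff {g g' : D} : M.index g = M.index g' ↔ M.h g = M.h g' := by
  rw [le_antisymm_iff, le_antisymm_iff, index_le_iff, index_le_iff]

/-- The set of the sides of the tile of a dart. -/
def tile (g : D) : Set (Sym2 V) :=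
  {e | ∃ j : ℕ, e = s(M.v (g * M.a ^ j), M.v (g * M.a ^ (j + 1)))}

lemma mem_tile_iff {g : D} {e : Sym2 V} : e ∈ M.tile g ↔ ∃ i : ℤ, e = M.edge (g * M.a ^ i) := by
  constructor
  · rintro ⟨j, rfl⟩
    exact ⟨j, by rw [edge, zpow_natCast, mul_assoc, ← pow_succ]⟩
  · rintro ⟨i, rfl⟩
    have hn : (0 : ℤ) < n := by have := M.five_le_n; omega
    obtain ⟨j, hj⟩ := Int.eq_ofNat_of_zero_le (Int.emod_nonneg i hn.ne')
    have : M.a ^ i = M.a ^ j := by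
      conv_lhs => rw [← Int.emod_add_mul_ediv i n, zpow_add, M.a_zpow_eq_one (dvd_mul_right _ _),
        mul_one, hj, zpow_natCast]
    exact ⟨j, by rw [edge, this, mul_assoc, ← pow_succ]⟩

lemma edge_mem_tile_iff {d g : D} :
    M.edge d ∈ M.tile g ↔ M.h d = M.h g ∨ M.h (d * M.a * M.b) = M.h g := by
  rw [mem_tile_iff, eq_comm (a := M.h d), eq_comm (b := M.h g), h_eq_iff, h_eq_iff, ← exists_or]
  refine exists_congr fun i => ?_
  rw [edge_eq_iff, eq_comm, eq_comm (a := g * M.a ^ i)]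

lemma tile_eq_iff {g g' : D} : M.tile g = M.tile g' ↔ M.h g = M.h g' := by
  constructor
  · intro h
    have h1 : M.edge g ∈ M.tile g' := by
      rw [← h, edge_mem_tile_iff]
      exact Or.inl rfl
    have h2 : M.edge (g * M.a) ∈ M.tile g' := by
      rw [← h, edge_mem_tile_iff]
      exact Or.inl (M.h_mul_a g)
    rw [edge_mem_tile_iff] at h1 h2
    rw [h_mul_a] at h2
    rcases h1 with h1 | h1
    · exact h1
    rcases h2 with h2 | h2
    · exact h2
    -- otherwise the other tiles at two adjacent sides coincide
    exfalso
    have h3 : g * M.a * M.a * M.b * M.a = g * M.a * M.b⁻¹ := by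
      rw [mul_assoc (g * M.a), mul_assoc (g * M.a), M.aba]
    rw [← M.h_mul_a, h3] at h2
    refine M.h_mul_b_zpow_ne (g * M.a * M.b⁻¹) (i := 2)
      (M.not_dvd_q (by norm_num) (by norm_num) (by norm_num)) ?_
    rw [h2, show g * M.a * M.b⁻¹ * M.b ^ (2 : ℤ) = g * M.a * M.b by group, h1]
  · intro h
    ext e
    induction e with | h x y => ?_
    constructor
    · rw [mem_tile_iff]
      rintro ⟨i, hi⟩
      rw [hi, edge_mem_tile_iff, h_mul_a_zpow]
      exact Or.inl h
    · rw [mem_tile_iff]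
      rintro ⟨i, hi⟩
      rw [hi, edge_mem_tile_iff, h_mul_a_zpow]
      exact Or.inl h.symm

lemma mem_of_mem_tile {x : V} {g : D} :
    (∃ e ∈ M.tile g, x ∈ e) ↔ ∃ i : ℤ, x = M.v (g * M.a ^ i) := by
  constructor
  · rintro ⟨e, he, hx⟩
    obtain ⟨i, rfl⟩ := M.mem_tile_iff.1 he
    rcases Sym2.mem_iff.1 hx with rfl | rfl
    · exact ⟨i, rfl⟩
    · exact ⟨i + 1, by rw [zpow_add_one, mul_assoc]⟩
  · rintro ⟨i, rfl⟩
    exact ⟨_, M.mem_tile_iff.2 ⟨i, rfl⟩, Sym2.mem_mk_left _ _⟩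

/-- The tiles in the order of their heights. -/
def tileSeq (m : ℕ) : Set (Sym2 V) := M.tile (M.index_surjective m).choose

lemma tileSeq_index (g : D) : M.tileSeq (M.index g) = M.tile g := by
  rw [tileSeq, tile_eq_iff, ← index_eq_iff]
  exact (M.index_surjective _).choose_spec

lemma tileSeq_injective : Function.Injective M.tileSeq := by
  intro i j h
  obtain ⟨g, rfl⟩ := M.index_surjective i
  obtain ⟨g', rfl⟩ := M.index_surjective j
  rw [tileSeq_index, tileSeq_index, tile_eq_iff, ← index_eq_iff] at h
  exact h

lemma range_tileSeq : Set.range M.tileSeq = Set.range M.tile := by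
  ext t
  constructor
  · rintro ⟨m, rfl⟩
    exact ⟨_, rfl⟩
  · rintro ⟨g, rfl⟩
    exact ⟨_, M.tileSeq_index g⟩

lemma edge_mem_tileSeq_iff {d : D} {i : ℕ} :
    M.edge d ∈ M.tileSeq i ↔ M.index d = i ∨ M.index (d * M.a * M.b) = i := by
  obtain ⟨g, rfl⟩ := M.index_surjective i
  rw [tileSeq_index, edge_mem_tile_iff, index_eq_iff, index_eq_iff]

lemma index_lt_of_not_visible {d : D} (hd : ¬ M.Visible d) :
    M.index d < M.index (d * M.a * M.b) := by
  rw [index_lt_iff]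
  have := (M.visible_mul_ab_iff d).2 hd
  rwa [Visible, mul_ab_ab] at this

/-- Every tile has exactly one dashed side that is not a side of a lower tile. -/
theorem existsUnique_new_dashed (m : ℕ) :
    ∃! e, e ∈ M.tileSeq m ∧ e ∈ M.dashed.edgeSet ∧ ∀ i < m, e ∉ M.tileSeq i := by
  obtain ⟨g, rfl⟩ := M.index_surjective m
  obtain ⟨i, hi⟩ := M.exists_dashed g
  have hidx : M.index (g * M.a ^ i) = M.index g := M.index_eq_iff.2 (M.h_mul_a_zpow _ _)
  refine ⟨M.edge (g * M.a ^ i), ⟨?_, M.mem_edgeSet_graph.2 ⟨_, hi, rfl⟩, ?_⟩, ?_⟩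
  · exact M.edge_mem_tileSeq_iff.2 (Or.inl hidx)
  · intro j hj h
    have := M.index_lt_of_not_visible hi.not_visible
    rcases M.edge_mem_tileSeq_iff.1 h with h | h <;> omega
  · rintro e ⟨h1, h2, h3⟩
    obtain ⟨d, hd, rfl⟩ := M.mem_edgeSet_graph.1 h2
    rcases M.edge_mem_tileSeq_iff.1 h1 with h | h
    · obtain ⟨j, rfl⟩ := (M.h_eq_iff _ _).1 (M.index_eq_iff.1 (hidx.trans h.symm))
      rw [hi.eq M hd]
    · refine absurd (M.edge_mem_tileSeq_iff.2 (Or.inl rfl)) (h3 (M.index d) ?_)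
      rw [← h]
      exact M.index_lt_of_not_visible hd.not_visible

/-- A tile has at most one dashed side apart from its own dashed dart, since its visible sides are
pairwise adjacent. -/
theorem ncard_dashed_sides (g : D) :
    (M.tile g ∩ M.dashed.edgeSet).ncard = 1 ∨ (M.tile g ∩ M.dashed.edgeSet).ncard = 2 := by
  obtain ⟨i, hi⟩ := M.exists_dashed g
  have hmem : ∀ e, e ∈ M.tile g ∩ M.dashed.edgeSet ↔ e = M.edge (g * M.a ^ i) ∨
      ∃ j : ℤ, e = M.edge (g * M.a ^ j) ∧ M.Dashed (g * M.a ^ j * M.a * M.b) := by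
    intro e
    rw [Set.mem_inter_iff, mem_tile_iff, dashed, mem_edgeSet_graph]
    constructor
    · rintro ⟨⟨j, rfl⟩, d, hd, h⟩
      rcases (M.edge_eq_iff _ _).1 h.symm with rfl | rfl
      · left
        rw [show g * M.a ^ j = g * M.a ^ i * M.a ^ (j - i) by group] at hd ⊢
        rw [hi.eq M hd]
      · exact Or.inr ⟨j, rfl, hd⟩
    · rintro (rfl | ⟨j, rfl, hd⟩)
      · exact ⟨⟨i, rfl⟩, _, hi, rfl⟩
      · exact ⟨⟨j, rfl⟩, _, hd, M.edge_mul_ab _⟩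
  have hvis : ∀ d, M.Dashed (d * M.a * M.b) → M.Visible d := by
    intro d hd
    by_contra h
    exact hd.not_visible M ((M.visible_mul_ab_iff _).2 h)
  -- two such sides with a common vertex would be two dashed edges at this vertex
  have hadj : ∀ d, M.Dashed (d * M.a * M.b) → ¬ M.Dashed (d * M.a * M.a * M.b) := by
    intro d h1 h2
    obtain ⟨d', -, hu⟩ := M.existsUnique_dashed (M.v (d * M.a))
    have e1 := hu _ ⟨h1, Or.inl (M.v_mul_b _)⟩
    have e2 := hu _ ⟨h2, Or.inr (by rw [mul_assoc (d * M.a), mul_assoc (d * M.a), M.aba,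
      v_mul_b_inv])⟩
    have := mul_right_cancel (e1.trans e2.symm)
    rw [left_eq_mul] at this
    exact M.a_ne_one this
  have huniq : ∀ j j' : ℤ, M.Dashed (g * M.a ^ j * M.a * M.b) →
      M.Dashed (g * M.a ^ j' * M.a * M.b) → g * M.a ^ j = g * M.a ^ j' := by
    intro j j' h h'
    have e : g * M.a ^ j' = g * M.a ^ j * M.a ^ (j' - j) := by group
    have h2 := hvis _ h'
    rw [e] at h2
    rcases (hvis _ h).dvd M h2 with h3 | h3 | h3
    · rw [e, M.a_zpow_eq_one h3, mul_one]
    · have h4 := M.a_zpow_eq_one h3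
      refine absurd h' ?_
      have : g * M.a ^ j' = g * M.a ^ j * M.a := by
        rw [e, ← sub_add_cancel (j' - j) 1, zpow_add, h4, one_mul, zpow_one]
      rw [this]
      exact hadj _ h
    · have h4 := M.a_zpow_eq_one h3
      refine absurd h ?_
      have : g * M.a ^ j = g * M.a ^ j' * M.a := by
        rw [e, mul_assoc, ← zpow_add_one, h4, mul_one]
      rw [this]
      exact hadj _ h'
  by_cases hex : ∃ j : ℤ, M.Dashed (g * M.a ^ j * M.a * M.b)
  · right
    obtain ⟨j, hj⟩ := hex
    rw [show M.tile g ∩ M.dashed.edgeSet = {M.edge (g * M.a ^ i), M.edge (g * M.a ^ j)} from ?_]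
    · apply Set.ncard_pair
      rw [← M.edge_mul_ab (g * M.a ^ j)]
      intro h
      have := M.eq_of_edge_eq h hi.not_visible hj.not_visible
      have h1 := hi.not_visible
      rw [show g * M.a ^ i = g * M.a ^ j * M.a ^ (i - j) by group] at this
      have h2 : M.h (g * M.a ^ j * M.a ^ (i - j)) = M.h (g * M.a ^ j * M.a * M.b) :=
        congrArg M.h this
      rw [h_mul_a_zpow] at h2
      exact (hvis _ hj).ne h2.symm
    · ext e
      rw [hmem, Set.mem_insert_iff, Set.mem_singleton_iff]
      refine or_congr Iff.rfl ⟨?_, fun h => ⟨j, h, hj⟩⟩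
      rintro ⟨j', rfl, hj'⟩
      rw [huniq _ _ hj hj']
  · left
    rw [show M.tile g ∩ M.dashed.edgeSet = {M.edge (g * M.a ^ i)} from ?_, Set.ncard_singleton]
    ext e
    rw [hmem, Set.mem_singleton_iff, or_iff_left]
    rintro ⟨j, -, hj⟩
    exact hex ⟨j, hj⟩

/-! ### The solid edges form trees -/

open Classical in
/-- The parent of a vertex in the tree of the solid edges. The root is the initial vertex of the
dart `1`. -/
def parent (x : V) : V :=
  if M.Front (M.first x * M.a) ∧ ¬ M.Open (M.first x * M.a) then M.v (M.first x * M.a)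
  else if M.first x = 1 then x else M.v (M.first x * M.a⁻¹)

/-- An edge is solid if it joins a vertex to its parent. It is then a side of the lowest tile at
this vertex. -/
lemma solid_adj_parent {x : V} (hx : M.parent x ≠ x) :
    ∃ d, ¬ M.Visible d ∧ ¬ M.Dashed d ∧ M.edge d = s(x, M.parent x) ∧
      M.index d = M.index (M.first x) := by
  have hf := M.fresh_first x
  have hfv := M.v_first x
  unfold parent at hx ⊢
  split_ifs at hx ⊢ with h1 h2
  · refine ⟨M.first x, hf.1, ?_, by rw [edge, hfv], rfl⟩
    rintro (h | h | h)
    · rw [h] at h1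
      exact M.not_visible_one h1.1.1
    · exact h1.2 h.2
    · have h3 := h1.1.eq M (i := 1) (by rw [zpow_one]; exact h.1)
      rw [zpow_one, mul_eq_left] at h3
      exact M.a_ne_one h3
  · exact absurd rfl hx
  · refine ⟨M.first x * M.a⁻¹, hf.2, ?_, by rw [edge, inv_mul_cancel_right, hfv, Sym2.eq_swap],
      M.index_eq_iff.2 (M.h_mul_a_inv _)⟩
    rintro (h | h | h)
    · rw [inv_mul_cancel_right] at h
      exact h2 h
    · rw [inv_mul_cancel_right] at h
      exact hf.1 h.1.1
    · rw [inv_mul_cancel_right] at h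
      exact h1 h

lemma solid_adj_iff (x y : V) :
    M.solid.Adj x y ↔ x ≠ y ∧ (M.parent x = y ∨ M.parent y = x) := by
  constructor
  · rintro ⟨d, ⟨hd, hdd⟩, h⟩
    have hne : x ≠ y := by
      rintro rfl
      rcases Sym2.eq_iff.1 h with h | h <;> exact M.v_mul_a_ne d (h.2.trans h.1.symm)
    refine ⟨hne, ?_⟩
    have key : M.parent (M.v d) = M.v (d * M.a) ∨ M.parent (M.v (d * M.a)) = M.v d := by
      by_cases hv : M.Visible (d * M.a)
      · left
        have hfr : M.Front (d * M.a) := ⟨hv, by rwa [mul_inv_cancel_right]⟩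
        have ho : ¬ M.Open (d * M.a) := fun ho => hdd (Or.inr (Or.inl ⟨hfr, ho⟩))
        have h2 := hfr.not_visible_two
        rw [mul_inv_cancel_right] at h2
        have hF : M.first (M.v d) = d := Fresh.first_eq M ⟨hd, h2⟩
        rw [parent, hF, if_pos ⟨hfr, ho⟩]
      · right
        have hF : M.first (M.v (d * M.a)) = d * M.a :=
          Fresh.first_eq M ⟨hv, by rwa [mul_inv_cancel_right]⟩
        rw [parent, hF, if_neg, if_neg, mul_inv_cancel_right]
        · exact fun h1 => hdd (Or.inl h1)
        · exact fun h1 => hdd (Or.inr (Or.inr h1))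
    rcases Sym2.eq_iff.1 h with ⟨rfl, rfl⟩ | ⟨rfl, rfl⟩
    · exact key
    · exact key.symm
  · rintro ⟨hne, rfl | rfl⟩
    · obtain ⟨d, h1, h2, h3, -⟩ := M.solid_adj_parent hne.symm
      exact ⟨d, ⟨h1, h2⟩, h3⟩
    · obtain ⟨d, h1, h2, h3, -⟩ := M.solid_adj_parent hne
      exact ⟨d, ⟨h1, h2⟩, by rw [h3, Sym2.eq_swap]⟩

/-- The number of steps from a dart back to the last visible dart of its tile, or to the dart `1`
in the base tile. -/
def position (g : D) : ℕ := sInf {i : ℕ | M.Visible (g * M.a ^ (-i : ℤ)) ∨ g * M.a ^ (-i : ℤ) = 1}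

lemma position_lt {g : D} (h1 : ¬ M.Visible g) (h2 : g ≠ 1) :
    M.position (g * M.a⁻¹) < M.position g := by
  have hne : {i : ℕ | M.Visible (g * M.a ^ (-i : ℤ)) ∨ g * M.a ^ (-i : ℤ) = 1}.Nonempty := by
    have hn : (0 : ℤ) < n := by have := M.five_le_n; omega
    have hz : ∃ i : ℤ, M.Visible (g * M.a ^ i) ∨ g * M.a ^ i = 1 := by
      by_contra hcon
      push Not at hcon
      obtain ⟨i, rfl⟩ := M.exists_eq_a_zpow g fun i => (hcon i).1
      exact (hcon (-i)).2 (by group)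
    obtain ⟨i, hi⟩ := hz
    obtain ⟨j, hj⟩ := Int.eq_ofNat_of_zero_le (Int.emod_nonneg (-i) hn.ne')
    refine ⟨j, ?_⟩
    have : M.a ^ (-j : ℤ) = M.a ^ i := by
      rw [zpow_neg, inv_eq_iff_eq_inv, ← zpow_neg]
      conv_rhs => rw [← Int.emod_add_mul_ediv (-i) n, zpow_add,
        M.a_zpow_eq_one (dvd_mul_right _ _), mul_one, hj]
    simpa only [Set.mem_ofPred_eq, this] using hi
  have hmem := Nat.sInf_mem hne
  obtain ⟨k, hk⟩ : ∃ k, M.position g = k + 1 := by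
    refine Nat.exists_eq_succ_of_ne_zero fun h0 => ?_
    rw [position] at h0
    rw [h0] at hmem
    simp only [Set.mem_ofPred_eq, Nat.cast_zero, neg_zero, zpow_zero, mul_one] at hmem
    tauto
  rw [hk, Nat.lt_succ_iff]
  apply Nat.sInf_le
  rw [position] at hk
  rw [hk] at hmem
  simp only [Set.mem_ofPred_eq] at hmem ⊢
  rwa [show g * M.a⁻¹ * M.a ^ (-k : ℤ) = g * M.a ^ (-((k + 1 : ℕ) : ℤ)) by push_cast; group]

/-- The measure of a vertex that decreases when passing to the parent. -/
def rank (x : V) : ℕ ×ₗ ℕ := toLex (M.index (M.first x), M.position (M.first x))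

lemma rank_parent_lt {x : V} (hx : M.parent x ≠ x) : M.rank (M.parent x) < M.rank x := by
  have hf := M.fresh_first x
  rw [rank, rank, Prod.Lex.toLex_lt_toLex]
  unfold parent at hx ⊢
  split_ifs at hx ⊢ with h1 h2
  · left
    rw [index_lt_iff, ← M.h_mul_a (M.first x)]
    refine (M.fresh_first _).h_lt M (M.v_first _) ?_
    intro h
    have := (M.fresh_first (M.v (M.first x * M.a))).1
    rw [h] at this
    exact this h1.1.1
  · exact absurd rfl hx
  · have hle := (M.fresh_first (M.v (M.first x * M.a⁻¹))).h_le M (M.v_first _)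
    by_cases hF : M.first (M.v (M.first x * M.a⁻¹)) = M.first x * M.a⁻¹
    · right
      rw [hF]
      exact ⟨M.index_eq_iff.2 (M.h_mul_a_inv _), M.position_lt hf.1 h2⟩
    · left
      rw [index_lt_iff, ← M.h_mul_a_inv (M.first x)]
      exact (M.fresh_first _).h_lt M (M.v_first _) hF

lemma index_first_parent_le (x : V) :
    M.index (M.first (M.parent x)) ≤ M.index (M.first x) := by
  by_cases hx : M.parent x = x
  · rw [hx]
  · have := M.rank_parent_lt hx
    rw [rank, rank, Prod.Lex.toLex_lt_toLex] at this
    rcases this with h | h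
    · exact h.le
    · exact h.1.le

lemma parent_eq_self {x : V} (hx : M.parent x = x) : x = M.v 1 := by
  have hv := M.v_first x
  unfold parent at hx
  split_ifs at hx with h1 h2
  · exact absurd (hx.trans hv.symm) (M.v_mul_a_ne _)
  · rw [← hv, h2]
  · refine absurd (hv.trans hx.symm) ?_
    have := M.v_mul_a_ne (M.first x * M.a⁻¹)
    rwa [inv_mul_cancel_right] at this

lemma exists_iterate_parent (x : V) : ∃ i : ℕ, M.parent^[i] x = M.v 1 := by
  obtain ⟨r, hr⟩ : ∃ r, M.rank x = r := ⟨_, rfl⟩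
  induction r using WellFoundedLT.induction generalizing x with
  | _ r ih =>
    by_cases hx : M.parent x = x
    · exact ⟨0, M.parent_eq_self hx⟩
    · obtain ⟨i, hi⟩ := ih _ (hr ▸ M.rank_parent_lt hx) _ rfl
      exact ⟨i + 1, hi⟩

theorem isTree_solid : M.solid.IsTree := by
  have : Nonempty V := ⟨M.v 1⟩
  refine SimpleGraph.isTree_of_parent _ M.parent M.rank M.solid_adj_iff
    (fun x => M.rank_parent_lt) fun x y => ?_
  obtain ⟨i, hi⟩ := M.exists_iterate_parent x
  obtain ⟨j, hj⟩ := M.exists_iterate_parent y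
  exact ⟨i, j, hi.trans hj.symm⟩

lemma mem_corners_iff (m : ℕ) (x : V) :
    x ∈ (⋃ i ∈ Set.Iic m, {x | ∃ e ∈ M.tileSeq i, x ∈ e}) ↔ M.index (M.first x) ≤ m := by
  simp only [Set.mem_iUnion, Set.mem_Iic, Set.mem_ofPred_eq, exists_prop]
  constructor
  · rintro ⟨i, hi, h⟩
    obtain ⟨g, rfl⟩ := M.index_surjective i
    rw [tileSeq_index, mem_of_mem_tile] at h
    obtain ⟨j, hj⟩ := h
    refine le_trans ?_ hi
    rw [index_le_iff, ← M.h_mul_a_zpow g j]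
    exact (M.fresh_first x).h_le M ((M.v_first x).trans hj)
  · intro h
    refine ⟨_, h, ?_⟩
    rw [tileSeq_index, mem_of_mem_tile]
    exact ⟨0, by simp⟩

/-- The solid sides of the lowest tiles form a tree. -/
theorem isTree_induce (m : ℕ) :
    ((SimpleGraph.fromEdgeSet (M.solid.edgeSet ∩ ⋃ i ∈ Set.Iic m, M.tileSeq i)).induce
      (⋃ i ∈ Set.Iic m, {x | ∃ e ∈ M.tileSeq i, x ∈ e})).IsTree := by
  have hp : ∀ x ∈ (⋃ i ∈ Set.Iic m, {x | ∃ e ∈ M.tileSeq i, x ∈ e}),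
      M.parent x ∈ (⋃ i ∈ Set.Iic m, {x | ∃ e ∈ M.tileSeq i, x ∈ e}) := by
    intro x hx
    rw [mem_corners_iff] at hx ⊢
    exact (M.index_first_parent_le x).trans hx
  have h1 : M.v 1 ∈ (⋃ i ∈ Set.Iic m, {x | ∃ e ∈ M.tileSeq i, x ∈ e}) := by
    rw [mem_corners_iff, M.fresh_one.first_eq]
    obtain ⟨g, rfl⟩ := M.index_surjective m
    rw [index_le_iff]
    exact M.h_one_le g
  have hedge : ∀ x ∈ (⋃ i ∈ Set.Iic m, {x | ∃ e ∈ M.tileSeq i, x ∈ e}), M.parent x ≠ x →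
      s(x, M.parent x) ∈ M.solid.edgeSet ∩ ⋃ i ∈ Set.Iic m, M.tileSeq i := by
    intro x hx hne
    obtain ⟨d, hd1, hd2, hd3, hd4⟩ := M.solid_adj_parent hne
    rw [mem_corners_iff, ← hd4] at hx
    refine ⟨⟨d, ⟨hd1, hd2⟩, hd3⟩, ?_⟩
    rw [← hd3]
    simp only [Set.mem_iUnion, exists_prop]
    exact ⟨M.index d, hx, M.edge_mem_tileSeq_iff.2 (Or.inl rfl)⟩
  have : Nonempty (⋃ i ∈ Set.Iic m, {x | ∃ e ∈ M.tileSeq i, x ∈ e} : Set V) := ⟨⟨_, h1⟩⟩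
  have hit : ∀ (i : ℕ) x, ((fun x => ⟨M.parent x.1, hp _ x.2⟩ :
      (⋃ i ∈ Set.Iic m, {x | ∃ e ∈ M.tileSeq i, x ∈ e} : Set V) → _)^[i] x).1 =
        M.parent^[i] x.1 := by
    intro i
    induction i with
    | zero => intro x; rfl
    | succ i ih => intro x; rw [Function.iterate_succ_apply, Function.iterate_succ_apply, ih]
  refine SimpleGraph.isTree_of_parent _ (fun x => ⟨M.parent x.1, hp _ x.2⟩)
    (fun x => M.rank x.1) ?_ ?_ ?_
  · rintro ⟨x, hx⟩ ⟨y, hy⟩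
    rw [SimpleGraph.comap_adj]
    simp only [Function.Embedding.subtype_apply, SimpleGraph.fromEdgeSet_adj, ne_eq,
      Subtype.mk.injEq]
    constructor
    · rintro ⟨⟨h, -⟩, -⟩
      exact (M.solid_adj_iff x y).1 h
    · rintro ⟨hne, rfl | rfl⟩
      · exact ⟨hedge x hx (Ne.symm hne), hne⟩
      · exact ⟨by rw [Sym2.eq_swap]; exact hedge y hy hne, hne⟩
  · rintro ⟨x, hx⟩ hne
    exact M.rank_parent_lt fun h => hne (Subtype.ext h)
  · intro x y
    obtain ⟨i, hi⟩ := M.exists_iterate_parent x.1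
    obtain ⟨j, hj⟩ := M.exists_iterate_parent y.1
    exact ⟨i, j, Subtype.ext (by rw [hit, hit, hi, hj])⟩

end MorseTiling

/-! ### Isometries of Minkowski space -/

namespace Minkowski

/-- Minkowski space `ℝ^{1,2}`, with the time coordinate first. -/
abbrev Space : Type := ℝ × ℝ × ℝ

/-- The Lorentz form. -/
def form (x y : Space) : ℝ := x.1 * y.1 - x.2.1 * y.2.1 - x.2.2 * y.2.2

/-- The determinant of three vectors. -/
def det (x y z : Space) : ℝ :=
  x.1 * (y.2.1 * z.2.2 - y.2.2 * z.2.1) - x.2.1 * (y.1 * z.2.2 - y.2.2 * z.1) +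
    x.2.2 * (y.1 * z.2.1 - y.2.1 * z.1)

/-- The open future light cone. -/
def cone : Set Space := {x | 0 < x.1 ∧ x.2.1 ^ 2 + x.2.2 ^ 2 < x.1 ^ 2}

/-- The point of the hyperboloid about which `rot` turns. -/
def centre : Space := (1, 0, 0)

/-- The rotation about the time axis. -/
def rot (θ : ℝ) : Equiv.Perm Space where
  toFun x := (x.1, Real.cos θ * x.2.1 - Real.sin θ * x.2.2, Real.sin θ * x.2.1 + Real.cos θ * x.2.2)
  invFun x :=
    (x.1, Real.cos θ * x.2.1 + Real.sin θ * x.2.2, -Real.sin θ * x.2.1 + Real.cos θ * x.2.2)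
  left_inv x := by
    have h := Real.sin_sq_add_cos_sq θ
    refine Prod.ext rfl (Prod.ext ?_ ?_) <;> dsimp only
    · linear_combination x.2.1 * h
    · linear_combination x.2.2 * h
  right_inv x := by
    have h := Real.sin_sq_add_cos_sq θ
    refine Prod.ext rfl (Prod.ext ?_ ?_) <;> dsimp only
    · linear_combination x.2.1 * h
    · linear_combination x.2.2 * h

/-- The boost along the first space axis. -/
def boost (t : ℝ) : Equiv.Perm Space where
  toFun x :=
    (Real.cosh t * x.1 + Real.sinh t * x.2.1, Real.sinh t * x.1 + Real.cosh t * x.2.1, x.2.2)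
  invFun x :=
    (Real.cosh t * x.1 - Real.sinh t * x.2.1, -Real.sinh t * x.1 + Real.cosh t * x.2.1, x.2.2)
  left_inv x := by
    have h := Real.cosh_sq t
    refine Prod.ext ?_ (Prod.ext ?_ rfl) <;> dsimp only
    · linear_combination x.1 * h
    · linear_combination x.2.1 * h
  right_inv x := by
    have h := Real.cosh_sq t
    refine Prod.ext ?_ (Prod.ext ?_ rfl) <;> dsimp only
    · linear_combination x.1 * h
    · linear_combination x.2.1 * h

/-- The reflection in the plane spanned by the time axis and the first space axis. -/
def mirror : Equiv.Perm Space where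
  toFun x := (x.1, x.2.1, -x.2.2)
  invFun x := (x.1, x.2.1, -x.2.2)
  left_inv x := by simp
  right_inv x := by simp

lemma rot_apply (θ : ℝ) (x : Space) : rot θ x = (x.1, Real.cos θ * x.2.1 - Real.sin θ * x.2.2,
    Real.sin θ * x.2.1 + Real.cos θ * x.2.2) := rfl

lemma boost_apply (t : ℝ) (x : Space) : boost t x = (Real.cosh t * x.1 + Real.sinh t * x.2.1,
    Real.sinh t * x.1 + Real.cosh t * x.2.1, x.2.2) := rfl

lemma boost_inv_apply (t : ℝ) (x : Space) : (boost t)⁻¹ x =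
    (Real.cosh t * x.1 - Real.sinh t * x.2.1, -Real.sinh t * x.1 + Real.cosh t * x.2.1, x.2.2) :=
  rfl

lemma mirror_apply (x : Space) : mirror x = (x.1, x.2.1, -x.2.2) := rfl

lemma rot_add (θ φ : ℝ) : rot (θ + φ) = rot θ * rot φ := by
  ext1 x
  rw [Equiv.Perm.mul_apply, rot_apply, rot_apply, rot_apply, Real.cos_add, Real.sin_add]
  refine Prod.ext rfl (Prod.ext ?_ ?_) <;> dsimp only <;> ring

lemma rot_zero : rot 0 = 1 := by
  ext1 x
  simp [rot_apply]

lemma rot_zpow (θ : ℝ) (i : ℤ) : rot θ ^ i = rot (i * θ) := by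
  let F : Multiplicative ℝ →* Equiv.Perm Space :=
    { toFun := fun θ => rot θ.toAdd
      map_one' := rot_zero
      map_mul' := fun θ φ => rot_add _ _ }
  have := map_zpow F (Multiplicative.ofAdd θ) i
  rw [← ofAdd_zsmul, zsmul_eq_mul] at this
  exact this.symm

lemma rot_int_mul_two_pi (k : ℤ) : rot (k * (2 * Real.pi)) = 1 := by
  ext1 x
  rw [rot_apply, Real.cos_int_mul_two_pi, ← zero_add ((k : ℝ) * (2 * Real.pi)),
    Real.sin_add_int_mul_two_pi]
  simp

lemma mirror_mul_mirror : mirror * mirror = 1 := by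
  ext1 x
  simp [mirror_apply]

lemma mirror_mul_rot (θ : ℝ) : mirror * rot θ = rot (-θ) * mirror := by
  ext1 x
  rw [Equiv.Perm.mul_apply, Equiv.Perm.mul_apply, mirror_apply, mirror_apply, rot_apply, rot_apply,
    Real.cos_neg, Real.sin_neg]
  refine Prod.ext rfl (Prod.ext ?_ ?_) <;> dsimp only <;> ring

lemma mirror_mul_boost (t : ℝ) : mirror * boost t = boost t * mirror := rfl

/-- The group of the permutations of Minkowski space that preserve the Lorentz form, the
orientation, and the future light cone. -/
def properGroup : Subgroup (Equiv.Perm Space) where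
  carrier := {d | (∀ x y, form (d x) (d y) = form x y) ∧
    (∀ x y z, det (d x) (d y) (d z) = det x y z) ∧ ∀ x, d x ∈ cone ↔ x ∈ cone}
  one_mem' := ⟨fun _ _ => rfl, fun _ _ _ => rfl, fun _ => Iff.rfl⟩
  mul_mem' := by
    rintro d e ⟨h1, h2, h3⟩ ⟨h1', h2', h3'⟩
    exact ⟨fun x y => (h1 _ _).trans (h1' _ _), fun x y z => (h2 _ _ _).trans (h2' _ _ _),
      fun x => (h3 _).trans (h3' _)⟩
  inv_mem' := by
    rintro d ⟨h1, h2, h3⟩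
    have hd : ∀ x, d (d⁻¹ x) = x := d.apply_symm_apply
    refine ⟨fun x y => ?_, fun x y z => ?_, fun x => ?_⟩
    · rw [← h1, hd, hd]
    · rw [← h2, hd, hd, hd]
    · rw [← h3, hd]

lemma rot_mem (θ : ℝ) : rot θ ∈ properGroup := by
  have h := Real.sin_sq_add_cos_sq θ
  refine ⟨fun x y => ?_, fun x y z => ?_, fun x => ?_⟩
  · simp only [form, rot_apply]
    linear_combination (-x.2.1 * y.2.1 - x.2.2 * y.2.2) * h
  · simp only [det, rot_apply]
    linear_combination (x.1 * (y.2.1 * z.2.2 - y.2.2 * z.2.1) -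
      x.2.1 * (y.1 * z.2.2 - y.2.2 * z.1) + x.2.2 * (y.1 * z.2.1 - y.2.1 * z.1)) * h
  · simp only [cone, rot_apply, Set.mem_ofPred_eq]
    rw [show (Real.cos θ * x.2.1 - Real.sin θ * x.2.2) ^ 2 +
      (Real.sin θ * x.2.1 + Real.cos θ * x.2.2) ^ 2 = x.2.1 ^ 2 + x.2.2 ^ 2 by
        linear_combination (x.2.1 ^ 2 + x.2.2 ^ 2) * h]

lemma boost_mem_cone {t : ℝ} {x : Space} (hx : x ∈ cone) : boost t x ∈ cone := by
  obtain ⟨h1, h2⟩ := hx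
  have h := Real.cosh_sq t
  have h3 : |x.2.1| < x.1 := abs_lt_of_sq_lt_sq (by nlinarith [sq_nonneg x.2.2]) h1.le
  have h4 : |Real.sinh t| < Real.cosh t :=
    abs_lt_of_sq_lt_sq (by linarith) (Real.cosh_pos t).le
  refine ⟨?_, ?_⟩
  · have h5 : |Real.sinh t * x.2.1| ≤ Real.cosh t * |x.2.1| := by
      rw [abs_mul]
      exact mul_le_mul_of_nonneg_right h4.le (abs_nonneg _)
    have h6 := neg_abs_le (Real.sinh t * x.2.1)
    have h7 := mul_lt_mul_of_pos_left h3 (Real.cosh_pos t)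
    simp only [boost_apply]
    linarith
  · simp only [boost_apply]
    nlinarith

lemma boost_mem (t : ℝ) : boost t ∈ properGroup := by
  have h := Real.cosh_sq t
  refine ⟨fun x y => ?_, fun x y z => ?_, fun x => ⟨fun hx => ?_, boost_mem_cone⟩⟩
  · simp only [form, boost_apply]
    linear_combination (x.1 * y.1 - x.2.1 * y.2.1) * h
  · simp only [det, boost_apply]
    linear_combination (x.1 * (y.2.1 * z.2.2 - y.2.2 * z.2.1) -
      x.2.1 * (y.1 * z.2.2 - y.2.2 * z.1) + x.2.2 * (y.1 * z.2.1 - y.2.1 * z.1)) * h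
  · have := boost_mem_cone (t := -t) hx
    rwa [show boost (-t) (boost t x) = x from ?_] at this
    have := (boost t).symm_apply_apply x
    rw [boost_apply (-t), Real.cosh_neg, Real.sinh_neg]
    convert this using 1
    change _ = (boost t)⁻¹ _
    rw [boost_inv_apply]
    refine Prod.ext ?_ (Prod.ext rfl rfl)
    dsimp only
    ring

lemma mirror_notMem : mirror ∉ properGroup := by
  rintro ⟨-, h, -⟩
  have := h (1, 0, 0) (0, 1, 0) (0, 0, 1)
  simp only [det, mirror_apply] at this
  norm_num at this

end Minkowski

namespace HyperbolicTiling

open Minkowski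

variable (n q : ℕ)

/-- The hyperbolic sine of the inradius of a tile. -/
def sinhInradius : ℝ := Real.sin (Real.pi / q) * Real.sinh (circumradius n q)

/-- The hyperbolic cosine of the inradius of a tile. -/
def coshInradius : ℝ := Real.cos (Real.pi / q) / Real.sin (Real.pi / n)

/-! ### The reflection group of the tiling -/

/-- The rotation of Minkowski space by `2π / n` about the centre of the base tile. -/
def rotA : Equiv.Perm Space := rot (2 * (Real.pi / n))

/-- The rotation of Minkowski space by `2π / q` about a corner of the base tile. -/
def rotB : Equiv.Perm Space :=
  boost (circumradius n q) * rot (2 * (Real.pi / q)) * (boost (circumradius n q))⁻¹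

/-- The functions that are nonnegative on the half spaces bounding the fundamental triangle. Its
corners are the centre of the base tile, the base vertex, and the midpoint of the side between the
base vertex and the next corner of the base tile. -/
def wall : Fin 3 → Space → ℝ
  | 0, x => Real.sin (Real.pi / n) * x.2.1 - Real.cos (Real.pi / n) * x.2.2
  | 1, x => x.2.2
  | 2, x => sinhInradius n q * x.1 - coshInradius n q *
      (Real.cos (Real.pi / n) * x.2.1 + Real.sin (Real.pi / n) * x.2.2)

/-- The reflections in the sides of the fundamental triangle. -/
def reflection : Fin 3 → Equiv.Perm Space
  | 0 => rotA n * mirror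
  | 1 => mirror
  | 2 => (rotB n q)⁻¹ * mirror

/-- The orders of the products of two reflections in sides of the fundamental triangle. -/
def order : Fin 3 → Fin 3 → ℕ := ![![1, n, 2], ![n, 1, q], ![2, q, 1]]

lemma wall_zero (x : Space) : wall n q 0 x =
    Real.sin (Real.pi / n) * x.2.1 - Real.cos (Real.pi / n) * x.2.2 := rfl

lemma wall_one (x : Space) : wall n q 1 x = x.2.2 := rfl

lemma wall_two (x : Space) : wall n q 2 x = sinhInradius n q * x.1 - coshInradius n q *
      (Real.cos (Real.pi / n) * x.2.1 + Real.sin (Real.pi / n) * x.2.2) := rfl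

lemma wall_reflection_zero (i : Fin 3) (x : Space) : wall n q i (reflection n q 0 x) =
    ![-wall n q 0 x, wall n q 1 x + 2 * Real.cos (Real.pi / n) * wall n q 0 x, wall n q 2 x] i := by
  have h := Real.sin_sq_add_cos_sq (Real.pi / n)
  have hx : reflection n q 0 x = (x.1,
      Real.cos (2 * (Real.pi / n)) * x.2.1 - Real.sin (2 * (Real.pi / n)) * -x.2.2,
      Real.sin (2 * (Real.pi / n)) * x.2.1 + Real.cos (2 * (Real.pi / n)) * -x.2.2) := rfl
  rw [hx, Real.cos_two_mul, Real.sin_two_mul]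
  fin_cases i
  · simp only [Fin.zero_eta, wall_zero, Matrix.cons_val_zero]
    linear_combination 2 * Real.cos (Real.pi / n) * x.2.2 * h
  · simp only [Fin.mk_one, wall_zero, wall_one, Matrix.cons_val_one, Matrix.cons_val_zero]
    ring
  · simp only [Fin.reduceFinMk, wall_two, Matrix.cons_val]
    linear_combination (-2 * coshInradius n q * Real.cos (Real.pi / n) * x.2.1) * h

variable [hn : Fact (5 ≤ n)]

lemma angle_n : 0 < Real.pi / n ∧ Real.pi / n ≤ Real.pi / 5 := by
  have h : (5 : ℝ) ≤ n := by exact_mod_cast hn.out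
  refine ⟨by have := Real.pi_pos; positivity, ?_⟩
  exact div_le_div_of_nonneg_left Real.pi_pos.le (by norm_num) h

lemma sin_n_pos : 0 < Real.sin (Real.pi / n) :=
  Real.sin_pos_of_pos_of_lt_pi (angle_n n).1 (by have := (angle_n n).2; linarith [Real.pi_pos])

lemma cos_n_pos : 0 < Real.cos (Real.pi / n) :=
  Real.cos_pos_of_mem_Ioo ⟨by linarith [(angle_n n).1, Real.pi_pos],
    by linarith [(angle_n n).2, Real.pi_pos]⟩

lemma half_lt_cos_sq_n : 1 / 2 < Real.cos (Real.pi / n) ^ 2 := by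
  have h := Real.cos_lt_cos_of_nonneg_of_le_pi (angle_n n).1.le (by linarith [Real.pi_pos])
    (show Real.pi / n < Real.pi / 4 by linarith [(angle_n n).2, Real.pi_pos])
  rw [Real.cos_pi_div_four] at h
  have h2 : (√2 / 2) ^ 2 = 1 / 2 := by rw [div_pow, Real.sq_sqrt (by norm_num)]; norm_num
  rw [← h2]
  exact pow_lt_pow_left₀ h (by positivity) (by norm_num)

lemma coshInradius_mul_sin :
    coshInradius n q * Real.sin (Real.pi / n) = Real.cos (Real.pi / q) :=
  div_mul_cancel₀ _ (sin_n_pos n).ne'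

lemma wall_reflection_one (i : Fin 3) (x : Space) : wall n q i (reflection n q 1 x) =
    ![wall n q 0 x + 2 * Real.cos (Real.pi / n) * wall n q 1 x, -wall n q 1 x,
      wall n q 2 x + 2 * Real.cos (Real.pi / q) * wall n q 1 x] i := by
  have hx : reflection n q 1 x = (x.1, x.2.1, -x.2.2) := rfl
  rw [hx]
  fin_cases i
  · simp only [Fin.zero_eta, wall_zero, wall_one, Matrix.cons_val_zero]
    ring
  · simp only [Fin.mk_one, wall_one, Matrix.cons_val_one, Matrix.cons_val_zero]
  · simp only [Fin.reduceFinMk, wall_two, wall_one, Matrix.cons_val]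
    linear_combination 2 * x.2.2 * coshInradius_mul_sin n q

variable [hq : Fact (4 ≤ q)]

lemma angle_q : 0 < Real.pi / q ∧ Real.pi / q ≤ Real.pi / 4 := by
  have h : (4 : ℝ) ≤ q := by exact_mod_cast hq.out
  refine ⟨by have := Real.pi_pos; positivity, ?_⟩
  exact div_le_div_of_nonneg_left Real.pi_pos.le (by norm_num) h

lemma sin_q_pos : 0 < Real.sin (Real.pi / q) :=
  Real.sin_pos_of_pos_of_lt_pi (angle_q q).1 (by have := (angle_q q).2; linarith [Real.pi_pos])

lemma cos_q_pos : 0 < Real.cos (Real.pi / q) :=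
  Real.cos_pos_of_mem_Ioo ⟨by linarith [(angle_q q).1, Real.pi_pos],
    by linarith [(angle_q q).2, Real.pi_pos]⟩

lemma half_le_cos_sq_q : 1 / 2 ≤ Real.cos (Real.pi / q) ^ 2 := by
  have h := Real.cos_le_cos_of_nonneg_of_le_pi (angle_q q).1.le (by linarith [Real.pi_pos])
    (angle_q q).2
  rw [Real.cos_pi_div_four] at h
  have h2 : (√2 / 2) ^ 2 = 1 / 2 := by rw [div_pow, Real.sq_sqrt (by norm_num)]; norm_num
  rw [← h2]
  exact pow_le_pow_left₀ (by positivity) h 2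

lemma one_lt_cot_mul_cot : 1 < Real.cot (Real.pi / n) * Real.cot (Real.pi / q) := by
  rw [Real.cot_eq_cos_div_sin, Real.cot_eq_cos_div_sin, div_mul_div_comm,
    one_lt_div (mul_pos (sin_n_pos n) (sin_q_pos q))]
  have h1 := half_lt_cos_sq_n n
  have h2 := half_le_cos_sq_q q
  have h3 := Real.sin_sq_add_cos_sq (Real.pi / n)
  have h4 := Real.sin_sq_add_cos_sq (Real.pi / q)
  have h5 : Real.sin (Real.pi / n) < Real.cos (Real.pi / n) :=
    lt_of_pow_lt_pow_left₀ 2 (cos_n_pos n).le (by linarith)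
  have h6 : Real.sin (Real.pi / q) ≤ Real.cos (Real.pi / q) :=
    le_of_sq_le_sq (by linarith) (cos_q_pos q).le
  exact mul_lt_mul h5 h6 (sin_q_pos q) (cos_n_pos n).le

lemma cosh_circumradius :
    Real.cosh (circumradius n q) = Real.cot (Real.pi / n) * Real.cot (Real.pi / q) :=
  Real.cosh_arcosh (one_lt_cot_mul_cot n q).le

lemma circumradius_pos : 0 < circumradius n q := Real.arcosh_pos (one_lt_cot_mul_cot n q)

lemma sinh_pos : 0 < Real.sinh (circumradius n q) := Real.sinh_pos_iff.2 (circumradius_pos n q)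

lemma sin_mul_sin_mul_cosh : Real.sin (Real.pi / n) * Real.sin (Real.pi / q) *
    Real.cosh (circumradius n q) = Real.cos (Real.pi / n) * Real.cos (Real.pi / q) := by
  rw [cosh_circumradius, Real.cot_eq_cos_div_sin, Real.cot_eq_cos_div_sin]
  have h1 := (sin_n_pos n).ne'
  have h2 := (sin_q_pos q).ne'
  field_simp

lemma sinhInradius_pos : 0 < sinhInradius n q := mul_pos (sin_q_pos q) (sinh_pos n q)

lemma coshInradius_pos : 0 < coshInradius n q := div_pos (cos_q_pos q) (sin_n_pos n)

lemma coshInradius_mul_cos :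
    coshInradius n q * Real.cos (Real.pi / n) =
      Real.sin (Real.pi / q) * Real.cosh (circumradius n q) := by
  rw [coshInradius, div_mul_eq_mul_div, div_eq_iff (sin_n_pos n).ne']
  linear_combination -sin_mul_sin_mul_cosh n q

lemma sinhInradius_sq : sinhInradius n q ^ 2 = coshInradius n q ^ 2 - 1 := by
  have h1 := coshInradius_mul_sin n q
  have h2 := coshInradius_mul_cos n q
  have h3 := Real.sin_sq_add_cos_sq (Real.pi / n)
  have h4 := Real.sin_sq_add_cos_sq (Real.pi / q)
  have h5 := Real.cosh_sq (circumradius n q)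
  rw [sinhInradius]
  linear_combination -(coshInradius n q * Real.sin (Real.pi / n) + Real.cos (Real.pi / q)) * h1 -
    (coshInradius n q * Real.cos (Real.pi / n) +
      Real.sin (Real.pi / q) * Real.cosh (circumradius n q)) * h2 +
    coshInradius n q ^ 2 * h3 - h4 - Real.sin (Real.pi / q) ^ 2 * h5

/-- The wall opposite to the centre of the base tile, in coordinates about the base vertex. -/
lemma wall_two_boost (x : Space) : wall n q 2 (boost (circumradius n q) x) =
    -(Real.sin (Real.pi / q) * x.2.1 + Real.cos (Real.pi / q) * x.2.2) := by
  have h1 := coshInradius_mul_sin n q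
  have h2 := coshInradius_mul_cos n q
  have h5 := Real.cosh_sq (circumradius n q)
  rw [wall_two, boost_apply, sinhInradius]
  dsimp only
  linear_combination (-x.2.2) * h1 - (Real.sinh (circumradius n q) * x.1 +
    Real.cosh (circumradius n q) * x.2.1) * h2 - Real.sin (Real.pi / q) * x.2.1 * h5

lemma wall_zero_boost (x : Space) :
    Real.sin (Real.pi / q) * wall n q 0 (boost (circumradius n q) x) =
    Real.sin (Real.pi / n) * Real.sin (Real.pi / q) * Real.sinh (circumradius n q) * x.1 +
      Real.cos (Real.pi / n) *
        (Real.cos (Real.pi / q) * x.2.1 - Real.sin (Real.pi / q) * x.2.2) := by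
  have h := sin_mul_sin_mul_cosh n q
  rw [wall_zero, boost_apply]
  dsimp only
  linear_combination x.2.1 * h

lemma wall_ext {x y : Space} (h : ∀ i, wall n q i x = wall n q i y) : x = y := by
  have h0 := h 0
  have h1 := h 1
  have h2 := h 2
  rw [wall_zero, wall_zero] at h0
  rw [wall_one, wall_one] at h1
  rw [wall_two, wall_two] at h2
  have e1 : x.2.1 = y.2.1 := by
    rw [h1] at h0
    exact mul_left_cancel₀ (sin_n_pos n).ne' (by linarith)
  have e0 : x.1 = y.1 := by
    rw [h1, e1] at h2
    exact mul_left_cancel₀ (sinhInradius_pos n q).ne' (by linarith)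
  exact Prod.ext e0 (Prod.ext e1 h1)

lemma wall_reflection_two (i : Fin 3) (x : Space) : wall n q i (reflection n q 2 x) =
    ![wall n q 0 x, wall n q 1 x + 2 * Real.cos (Real.pi / q) * wall n q 2 x, -wall n q 2 x] i := by
  have h := Real.sin_sq_add_cos_sq (Real.pi / q)
  obtain ⟨y, rfl⟩ := (boost (circumradius n q)).surjective x
  have hx : reflection n q 2 (boost (circumradius n q) y) = boost (circumradius n q) (y.1,
      Real.cos (2 * (Real.pi / q)) * y.2.1 + Real.sin (2 * (Real.pi / q)) * -y.2.2,
      -Real.sin (2 * (Real.pi / q)) * y.2.1 + Real.cos (2 * (Real.pi / q)) * -y.2.2) := by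
    change boost (circumradius n q) ((rot (2 * (Real.pi / q))).symm
      ((boost (circumradius n q)).symm (boost (circumradius n q) (y.1, y.2.1, -y.2.2)))) = _
    rw [Equiv.symm_apply_apply]
    rfl
  rw [hx, Real.cos_two_mul, Real.sin_two_mul]
  fin_cases i
  · simp only [Fin.zero_eta, Matrix.cons_val_zero]
    refine mul_left_cancel₀ (sin_q_pos q).ne' ?_
    rw [wall_zero_boost, wall_zero_boost]
    dsimp only
    linear_combination (2 * Real.cos (Real.pi / n) * Real.cos (Real.pi / q) * y.2.1) * h
  · simp only [Fin.mk_one, wall_one, wall_two_boost, Matrix.cons_val_one, Matrix.cons_val_zero]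
    simp only [boost_apply]
    ring
  · simp only [Fin.reduceFinMk, wall_two_boost, Matrix.cons_val]
    linear_combination (2 * Real.cos (Real.pi / q) * y.2.2) * h

end HyperbolicTiling

namespace HyperbolicTiling

open Minkowski

/-! ### Stabilizers of tiles and vertices -/

variable (n q : ℕ)

lemma rotA_zpow (i : ℤ) : rotA n ^ i = rot (i * (2 * (Real.pi / n))) := rot_zpow _ _

lemma rotB_zpow (i : ℤ) : rotB n q ^ i =
    boost (circumradius n q) * rot (i * (2 * (Real.pi / q))) * (boost (circumradius n q))⁻¹ := by
  rw [rotB, conj_zpow, rot_zpow]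

/-- The group of orientation preserving symmetries of the tiling, acting on Minkowski space. -/
def darts : Subgroup (Equiv.Perm Space) := Subgroup.closure {rotA n, rotB n q}

lemma rotA_mem : rotA n ∈ darts n q := Subgroup.subset_closure (Or.inl rfl)

lemma rotB_mem : rotB n q ∈ darts n q := Subgroup.subset_closure (Or.inr rfl)

lemma darts_le_properGroup : darts n q ≤ properGroup := by
  refine (Subgroup.closure_le _).2 ?_
  rintro _ (rfl | rfl)
  · exact rot_mem _
  · exact mul_mem (mul_mem (boost_mem _) (rot_mem _)) (inv_mem (boost_mem _))

/-- The elements of a dihedral group are rotations and reflections. -/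
lemma exists_zpow_of_mem_closure_pair {G : Type*} [Group G] {s t : G} (hs : s * s = 1)
    (ht : t * t = 1) {w : G} (hw : w ∈ Subgroup.closure {s, t}) :
    ∃ i : ℤ, w = (s * t) ^ i ∨ w = (s * t) ^ i * s := by
  have hs' : s⁻¹ = s := inv_eq_of_mul_eq_one_right hs
  have ht' : t⁻¹ = t := inv_eq_of_mul_eq_one_right ht
  have e : s * (s * t) * s⁻¹ = (s * t)⁻¹ := by
    rw [mul_inv_rev, hs', ht', ← mul_assoc, hs, one_mul]
  have h1 : ∀ i : ℤ, s * (s * t) ^ i = (s * t) ^ (-i) * s := by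
    intro i
    rw [← inv_mul_cancel_right (s * (s * t) ^ i) s, ← conj_zpow, e, inv_zpow, zpow_neg]
  have h2 : ∀ i : ℤ, t * (s * t) ^ i = (s * t) ^ (-i - 1) * s := by
    intro i
    have h3 : t * (s * t) ^ i = s * (s * t * (s * t) ^ i) := by
      rw [← mul_assoc, ← mul_assoc, hs, one_mul]
    rw [h3, ← zpow_one_add, h1]
    congr 2
    ring
  have key : ∀ x : G, (x = s ∨ x = t) → ∀ y, (∃ i : ℤ, y = (s * t) ^ i ∨ y = (s * t) ^ i * s) →
      ∃ i : ℤ, x * y = (s * t) ^ i ∨ x * y = (s * t) ^ i * s := by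
    rintro x (rfl | rfl) y ⟨i, rfl | rfl⟩
    · exact ⟨-i, Or.inr (h1 i)⟩
    · exact ⟨-i, Or.inl (by rw [← mul_assoc, h1, mul_assoc, hs, mul_one])⟩
    · exact ⟨-i - 1, Or.inr (h2 i)⟩
    · exact ⟨-i - 1, Or.inl (by rw [← mul_assoc, h2, mul_assoc, hs, mul_one])⟩
  induction hw using Subgroup.closure_induction_left with
  | one => exact ⟨0, Or.inl (zpow_zero _).symm⟩
  | mul_left x hx y _ ih => exact key x hx y ih
  | inv_mul_cancel x hx y _ ih =>
    refine key x⁻¹ ?_ y ih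
    rcases hx with rfl | rfl
    · exact Or.inl hs'
    · exact Or.inr ht'

/-- The corner of the base tile that is fixed by `rotB`. -/
def corner₀ : Space := boost (circumradius n q) centre

lemma corner₀_eq : corner₀ n q =
    (Real.cosh (circumradius n q), Real.sinh (circumradius n q), 0) := by
  simp [corner₀, centre, boost_apply]

lemma wall_centre : ∀ i, wall n q i centre = ![0, 0, sinhInradius n q] i := by
  intro i
  fin_cases i <;> simp [wall, centre]

lemma mirror_notMem_darts : mirror ∉ darts n q :=
  fun h => mirror_notMem (darts_le_properGroup n q h)

lemma rot_apply_centre (θ : ℝ) : rot θ centre = centre := by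
  simp [rot_apply, centre]

lemma reflection_zero_mul_one : reflection n q 0 * reflection n q 1 = rotA n := by
  change rotA n * mirror * mirror = _
  rw [mul_assoc, mirror_mul_mirror, mul_one]

lemma mirror_mul_rotB : mirror * rotB n q = (rotB n q)⁻¹ * mirror := by
  have h1 : (rot (2 * (Real.pi / q)))⁻¹ = rot (-(2 * (Real.pi / q))) := by
    rw [inv_eq_iff_mul_eq_one, ← rot_add, add_neg_cancel, rot_zero]
  have h2 : mirror * (boost (circumradius n q))⁻¹ = (boost (circumradius n q))⁻¹ * mirror := by
    rw [eq_inv_mul_iff_mul_eq, ← mul_assoc, ← mirror_mul_boost, mul_inv_cancel_right]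
  rw [rotB, mul_inv_rev, mul_inv_rev, inv_inv, h1]
  simp only [mul_assoc]
  rw [← h2, ← mul_assoc (rot _) mirror, ← mirror_mul_rot, ← mul_assoc mirror, mirror_mul_boost]
  simp only [mul_assoc]

lemma reflection_one_mul_two : reflection n q 1 * reflection n q 2 = rotB n q := by
  change mirror * ((rotB n q)⁻¹ * mirror) = _
  rw [← mirror_mul_rotB, ← mul_assoc, mirror_mul_mirror, one_mul]

lemma rotB_zpow_apply_corner₀ (i : ℤ) : (rotB n q ^ i) (corner₀ n q) = corner₀ n q := by
  rw [rotB_zpow, corner₀]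
  simp only [Equiv.Perm.mul_apply]
  rw [show (boost (circumradius n q))⁻¹ (boost (circumradius n q) centre) = centre from
    Equiv.symm_apply_apply _ _, rot_apply_centre]

lemma rotB_pow [hq : Fact (4 ≤ q)] : rotB n q ^ q = 1 := by
  have h := hq.out
  have h0 : (q : ℝ) ≠ 0 := by positivity
  have := rot_int_mul_two_pi 1
  rw [← zpow_natCast, rotB_zpow, show (((q : ℕ) : ℤ) : ℝ) * (2 * (Real.pi / q)) =
    (1 : ℤ) * (2 * Real.pi) by push_cast; field_simp, this, mul_one, mul_inv_cancel]

variable [hn : Fact (5 ≤ n)]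

lemma rotA_pow : rotA n ^ n = 1 := by
  have h := hn.out
  have h0 : (n : ℝ) ≠ 0 := by positivity
  rw [← zpow_natCast, rotA_zpow]
  have := rot_int_mul_two_pi 1
  rw [← this]
  congr 1
  push_cast
  field_simp

variable [hq : Fact (4 ≤ q)]

lemma wall_reflection (i j : Fin 3) (x : Space) (hij : i ≠ j) : wall n q i (reflection n q j x) =
    wall n q i x + 2 * Real.cos (Real.pi / order n q i j) * wall n q j x := by
  fin_cases j <;> fin_cases i <;>
    first
    | exact absurd rfl hij
    | simp [wall_reflection_zero, wall_reflection_one, wall_reflection_two, order]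

lemma wall_reflection_self (i : Fin 3) (x : Space) :
    wall n q i (reflection n q i x) = -wall n q i x := by
  fin_cases i <;> simp [wall_reflection_zero, wall_reflection_one, wall_reflection_two]

lemma reflection_mul_self (i : Fin 3) : reflection n q i * reflection n q i = 1 := by
  ext1 x
  refine wall_ext n q fun j => ?_
  rw [Equiv.Perm.mul_apply, Equiv.Perm.one_apply]
  by_cases h : j = i
  · rw [h, wall_reflection_self, wall_reflection_self, neg_neg]
  · rw [wall_reflection n q j i _ h, wall_reflection n q j i _ h, wall_reflection_self]
    ring

/-- The reflections in the sides of the fundamental triangle. -/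
def reflectionSystem : ReflectionSystem (Fin 3) Space where
  s := reflection n q
  f := wall n q
  m := order n q
  s_mul_self := reflection_mul_self n q
  f_s_self := wall_reflection_self n q
  f_s := wall_reflection n q
  m_symm i j := by fin_cases i <;> fin_cases j <;> rfl
  two_le_m i j hij := by
    have h1 := hn.out
    have h2 := hq.out
    fin_cases i <;> fin_cases j <;> first | exact absurd rfl hij | (simp [order]; try omega)
  s_mul_s_pow i j hij := by
    have hinv : ∀ i j, reflection n q i * reflection n q j =
        (reflection n q j * reflection n q i)⁻¹ := by
      intro i j
      rw [mul_inv_rev, inv_eq_of_mul_eq_one_right (reflection_mul_self n q i),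
        inv_eq_of_mul_eq_one_right (reflection_mul_self n q j)]
    have h01 : (reflection n q 0 * reflection n q 1) ^ n = 1 := by
      rw [reflection_zero_mul_one, rotA_pow]
    have h12 : (reflection n q 1 * reflection n q 2) ^ q = 1 := by
      rw [reflection_one_mul_two, rotB_pow]
    have h02 : (reflection n q 0 * reflection n q 2) ^ 2 = 1 := by
      ext1 x
      refine wall_ext n q fun j => ?_
      rw [pow_two]
      simp only [Equiv.Perm.mul_apply, Equiv.Perm.one_apply]
      fin_cases j <;> (simp [wall_reflection_zero, wall_reflection_two]; try ring)
    fin_cases i <;> fin_cases j <;>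
      first
      | exact absurd rfl hij
      | exact h01
      | exact h12
      | exact h02
      | (refine (congrArg (· ^ _) (hinv _ _)).trans ((inv_pow _ _).trans (inv_eq_one.2 ?_))
         first | exact h01 | exact h12 | exact h02)
  s_apply i x hx := by
    refine wall_ext n q fun j => ?_
    by_cases h : j = i
    · rw [h, wall_reflection_self, hx, neg_zero]
    · rw [wall_reflection n q j i _ h, hx, mul_zero, add_zero]

lemma darts_le_group : darts n q ≤ (reflectionSystem n q).group := by
  refine (Subgroup.closure_le _).2 ?_
  rintro _ (rfl | rfl)
  · rw [← reflection_zero_mul_one n q]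
    exact mul_mem ((reflectionSystem n q).s_mem 0) ((reflectionSystem n q).s_mem 1)
  · rw [← reflection_one_mul_two n q]
    exact mul_mem ((reflectionSystem n q).s_mem 1) ((reflectionSystem n q).s_mem 2)

lemma countable_darts : (darts n q : Set (Equiv.Perm Space)).Countable := by
  refine (Set.countable_range (reflectionSystem n q).word).mono fun d hd => ?_
  obtain ⟨l, hl⟩ := (reflectionSystem n q).exists_word (darts_le_group n q hd)
  exact ⟨l, hl⟩

lemma wall_corner₀ : ∀ i, wall n q i (corner₀ n q) =
    ![Real.sin (Real.pi / n) * Real.sinh (circumradius n q), 0, 0] i := by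
  intro i
  fin_cases i
  · simp [wall, corner₀_eq]
  · simp [wall, corner₀_eq]
  · simp only [Fin.reduceFinMk, Matrix.cons_val]
    rw [corner₀, wall_two_boost]
    simp [centre]

lemma centre_mem_chamber : centre ∈ (reflectionSystem n q).chamber := by
  intro i
  change 0 ≤ wall n q i centre
  rw [wall_centre]
  have := (sinhInradius_pos n q).le
  fin_cases i <;> simp [this]

lemma corner₀_mem_chamber : corner₀ n q ∈ (reflectionSystem n q).chamber := by
  intro i
  change 0 ≤ wall n q i _
  rw [wall_corner₀]
  have := (mul_pos (sin_n_pos n) (sinh_pos n q)).le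
  fin_cases i <;> simp [this]

/-- The stabilizer of the centre of the base tile. -/
lemma exists_eq_rotA_zpow {d : Equiv.Perm Space} (hd : d ∈ darts n q) (h : d centre = centre) :
    ∃ i : ℤ, d = rotA n ^ i := by
  have h1 := ((reflectionSystem n q).eq_and_mem_closure_of_mem_chamber (darts_le_group n q hd)
    (centre_mem_chamber n q) (by rw [h]; exact centre_mem_chamber n q)).2
  have h2 : (reflectionSystem n q).s '' {i | (reflectionSystem n q).f i centre = 0} ⊆
      {reflection n q 0, reflection n q 1} := by
    rintro _ ⟨i, hi, rfl⟩
    change wall n q i centre = 0 at hi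
    rw [wall_centre] at hi
    fin_cases i
    · exact Or.inl rfl
    · exact Or.inr rfl
    · exact absurd hi (sinhInradius_pos n q).ne'
  obtain ⟨i, hi | hi⟩ := exists_zpow_of_mem_closure_pair (reflection_mul_self n q 0)
    (reflection_mul_self n q 1) (Subgroup.closure_mono h2 h1)
  · exact ⟨i, by rw [hi, reflection_zero_mul_one]⟩
  · exfalso
    rw [reflection_zero_mul_one] at hi
    change d = rotA n ^ i * (rotA n * mirror) at hi
    refine mirror_notMem_darts n q ?_
    have : mirror = (rotA n)⁻¹ * ((rotA n ^ i)⁻¹ * d) := by rw [hi]; group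
    rw [this]
    exact mul_mem (inv_mem (rotA_mem n q)) (mul_mem (inv_mem (zpow_mem (rotA_mem n q) i)) hd)

/-- The stabilizer of the base vertex. -/
lemma exists_eq_rotB_zpow {d : Equiv.Perm Space} (hd : d ∈ darts n q)
    (h : d (corner₀ n q) = corner₀ n q) : ∃ i : ℤ, d = rotB n q ^ i := by
  have h1 := ((reflectionSystem n q).eq_and_mem_closure_of_mem_chamber (darts_le_group n q hd)
    (corner₀_mem_chamber n q) (by rw [h]; exact corner₀_mem_chamber n q)).2
  have h2 : (reflectionSystem n q).s '' {i | (reflectionSystem n q).f i (corner₀ n q) = 0} ⊆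
      {reflection n q 1, reflection n q 2} := by
    rintro _ ⟨i, hi, rfl⟩
    change wall n q i (corner₀ n q) = 0 at hi
    rw [wall_corner₀] at hi
    fin_cases i
    · exact absurd hi (mul_pos (sin_n_pos n) (sinh_pos n q)).ne'
    · exact Or.inl rfl
    · exact Or.inr rfl
  obtain ⟨i, hi | hi⟩ := exists_zpow_of_mem_closure_pair (reflection_mul_self n q 1)
    (reflection_mul_self n q 2) (Subgroup.closure_mono h2 h1)
  · exact ⟨i, by rw [hi, reflection_one_mul_two]⟩
  · exfalso
    rw [reflection_one_mul_two] at hi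
    change d = rotB n q ^ i * mirror at hi
    refine mirror_notMem_darts n q ?_
    have : mirror = (rotB n q ^ i)⁻¹ * d := by rw [hi]; group
    rw [this]
    exact mul_mem (inv_mem (zpow_mem (rotB_mem n q) i)) hd

/-- A point in the half spaces bounding the base tile can be moved into the fundamental triangle
by symmetries of the base tile. -/
lemma exists_mem_chamber {y : Space} (hy : ∀ i : ℤ, 0 ≤ wall n q 2 ((rotA n ^ i) y)) :
    ∃ w ∈ (reflectionSystem n q).group, w centre = centre ∧
      w y ∈ (reflectionSystem n q).chamber := by
  set z : ℂ := ⟨y.2.1, y.2.2⟩ with hz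
  set r := ‖z‖
  set φ := z.arg
  have h1 : y.2.1 = r * Real.cos φ :=
    (Complex.norm_mul_cos_arg z).symm
  have h2 : y.2.2 = r * Real.sin φ :=
    (Complex.norm_mul_sin_arg z).symm
  have hr : 0 ≤ r := norm_nonneg z
  obtain ⟨ha1, ha2⟩ := angle_n n
  obtain ⟨α, hα⟩ : ∃ α, α = Real.pi / n := ⟨_, rfl⟩
  rw [← hα] at ha1 ha2
  obtain ⟨k, hk⟩ : ∃ k : ℤ, k = round (φ / (2 * α)) := ⟨_, rfl⟩
  obtain ⟨ψ, hψ⟩ : ∃ ψ, ψ = φ - k * (2 * α) := ⟨_, rfl⟩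
  have hψ' : |ψ| ≤ α := by
    have := abs_sub_round (φ / (2 * α))
    rw [← hk] at this
    have e : ψ = (φ / (2 * α) - k) * (2 * α) := by rw [hψ]; field_simp
    rw [e, abs_mul, abs_of_pos (by positivity : 0 < 2 * α)]
    nlinarith
  have hrot : (rotA n ^ (-k)) y = (y.1, r * Real.cos ψ, r * Real.sin ψ) := by
    rw [rotA_zpow, rot_apply, h1, h2, ← hα]
    push_cast
    rw [neg_mul, Real.cos_neg, Real.sin_neg, hψ, Real.cos_sub, Real.sin_sub]
    refine Prod.ext rfl (Prod.ext ?_ ?_) <;> dsimp only <;> ring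
  have hw2 := hy (-k)
  have hw2' := hy (1 + -k)
  have hmem : rotA n ^ (-k) ∈ (reflectionSystem n q).group :=
    darts_le_group n q (zpow_mem (rotA_mem n q) _)
  have hfix : (rotA n ^ (-k)) centre = centre := by rw [rotA_zpow, rot_apply_centre]
  have habs := abs_le.1 hψ'
  have hpi := Real.pi_pos
  by_cases hs : 0 ≤ ψ
  · refine ⟨rotA n ^ (-k), hmem, hfix, fun i => ?_⟩
    change 0 ≤ wall n q i _
    fin_cases i
    · simp only [Fin.zero_eta]
      rw [hrot, wall_zero, ← hα]
      dsimp only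
      rw [show Real.sin α * (r * Real.cos ψ) - Real.cos α *
        (r * Real.sin ψ) = r * Real.sin (α - ψ) by rw [Real.sin_sub]; ring]
      exact mul_nonneg hr (Real.sin_nonneg_of_nonneg_of_le_pi (by linarith) (by linarith))
    · simp only [Fin.mk_one]
      rw [hrot, wall_one]
      exact mul_nonneg hr (Real.sin_nonneg_of_nonneg_of_le_pi hs (by linarith))
    · exact hw2
  · rw [not_le] at hs
    have hm : ∀ x, reflection n q 1 x = (x.1, x.2.1, -x.2.2) := fun x => rfl
    refine ⟨reflection n q 1 * rotA n ^ (-k), mul_mem ((reflectionSystem n q).s_mem 1) hmem, ?_,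
      fun i => ?_⟩
    · rw [Equiv.Perm.mul_apply, hfix, hm, centre, neg_zero]
    change 0 ≤ wall n q i _
    fin_cases i
    · simp only [Fin.zero_eta]
      rw [Equiv.Perm.mul_apply, hrot, hm, wall_zero, ← hα]
      dsimp only
      rw [show Real.sin α * (r * Real.cos ψ) - Real.cos α *
        -(r * Real.sin ψ) = r * Real.sin (α + ψ) by rw [Real.sin_add]; ring]
      exact mul_nonneg hr (Real.sin_nonneg_of_nonneg_of_le_pi (by linarith) (by linarith))
    · simp only [Fin.mk_one]
      rw [Equiv.Perm.mul_apply, hrot, hm, wall_one]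
      dsimp only
      rw [← mul_neg, ← Real.sin_neg]
      exact mul_nonneg hr (Real.sin_nonneg_of_nonneg_of_le_pi (by linarith) (by linarith))
    · simp only [Fin.reduceFinMk]
      rw [Equiv.Perm.mul_apply]
      rw [zpow_add, zpow_one, ← reflection_zero_mul_one n q, mul_assoc, Equiv.Perm.mul_apply,
        wall_reflection_zero] at hw2'
      rw [reflection_zero_mul_one, Equiv.Perm.mul_apply] at hw2'
      exact hw2'

end HyperbolicTiling

namespace HyperbolicTiling

open Minkowski

/-! ### Distances of tile centres from a point in general position -/

/-- A strict minimum of the cosine among three equidistant points is close to an odd multiple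
of `π`. -/
lemma exists_abs_sub_lt_of_cos_lt {x δ : ℝ} (hδ : 0 < δ) (hδ' : δ < 2 * Real.pi)
    (h1 : Real.cos x < Real.cos (x + δ)) (h2 : Real.cos x < Real.cos (x - δ)) :
    ∃ m : ℤ, |x - Real.pi - m * (2 * Real.pi)| < δ / 2 := by
  have hpi := Real.pi_pos
  have hs : 0 < Real.sin (δ / 2) := Real.sin_pos_of_pos_of_lt_pi (by linarith) (by linarith)
  obtain ⟨m, hm⟩ : ∃ m : ℤ, m = round ((x - Real.pi) / (2 * Real.pi)) := ⟨_, rfl⟩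
  obtain ⟨ε, hε⟩ : ∃ ε, ε = x - Real.pi - m * (2 * Real.pi) := ⟨_, rfl⟩
  have hε' : |ε| ≤ Real.pi := by
    have := abs_sub_round ((x - Real.pi) / (2 * Real.pi))
    rw [← hm] at this
    have e : ε = ((x - Real.pi) / (2 * Real.pi) - m) * (2 * Real.pi) := by rw [hε]; field_simp
    rw [e, abs_mul, abs_of_pos (by positivity : 0 < 2 * Real.pi)]
    nlinarith
  have hx : x = ε + Real.pi + m * (2 * Real.pi) := by rw [hε]; ring
  have hc : ∀ t, Real.cos (x + t) = -Real.cos (ε + t) := by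
    intro t
    rw [hx, show ε + Real.pi + m * (2 * Real.pi) + t = ε + t + Real.pi + m * (2 * Real.pi) by ring,
      Real.cos_add_int_mul_two_pi, Real.cos_add_pi]
  have hp : 0 < Real.sin (ε + δ / 2) := by
    have e1 := hc 0
    have e2 := hc δ
    rw [add_zero, add_zero] at e1
    have e3 := Real.cos_sub_cos ε (ε + δ)
    rw [show (ε + (ε + δ)) / 2 = ε + δ / 2 by ring, show (ε - (ε + δ)) / 2 = -(δ / 2) by ring,
      Real.sin_neg] at e3
    have : 0 < 2 * Real.sin (ε + δ / 2) * Real.sin (δ / 2) := by linarith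
    exact (mul_pos_iff_of_pos_right hs).1 (by linarith)
  have hm' : Real.sin (ε - δ / 2) < 0 := by
    have e1 := hc 0
    have e2 := hc (-δ)
    rw [add_zero, add_zero] at e1
    rw [← sub_eq_add_neg, ← sub_eq_add_neg] at e2
    have e3 := Real.cos_sub_cos ε (ε - δ)
    rw [show (ε + (ε - δ)) / 2 = ε - δ / 2 by ring, show (ε - (ε - δ)) / 2 = δ / 2 by ring] at e3
    have : Real.sin (ε - δ / 2) * Real.sin (δ / 2) < 0 := by linarith
    by_contra! h0
    exact this.not_ge (mul_nonneg h0 hs.le)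
  refine ⟨m, ?_⟩
  rw [← hε, abs_lt]
  have := abs_le.1 hε'
  constructor
  · by_contra! h
    exact hp.not_ge (Real.sin_nonpos_of_nonpos_of_neg_pi_le (by linarith) (by linarith))
  · by_contra! h
    exact hm'.not_ge (Real.sin_nonneg_of_nonneg_of_le_pi (by linarith) (by linarith))

lemma dvd_of_cos_eq_one {n : ℕ} (hn : 0 < n) {i : ℤ} (h : Real.cos (i * (2 * (Real.pi / n))) = 1) :
    (n : ℤ) ∣ i := by
  obtain ⟨k, hk⟩ := (Real.cos_eq_one_iff _).1 h
  refine ⟨k, ?_⟩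
  have h0 : (n : ℝ) ≠ 0 := by positivity
  have hpi := Real.pi_pos
  have : (i : ℝ) = n * k := by
    field_simp at hk
    linarith
  exact_mod_cast this

variable (n q : ℕ)

/-- The height of the tile with centre `d centre`: the hyperbolic cosine of its distance from `P`,
up to a constant factor. -/
def height (P : Space) (d : Equiv.Perm Space) : ℝ := form P (d centre)

lemma form_inv_left {d : Equiv.Perm Space} (hd : d ∈ darts n q) (x y : Space) :
    form (d⁻¹ x) y = form x (d y) := by
  rw [← (darts_le_properGroup n q hd).1, show d (d⁻¹ x) = x from d.apply_symm_apply x]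

lemma height_mul (P : Space) {d : Equiv.Perm Space} (hd : d ∈ darts n q) (e : Equiv.Perm Space) :
    height P (d * e) = form (d⁻¹ P) (e centre) := (form_inv_left n q hd _ _).symm

lemma height_eq (P : Space) {d : Equiv.Perm Space} (hd : d ∈ darts n q) :
    height P d = (d⁻¹ P).1 := by
  rw [height, ← form_inv_left n q hd]
  simp [form, centre]

lemma mul_rotA_zpow_inv_apply (d : Equiv.Perm Space) (i : ℤ) (x : Space) :
    (d * rotA n ^ i)⁻¹ x = (rotA n ^ (-i)) (d⁻¹ x) := by
  rw [mul_inv_rev, zpow_neg, Equiv.Perm.mul_apply]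

lemma form_apply_centre_self {d : Equiv.Perm Space} (hd : d ∈ darts n q) :
    form (d centre) (d centre) = 1 := by
  rw [(darts_le_properGroup n q hd).1]
  simp [form, centre]

lemma apply_centre_mem_cone {d : Equiv.Perm Space} (hd : d ∈ darts n q) : d centre ∈ cone :=
  ((darts_le_properGroup n q hd).2.2 _).2 (by simp [cone, centre])

lemma one_le_apply_centre {d : Equiv.Perm Space} (hd : d ∈ darts n q) : 1 ≤ (d centre).1 := by
  have h1 := form_apply_centre_self n q hd
  have h2 := (apply_centre_mem_cone n q hd).1
  rw [form] at h1
  nlinarith [sq_nonneg (d centre).2.1, sq_nonneg (d centre).2.2]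

lemma rotA_mul_rotB : rotA n * rotB n q = reflection n q 0 * reflection n q 2 := by
  change _ = rotA n * mirror * ((rotB n q)⁻¹ * mirror)
  rw [← mirror_mul_rotB, mul_assoc, ← mul_assoc mirror mirror, mirror_mul_mirror, one_mul]

variable [hn : Fact (5 ≤ n)] [hq : Fact (4 ≤ q)]

lemma reflection_zero_mul_two : reflection n q 0 * reflection n q 2 =
    reflection n q 2 * reflection n q 0 := by
  ext1 x
  refine wall_ext n q fun j => ?_
  simp only [Equiv.Perm.mul_apply]
  fin_cases j <;> (simp [wall_reflection_zero, wall_reflection_two]; try ring)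

lemma rotA_mul_rotB_mul_self : rotA n * rotB n q * (rotA n * rotB n q) = 1 := by
  rw [rotA_mul_rotB]
  nth_rw 2 [reflection_zero_mul_two]
  rw [mul_assoc, ← mul_assoc (reflection n q 2), reflection_mul_self, one_mul, reflection_mul_self]

lemma rotA_mul_rotB_centre : (rotA n * rotB n q) centre =
    (1 + 2 * sinhInradius n q ^ 2,
      2 * sinhInradius n q * coshInradius n q * Real.cos (Real.pi / n),
      2 * sinhInradius n q * coshInradius n q * Real.sin (Real.pi / n)) := by
  have h0 : reflection n q 0 centre = centre := by
    change rotA n (1, 0, -0) = _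
    rw [neg_zero]
    exact rot_apply_centre _
  have h := Real.sin_sq_add_cos_sq (Real.pi / n)
  have h' := sinhInradius_sq n q
  have h'' := coshInradius_mul_sin n q
  rw [rotA_mul_rotB, reflection_zero_mul_two, Equiv.Perm.mul_apply, h0]
  refine wall_ext n q fun j => ?_
  rw [wall_reflection_two]
  fin_cases j
  · simp [wall, centre]
    ring
  · simp [wall, centre]
    linear_combination (-2 * sinhInradius n q) * h''
  · simp [wall, centre]
    linear_combination (-2 * sinhInradius n q) * h' +
      (2 * sinhInradius n q * coshInradius n q ^ 2) * h

/-- A tile is visible over a side from `P` if and only if this side separates it from `P`. -/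
lemma height_lt_iff (P : Space) {d : Equiv.Perm Space} (hd : d ∈ darts n q) :
    height P (d * rotA n * rotB n q) < height P d ↔ wall n q 2 (d⁻¹ P) < 0 := by
  rw [mul_assoc, height_mul n q P hd, height_eq n q P hd, rotA_mul_rotB_centre]
  have h := sinhInradius_pos n q
  have e : form (d⁻¹ P) (1 + 2 * sinhInradius n q ^ 2,
      2 * sinhInradius n q * coshInradius n q * Real.cos (Real.pi / n),
      2 * sinhInradius n q * coshInradius n q * Real.sin (Real.pi / n)) =
      (d⁻¹ P).1 + 2 * sinhInradius n q * wall n q 2 (d⁻¹ P) := by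
    rw [form, wall_two]
    ring
  rw [e, add_lt_iff_neg_left]
  exact ⟨fun h' => by by_contra! h0; exact h'.not_ge (by positivity),
    fun h' => mul_neg_of_pos_of_neg (by positivity) h'⟩

/-- From a point inside the base tile, only the base tile is not behind one of its sides. -/
lemma exists_eq_rotA_zpow_of_height {P : Space} (hP : ∀ i, 0 < wall n q i P)
    {d : Equiv.Perm Space} (hd : d ∈ darts n q)
    (h : ∀ i : ℤ, ¬ height P (d * rotA n ^ i * rotA n * rotB n q) < height P (d * rotA n ^ i)) :
    ∃ i : ℤ, d = rotA n ^ i := by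
  obtain ⟨w, hw, hwc, hwy⟩ := exists_mem_chamber n q (y := d⁻¹ P) fun i => by
    have := h (-i)
    rwa [height_lt_iff n q P (mul_mem hd (zpow_mem (rotA_mem n q) _)), mul_rotA_zpow_inv_apply,
      neg_neg, not_lt] at this
  have h1 := ((reflectionSystem n q).eq_and_mem_closure_of_mem_chamber
    (mul_mem hw (inv_mem (darts_le_group n q hd))) (x := P) (fun i => (hP i).le)
    (by rwa [Equiv.Perm.mul_apply])).2
  have h2 : {i | (reflectionSystem n q).f i P = 0} = ∅ := by
    ext i
    exact iff_of_false (hP i).ne' id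
  rw [h2, Set.image_empty, Subgroup.closure_empty, Subgroup.mem_bot, mul_inv_eq_one] at h1
  refine exists_eq_rotA_zpow n q hd ?_
  rw [← h1, hwc]

/-- Centres of different tiles have a distance of more than the inradius. -/
lemma apply_centre_eq_of_le {d : Equiv.Perm Space} (hd : d ∈ darts n q)
    (h : coshInradius n q ^ 2 * ((d centre).1 ^ 2 - 1) ≤ sinhInradius n q ^ 2) :
    d centre = centre := by
  have hs := sinhInradius_pos n q
  have hc := coshInradius_pos n q
  have h1 := form_apply_centre_self n q hd
  have h2 := one_le_apply_centre n q hd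
  rw [form] at h1
  obtain ⟨w, hw, hwc, hwy⟩ := exists_mem_chamber n q (y := d centre) fun i => by
    rw [rotA_zpow, rot_apply, wall_two]
    dsimp only
    set y := d centre
    set θ := (i : ℝ) * (2 * (Real.pi / n))
    set α := Real.pi / n
    rw [show Real.cos α * (Real.cos θ * y.2.1 - Real.sin θ * y.2.2) + Real.sin α *
      (Real.sin θ * y.2.1 + Real.cos θ * y.2.2) = Real.cos (α - θ) * y.2.1 +
        Real.sin (α - θ) * y.2.2 by rw [Real.cos_sub, Real.sin_sub]; ring]
    have h3 : (Real.cos (α - θ) * y.2.1 + Real.sin (α - θ) * y.2.2) ^ 2 ≤ y.1 ^ 2 - 1 := by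
      have := Real.sin_sq_add_cos_sq (α - θ)
      nlinarith [sq_nonneg (Real.sin (α - θ) * y.2.1 - Real.cos (α - θ) * y.2.2)]
    have h4 : (coshInradius n q * (Real.cos (α - θ) * y.2.1 + Real.sin (α - θ) * y.2.2)) ^ 2 ≤
        (sinhInradius n q * y.1) ^ 2 := by
      rw [mul_pow]
      nlinarith [mul_le_mul_of_nonneg_left h3 (sq_nonneg (coshInradius n q)),
        mul_nonneg (sq_nonneg (sinhInradius n q)) (by nlinarith : (0 : ℝ) ≤ y.1 ^ 2 - 1)]
    have := abs_le_of_sq_le_sq h4 (by positivity)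
    linarith [(abs_le.1 this).2]
  have h5 := ((reflectionSystem n q).eq_and_mem_closure_of_mem_chamber
    (mul_mem hw (darts_le_group n q hd)) (centre_mem_chamber n q)
    (by rwa [Equiv.Perm.mul_apply])).1
  rw [Equiv.Perm.mul_apply] at h5
  exact w.injective (h5.trans hwc.symm)

/-- Only finitely many tiles have their centre in a given bounded set. -/
lemma finite_apply_centre (C : ℝ) :
    {y : Space | ∃ d ∈ darts n q, y = d centre ∧ y.1 ≤ C}.Finite := by
  have hc := coshInradius_pos n q
  have hc1 : 1 < coshInradius n q ^ 2 := by
    have := sinhInradius_sq n q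
    have := sinhInradius_pos n q
    nlinarith
  -- By `apply_centre_eq_of_le`, the form takes values above `s` on different centres.
  obtain ⟨s, hs1, hs⟩ : ∃ s : ℝ, 1 < s ∧ coshInradius n q ^ 2 * (s ^ 2 - 1) ≤
      sinhInradius n q ^ 2 := by
    refine ⟨√(2 - 1 / coshInradius n q ^ 2), ?_, ?_⟩
    · rw [Real.lt_sqrt (by norm_num)]
      have : 1 / coshInradius n q ^ 2 < 1 := by rwa [div_lt_one (by positivity)]
      linarith
    · have : 1 / coshInradius n q ^ 2 < 1 := by rwa [div_lt_one (by positivity)]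
      rw [Real.sq_sqrt (by linarith), sinhInradius_sq]
      apply le_of_eq
      field_simp
      ring
  set S := {y : Space | ∃ d ∈ darts n q, y = d centre ∧ y.1 ≤ C}
  have hform : ∀ y ∈ S, form y y = 1 := by
    rintro _ ⟨d, hd, rfl, -⟩
    exact form_apply_centre_self n q hd
  have hsep : ∀ y ∈ S, ∀ y' ∈ S, y ≠ y' → s < form y y' := by
    rintro _ ⟨d, hd, rfl, -⟩ _ ⟨d', hd', rfl, -⟩ hne
    by_contra! hle
    refine hne ?_
    have hm := mul_mem (inv_mem hd) hd'
    have h1 : form (d centre) (d' centre) = ((d⁻¹ * d') centre).1 := by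
      have h0 : form centre ((d⁻¹ * d') centre) = ((d⁻¹ * d') centre).1 := by simp [form, centre]
      rw [← h0, Equiv.Perm.mul_apply, ← form_inv_left n q (inv_mem hd), inv_inv]
    have h2 := one_le_apply_centre n q hm
    have h3 := apply_centre_eq_of_le n q hm (by
      refine le_trans ?_ hs
      gcongr
      rwa [← h1])
    exact (Equiv.Perm.inv_eq_iff_eq.1 h3).symm
  have hdist : ∀ y ∈ S, ∀ y' ∈ S, dist y y' < √(s - 1) → y = y' := by
    intro y hy y' hy' h
    by_contra hne
    have h1 := hsep y hy y' hy' hne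
    have h2 := hform y hy
    have h3 := hform y' hy'
    rw [form] at h1 h2 h3
    have h4 : dist y.2.1 y'.2.1 < √(s - 1) :=
      lt_of_le_of_lt ((le_max_left _ _).trans (le_max_right _ _)) h
    have h5 : dist y.2.2 y'.2.2 < √(s - 1) :=
      lt_of_le_of_lt ((le_max_right _ _).trans (le_max_right _ _)) h
    have h6 := Real.sq_sqrt (show 0 ≤ s - 1 by linarith)
    rw [Real.dist_eq] at h4 h5
    have h7 := sq_lt_sq' (by linarith [abs_nonneg (y.2.1 - y'.2.1)]) h4
    have h8 := sq_lt_sq' (by linarith [abs_nonneg (y.2.2 - y'.2.2)]) h5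
    rw [sq_abs] at h7 h8
    nlinarith [sq_nonneg (y.1 - y'.1)]
  have hbdd : S ⊆ Metric.closedBall 0 |C| := by
    intro y hy
    have h1 := hform y hy
    obtain ⟨d, hd, hyd, hC⟩ := hy
    have h2 := one_le_apply_centre n q hd
    rw [← hyd] at h2
    rw [form] at h1
    have h3 : y.1 ≤ |C| := hC.trans (le_abs_self C)
    rw [mem_closedBall_zero_iff, norm_prod_le_iff, norm_prod_le_iff]
    simp only [Real.norm_eq_abs]
    refine ⟨?_, ?_, ?_⟩
    · rwa [abs_of_nonneg (by linarith)]
    · exact (abs_le_of_sq_le_sq (by nlinarith [sq_nonneg y.2.2]) (by linarith)).trans h3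
    · exact (abs_le_of_sq_le_sq (by nlinarith [sq_nonneg y.2.1]) (by linarith)).trans h3
  have htb : TotallyBounded S := (isCompact_closedBall 0 |C|).totallyBounded.subset hbdd
  obtain ⟨t, ht, hcov⟩ := Metric.totallyBounded_iff.1 htb (√(s - 1) / 2)
    (half_pos (Real.sqrt_pos.2 (by linarith)))
  have hex : ∀ y ∈ S, ∃ x ∈ t, dist y x < √(s - 1) / 2 := by
    intro y hy
    obtain ⟨x, hx, hyx⟩ := Set.mem_iUnion₂.1 (hcov hy)
    exact ⟨x, hx, hyx⟩
  choose! g hg hgd using hex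
  refine Set.Finite.of_finite_image (f := g) (ht.subset (Set.image_subset_iff.2 hg)) ?_
  intro y hy y' hy' he
  refine hdist y hy y' hy' ?_
  have h1 := hgd y hy
  have h2 := hgd y' hy'
  rw [← he] at h2
  have := dist_triangle_right y y' (g y)
  linarith

end HyperbolicTiling

namespace HyperbolicTiling

open Minkowski

/-! ### The geometric properties of the heights -/

variable (n q : ℕ)

lemma height_rotA_zpow {n : ℕ} (P : Space) (d : Equiv.Perm Space) (i : ℤ) :
    height P (d * rotA n ^ i) = height P d := by
  rw [height, height, Equiv.Perm.mul_apply, rotA_zpow, rot_apply_centre]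

variable [hn : Fact (5 ≤ n)] [hq : Fact (4 ≤ q)]

/-- A point inside the fundamental triangle from which all tiles have different distances. It is
given by the vector on its ray whose time coordinate is `1`, and it is not too far from the centre
of the base tile. -/
structure IsGeneric (P : Space) : Prop where
  wall_pos : ∀ i, 0 < wall n q i P
  mem_cone : P ∈ cone
  fst_eq : P.1 = 1
  abs_add_abs_le : |P.2.1| + |P.2.2| ≤ 1 / 2
  apply_centre_eq : ∀ d ∈ darts n q, ∀ d' ∈ darts n q,
    height P d = height P d' → d centre = d' centre

/-- The points in general position exist, as the heights of two different tiles agree at only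
finitely many points of the curve `u ↦ (1, u, u²)`. -/
lemma exists_isGeneric : ∃ P, IsGeneric n q P := by
  have hs := sin_n_pos n
  have h0 : ∀ᶠ u : ℝ in nhds 0, 0 < Real.sin (Real.pi / n) - Real.cos (Real.pi / n) * u :=
    ContinuousAt.eventually_lt (f := fun _ => 0) (by fun_prop) (by fun_prop) (by simpa using hs)
  have h1 : ∀ᶠ u : ℝ in nhds 0, 0 < wall n q 2 (1, u, u ^ 2) := by
    simp only [wall_two]
    exact ContinuousAt.eventually_lt (f := fun _ => 0) (by fun_prop) (by fun_prop)
      (by simpa using sinhInradius_pos n q)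
  have h2 : ∀ᶠ u : ℝ in nhds 0, u + u ^ 2 < 1 / 2 :=
    ContinuousAt.eventually_lt (g := fun _ => 1 / 2) (by fun_prop) (by fun_prop) (by norm_num)
  obtain ⟨ε, hε, hball⟩ := Metric.eventually_nhds_iff.1 (h0.and (h1.and h2))
  set B : Set ℝ := ⋃ d ∈ (darts n q : Set (Equiv.Perm Space)),
    ⋃ d' ∈ (darts n q : Set (Equiv.Perm Space)),
      {u | d centre ≠ d' centre ∧ height (1, u, u ^ 2) d = height (1, u, u ^ 2) d'}
  have hB : B.Countable := by
    refine (countable_darts n q).biUnion fun d _ => (countable_darts n q).biUnion fun d' _ => ?_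
    refine Set.Finite.countable ?_
    by_cases hne : d centre = d' centre
    · simp [hne]
    set x := d centre
    set y := d' centre
    set p : Polynomial ℝ := Polynomial.C (x.1 - y.1) - Polynomial.C (x.2.1 - y.2.1) * Polynomial.X -
      Polynomial.C (x.2.2 - y.2.2) * Polynomial.X ^ 2 with hp
    have hp0 : p ≠ 0 := by
      intro h
      have he : ∀ u, p.eval u = 0 := fun u => by rw [h, Polynomial.eval_zero]
      have e0 := he 0
      have e1 := he 1
      have e2 := he (-1)
      simp only [hp, Polynomial.eval_sub, Polynomial.eval_mul, Polynomial.eval_C,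
        Polynomial.eval_X, Polynomial.eval_pow] at e0 e1 e2
      exact hne (Prod.ext (by linarith) (Prod.ext (by linarith) (by linarith)))
    refine (p.roots.toFinset.finite_toSet).subset ?_
    rintro u ⟨-, hu⟩
    rw [Finset.mem_coe, Multiset.mem_toFinset, Polynomial.mem_roots hp0, Polynomial.IsRoot]
    simp only [height, form] at hu
    simp only [hp, Polynomial.eval_sub, Polynomial.eval_mul, Polynomial.eval_C, Polynomial.eval_X,
      Polynomial.eval_pow]
    linear_combination hu
  obtain ⟨u, hu, hu0, huε⟩ := (hB.dense_compl ℝ).exists_between hε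
  obtain ⟨h0, h1, h2⟩ := hball (show dist u 0 < ε by
    rwa [Real.dist_eq, sub_zero, abs_of_pos hu0])
  refine ⟨(1, u, u ^ 2), ⟨fun i => ?_, ⟨one_pos, ?_⟩, rfl, ?_, fun d hd d' hd' h => ?_⟩⟩
  · fin_cases i
    · have := mul_pos hu0 h0
      change 0 < wall n q 0 _
      rw [wall_zero]
      dsimp only
      linarith
    · exact pow_pos hu0 2
    · exact h1
  · dsimp only
    nlinarith [pow_pos hu0 2]
  · dsimp only
    rw [abs_of_pos hu0, abs_of_pos (pow_pos hu0 2)]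
    exact h2.le
  · by_contra hne
    exact hu (Set.mem_iUnion₂.2 ⟨d, hd, Set.mem_iUnion₂.2 ⟨d', hd', hne, h⟩⟩)

variable {n q}

lemma IsGeneric.height_eq_iff {P : Space} (hP : IsGeneric n q P) {d d' : Equiv.Perm Space}
    (hd : d ∈ darts n q) (hd' : d' ∈ darts n q) :
    height P d = height P d' ↔ ∃ i : ℤ, d' = d * rotA n ^ i := by
  constructor
  · intro h
    have h1 := hP.apply_centre_eq d hd d' hd' h
    obtain ⟨i, hi⟩ := exists_eq_rotA_zpow n q (mul_mem (inv_mem hd) hd')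
      (by rw [Equiv.Perm.mul_apply, ← h1, Equiv.Perm.inv_eq_iff_eq])
    exact ⟨i, by rw [← hi, mul_inv_cancel_left]⟩
  · rintro ⟨i, rfl⟩
    exact (height_rotA_zpow P d i).symm

lemma IsGeneric.finite_height_le {P : Space} (hP : IsGeneric n q P) (C : ℝ) :
    {t | (∃ d ∈ darts n q, height P d = t) ∧ t ≤ C}.Finite := by
  refine ((finite_apply_centre n q (2 * C)).image (form P)).subset ?_
  rintro _ ⟨⟨d, hd, rfl⟩, hC⟩
  refine ⟨d centre, ⟨d, hd, rfl, ?_⟩, rfl⟩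
  have h1 := one_le_apply_centre n q hd
  have h2 := (apply_centre_mem_cone n q hd).2
  have h3 := hP.abs_add_abs_le
  rw [height, form, hP.fst_eq, one_mul] at hC
  have h4 : |(d centre).2.1| ≤ (d centre).1 :=
    abs_le_of_sq_le_sq (by nlinarith [sq_nonneg (d centre).2.2]) (by linarith)
  have h5 : |(d centre).2.2| ≤ (d centre).1 :=
    abs_le_of_sq_le_sq (by nlinarith [sq_nonneg (d centre).2.1]) (by linarith)
  have h6 : P.2.1 * (d centre).2.1 ≤ |P.2.1| * (d centre).1 :=
    (le_abs_self _).trans (by rw [abs_mul]; gcongr)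
  have h7 : P.2.2 * (d centre).2.2 ≤ |P.2.2| * (d centre).1 :=
    (le_abs_self _).trans (by rw [abs_mul]; gcongr)
  nlinarith

lemma sin_sq_add_int_mul_pi (x : ℝ) (k : ℤ) :
    Real.sin (x + k * Real.pi) ^ 2 = Real.sin x ^ 2 := by
  rw [Real.sin_add_int_mul_pi, mul_pow, ← zpow_natCast, ← zpow_mul, mul_comm k, zpow_mul]
  simp

/-- Unless `i` is `0` or `±1` modulo `n`, the angle `i π / n` is at least `2 π / n` away from the
multiples of `π`. -/
lemma dvd_of_sin_sq_lt {i : ℤ}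
    (h : Real.sin (i * (Real.pi / n)) ^ 2 < 2 * Real.sin (Real.pi / n) ^ 2) :
    (n : ℤ) ∣ i ∨ (n : ℤ) ∣ i - 1 ∨ (n : ℤ) ∣ i + 1 := by
  by_contra! hcon
  have hn5 := hn.out
  have hn0 : (n : ℝ) ≠ 0 := by positivity
  obtain ⟨ha, ha'⟩ := angle_n n
  have hα : (n : ℝ) * (Real.pi / n) = Real.pi := by field_simp
  set α := Real.pi / n with hαdef
  have hd := Int.emod_add_mul_ediv i n
  have h0 := Int.emod_nonneg i (show (n : ℤ) ≠ 0 by omega)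
  have h1 := Int.emod_lt_of_pos i (show (0 : ℤ) < n by omega)
  obtain ⟨j, hj⟩ : ∃ j, j = i % n := ⟨_, rfl⟩
  obtain ⟨k, hk⟩ : ∃ k, k = i / n := ⟨_, rfl⟩
  rw [← hj, ← hk] at hd
  rw [← hj] at h0 h1
  have hj2 : 2 ≤ j := by
    by_contra! hlt
    interval_cases j
    · exact hcon.1 ⟨k, by omega⟩
    · exact hcon.2.1 ⟨k, by omega⟩
  have hjn : j ≤ n - 2 := by
    by_contra! hlt
    exact hcon.2.2 ⟨k + 1, by rw [mul_add, mul_one]; omega⟩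
  have hi : (i : ℝ) * α = j * α + k * Real.pi := by
    rw [← hd, ← hα]
    push_cast
    ring
  rw [hi, sin_sq_add_int_mul_pi] at h
  have hj2' : (2 : ℝ) ≤ j := by exact_mod_cast hj2
  have hjn' : (j : ℝ) ≤ n - 2 := by exact_mod_cast hjn
  have hge : Real.sin (2 * α) ≤ Real.sin (j * α) := by
    rw [← Real.cos_pi_div_two_sub, ← Real.cos_pi_div_two_sub, ← Real.cos_abs (_ - j * α)]
    refine Real.cos_le_cos_of_nonneg_of_le_pi (abs_nonneg _) (by linarith) ?_
    rw [abs_le]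
    constructor <;> nlinarith
  have hs := sin_n_pos n
  have hc := cos_n_pos n
  have hc2 := half_lt_cos_sq_n n
  rw [Real.sin_two_mul] at hge
  have h3 : (2 * Real.sin α * Real.cos α) ^ 2 ≤ Real.sin (j * α) ^ 2 :=
    pow_le_pow_left₀ (by positivity) hge 2
  have h4 : 0 < Real.sin α ^ 2 := by positivity
  nlinarith

/-- A tile is separated from `P` by at most two of its sides, which are adjacent. -/
lemma IsGeneric.dvd_of_lower {P : Space} (hP : IsGeneric n q P) {d : Equiv.Perm Space}
    (hd : d ∈ darts n q) (i : ℤ) (h1 : height P (d * rotA n * rotB n q) < height P d)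
    (h2 : height P (d * rotA n ^ i * rotA n * rotB n q) < height P (d * rotA n ^ i)) :
    (n : ℤ) ∣ i ∨ (n : ℤ) ∣ i - 1 ∨ (n : ℤ) ∣ i + 1 := by
  rw [height_lt_iff n q P hd] at h1
  rw [height_lt_iff n q P (mul_mem hd (zpow_mem (rotA_mem n q) i)), mul_rotA_zpow_inv_apply] at h2
  obtain ⟨hκ0, hκ⟩ := ((darts_le_properGroup n q (inv_mem hd)).2.2 _).2 hP.mem_cone
  generalize d⁻¹ P = κ at *
  have hs := sinhInradius_pos n q
  have hc := coshInradius_pos n q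
  refine dvd_of_sin_sq_lt ?_
  rw [rotA_zpow, rot_apply, wall_two] at h2
  rw [wall_two] at h1
  dsimp only at h2
  push_cast at h2
  rw [neg_mul, Real.cos_neg, Real.sin_neg] at h2
  have hsq := sinhInradius_sq n q
  have hcs := coshInradius_mul_sin n q
  have hq2 := half_le_cos_sq_q q
  have hsn := sin_n_pos n
  set α := Real.pi / n
  set x := (i : ℝ) * α with hx
  rw [show (i : ℝ) * (2 * α) = x + x by rw [hx]; ring, Real.cos_add, Real.sin_add] at h2
  have ht := Real.sin_sq_add_cos_sq x
  have ht' := Real.sin_sq_add_cos_sq (α + x)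
  -- The sum of the two inequalities bounds the component of `κ` in the direction `α + x`.
  have h3 : sinhInradius n q * κ.1 < coshInradius n q * (Real.cos x *
      (Real.cos (α + x) * κ.2.1 + Real.sin (α + x) * κ.2.2)) := by
    rw [Real.cos_add, Real.sin_add]
    have e : 2 * (coshInradius n q * (Real.cos x * ((Real.cos α * Real.cos x - Real.sin α *
        Real.sin x) * κ.2.1 + (Real.sin α * Real.cos x + Real.cos α * Real.sin x) * κ.2.2))) =
        coshInradius n q * (Real.cos α * κ.2.1 + Real.sin α * κ.2.2) +
        coshInradius n q * (Real.cos α * ((Real.cos x * Real.cos x - Real.sin x * Real.sin x) *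
          κ.2.1 - -(Real.sin x * Real.cos x + Real.cos x * Real.sin x) * κ.2.2) +
          Real.sin α * (-(Real.sin x * Real.cos x + Real.cos x * Real.sin x) * κ.2.1 +
            (Real.cos x * Real.cos x - Real.sin x * Real.sin x) * κ.2.2)) := by
      linear_combination (coshInradius n q * (Real.cos α * κ.2.1 + Real.sin α * κ.2.2)) * ht
    linarith
  have h4 : (Real.cos (α + x) * κ.2.1 + Real.sin (α + x) * κ.2.2) ^ 2 ≤ κ.1 ^ 2 := by
    nlinarith [sq_nonneg (Real.sin (α + x) * κ.2.1 - Real.cos (α + x) * κ.2.2)]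
  have h5 : (sinhInradius n q * κ.1) ^ 2 < (coshInradius n q * (Real.cos x *
      (Real.cos (α + x) * κ.2.1 + Real.sin (α + x) * κ.2.2))) ^ 2 :=
    pow_lt_pow_left₀ h3 (by positivity) two_ne_zero
  have h6 : sinhInradius n q ^ 2 * κ.1 ^ 2 < coshInradius n q ^ 2 * Real.cos x ^ 2 * κ.1 ^ 2 := by
    rw [mul_pow, mul_pow, mul_pow] at h5
    refine h5.trans_le ?_
    rw [← mul_assoc]
    gcongr
  have h7 : sinhInradius n q ^ 2 < coshInradius n q ^ 2 * Real.cos x ^ 2 :=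
    lt_of_mul_lt_mul_right h6 (sq_nonneg _)
  have h8 : coshInradius n q ^ 2 * Real.sin x ^ 2 < 1 := by nlinarith
  have h9 : coshInradius n q ^ 2 * Real.sin x ^ 2 * Real.sin α ^ 2 < 1 * Real.sin α ^ 2 :=
    mul_lt_mul_of_pos_right h8 (by positivity)
  have h10 : Real.cos (Real.pi / q) ^ 2 * Real.sin x ^ 2 < Real.sin α ^ 2 := by
    rw [← hcs]
    linarith
  nlinarith [sq_nonneg (Real.sin x)]

/-- The heights of the tiles around a vertex, in their cyclic order. -/
lemma exists_height_rotB_zpow (P : Space) {d : Equiv.Perm Space} (hd : d ∈ darts n q) :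
    ∃ A r φ : ℝ, 0 ≤ r ∧ ∀ i : ℤ, height P (d * rotB n q ^ i) =
      A + r * Real.cos (φ - i * (2 * (Real.pi / q))) := by
  set y := (boost (circumradius n q))⁻¹ (d⁻¹ P)
  set z : ℂ := ⟨y.2.1, y.2.2⟩
  have h1 : y.2.1 = ‖z‖ * Real.cos z.arg := (Complex.norm_mul_cos_arg z).symm
  have h2 : y.2.2 = ‖z‖ * Real.sin z.arg := (Complex.norm_mul_sin_arg z).symm
  have hs := (sinh_pos n q).le
  refine ⟨Real.cosh (circumradius n q) * y.1, Real.sinh (circumradius n q) * ‖z‖, z.arg,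
    by positivity, fun i => ?_⟩
  rw [height_mul n q P hd, rotB_zpow]
  have h3 : form y (rot (i * (2 * (Real.pi / q))) ((boost (circumradius n q))⁻¹ centre)) =
      form (d⁻¹ P) ((boost (circumradius n q) * rot (i * (2 * (Real.pi / q))) *
        (boost (circumradius n q))⁻¹) centre) := by
    rw [← (boost_mem (circumradius n q)).1]
    exact congrArg (form · _) ((boost (circumradius n q)).apply_symm_apply _)
  rw [← h3, boost_inv_apply, rot_apply, form, h1, h2, Real.cos_sub]
  simp only [centre]
  ring

lemma angle_sector_q : 0 < 2 * (Real.pi / q) ∧ 2 * (Real.pi / q) ≤ Real.pi / 2 := by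
  obtain ⟨h1, h2⟩ := angle_q q
  constructor <;> linarith

lemma exists_of_local_min {A r φ δ : ℝ} (hr : 0 ≤ r) (hδ : 0 < δ) (hδ' : δ < 2 * Real.pi)
    {f : ℤ → ℝ} (hf : ∀ i : ℤ, f i = A + r * Real.cos (φ - i * δ)) {i : ℤ}
    (h1 : f i < f (i + 1)) (h2 : f i < f (i - 1)) :
    ∃ m : ℤ, |φ - i * δ - Real.pi - m * (2 * Real.pi)| < δ / 2 := by
  rw [hf, hf, add_lt_add_iff_left] at h1 h2
  have h1' := lt_of_mul_lt_mul_left h1 hr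
  have h2' := lt_of_mul_lt_mul_left h2 hr
  refine exists_abs_sub_lt_of_cos_lt hδ hδ' (h2'.trans_eq ?_) (h1'.trans_eq ?_) <;>
  · congr 1
    push_cast
    ring

/-- Among the tiles around a vertex, at most one is nearer to `P` than its two neighbours. -/
lemma dvd_of_local_min (P : Space) {d : Equiv.Perm Space} (hd : d ∈ darts n q) (i : ℤ)
    (h1 : height P d < height P (d * rotB n q)) (h2 : height P d < height P (d * (rotB n q)⁻¹))
    (h3 : height P (d * rotB n q ^ i) < height P (d * rotB n q ^ i * rotB n q))
    (h4 : height P (d * rotB n q ^ i) < height P (d * rotB n q ^ i * (rotB n q)⁻¹)) :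
    (q : ℤ) ∣ i := by
  obtain ⟨A, r, φ, hr, hf⟩ := exists_height_rotB_zpow P hd
  obtain ⟨hδ, hδ'⟩ := angle_sector_q (q := q)
  have hpi := Real.pi_pos
  have hq4 := hq.out
  have hqδ : (q : ℝ) * (2 * (Real.pi / q)) = 2 * Real.pi := by
    have : (q : ℝ) ≠ 0 := by positivity
    field_simp
  set δ := 2 * (Real.pi / q)
  rw [mul_assoc, ← zpow_add_one] at h3
  rw [mul_assoc, ← zpow_sub_one] at h4
  obtain ⟨m, hm⟩ := exists_of_local_min hr hδ (by linarith) hf (i := 0) (by simpa using h1)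
    (by simpa using h2)
  obtain ⟨m', hm'⟩ := exists_of_local_min hr hδ (by linarith) hf h3 h4
  rw [abs_lt] at hm hm'
  have h5 : |((i - q * (m - m') : ℤ) : ℝ)| < 1 := by
    push_cast at hm hm' ⊢
    refine lt_of_mul_lt_mul_right (a := δ) ?_ hδ.le
    rw [← abs_of_pos hδ, ← abs_mul, abs_of_pos hδ, sub_mul, mul_right_comm, hqδ, abs_lt]
    constructor <;> linarith
  have h6 : |i - q * (m - m')| < 1 := by exact_mod_cast h5
  exact ⟨m - m', by rw [Int.abs_lt_one_iff] at h6; linarith⟩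

/-- From the nearest tile at a vertex, the distances still increase in the second step. -/
lemma lt_of_local_min (P : Space) {d : Equiv.Perm Space} (hd : d ∈ darts n q)
    (h1 : height P d < height P (d * rotB n q)) (h2 : height P d < height P (d * (rotB n q)⁻¹)) :
    height P (d * rotB n q) < height P (d * rotB n q * rotB n q) := by
  obtain ⟨A, r, φ, hr, hf⟩ := exists_height_rotB_zpow P hd
  obtain ⟨hδ, hδ'⟩ := angle_sector_q (q := q)
  have hpi := Real.pi_pos
  set δ := 2 * (Real.pi / q)
  obtain ⟨m, hm⟩ := exists_of_local_min hr hδ (by linarith) hf (i := 0) (by simpa using h1)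
    (by simpa using h2)
  have hr' : 0 < r := by
    refine lt_of_le_of_ne hr fun h => ?_
    have e0 := hf 0
    have e1 := hf 1
    rw [← h] at e0 e1
    rw [zpow_zero, mul_one] at e0
    rw [zpow_one] at e1
    linarith
  obtain ⟨ε, hε⟩ : ∃ ε, ε = φ - Real.pi - m * (2 * Real.pi) := ⟨_, rfl⟩
  have hε' : |ε| < δ / 2 := by rw [hε]; simpa using hm
  have hc : ∀ t, Real.cos (φ - t) = -Real.cos (ε - t) := by
    intro t
    rw [show φ - t = ε - t + Real.pi + m * (2 * Real.pi) by rw [hε]; ring,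
      Real.cos_add_int_mul_two_pi, Real.cos_add_pi]
  have e1 := hf 1
  have e2 := hf 2
  rw [zpow_one] at e1
  rw [show (2 : ℤ) = 1 + 1 from rfl, zpow_add, zpow_one, ← mul_assoc] at e2
  rw [e1, e2, hc, hc, add_lt_add_iff_left]
  refine mul_lt_mul_of_pos_left (neg_lt_neg ?_) hr'
  rw [abs_lt] at hε'
  have e3 := Real.cos_sub_cos (ε - 1 * δ) (ε - (1 + 1) * δ)
  rw [show (ε - 1 * δ + (ε - (1 + 1) * δ)) / 2 = -(3 * δ / 2 - ε) by ring,
    show (ε - 1 * δ - (ε - (1 + 1) * δ)) / 2 = δ / 2 by ring, Real.sin_neg] at e3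
  rw [Int.cast_add, Int.cast_one]
  have h3 : 0 < Real.sin (3 * δ / 2 - ε) :=
    Real.sin_pos_of_pos_of_lt_pi (by linarith) (by linarith)
  have h4 : 0 < Real.sin (δ / 2) := Real.sin_pos_of_pos_of_lt_pi (by linarith) (by linarith)
  have := mul_pos h3 h4
  rw [← sub_pos]
  refine lt_of_lt_of_eq ?_ e3.symm
  linarith

lemma dvd_of_rotA_zpow_corner₀ {i : ℤ} (h : (rotA n ^ i) (corner₀ n q) = corner₀ n q) :
    (n : ℤ) ∣ i := by
  rw [rotA_zpow, rot_apply, corner₀_eq] at h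
  have h1 := congrArg (fun x : Space => x.2.1) h
  dsimp only at h1
  rw [mul_zero, sub_zero, mul_eq_right₀ (sinh_pos n q).ne'] at h1
  exact dvd_of_cos_eq_one (by linarith [hn.out]) h1

lemma dvd_of_rotB_zpow_rotA_corner₀ {i : ℤ}
    (h : (rotB n q ^ i * rotA n) (corner₀ n q) = rotA n (corner₀ n q)) : (q : ℤ) ∣ i := by
  have hs := sin_n_pos n
  have hc := cos_n_pos n
  have hL := sinh_pos n q
  rw [rotB_zpow, Equiv.Perm.mul_apply] at h
  generalize hx : rotA n (corner₀ n q) = x at h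
  have hx2 : x.2.2 = Real.sin (2 * (Real.pi / n)) * Real.sinh (circumradius n q) := by
    rw [← hx, rotA, rot_apply, corner₀_eq]
    simp
  have h1 := congrArg (fun z => (boost (circumradius n q))⁻¹ z) h
  rw [mul_assoc, Equiv.Perm.mul_apply, show ∀ z, (boost (circumradius n q))⁻¹
    (boost (circumradius n q) z) = z from Equiv.symm_apply_apply _, Equiv.Perm.mul_apply] at h1
  have hy2 : ((boost (circumradius n q))⁻¹ x).2.2 = x.2.2 := rfl
  have hpos : 0 < x.2.2 := by
    rw [hx2, Real.sin_two_mul]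
    positivity
  generalize (boost (circumradius n q))⁻¹ x = y at h1 hy2
  rw [rot_apply] at h1
  have h2 := congrArg (fun x : Space => x.2.1) h1
  have h3 := congrArg (fun x : Space => x.2.2) h1
  dsimp only at h2 h3
  have h4 := Real.sin_sq_add_cos_sq (i * (2 * (Real.pi / q)))
  refine dvd_of_cos_eq_one (by linarith [hq.out]) ?_
  generalize (i : ℝ) * (2 * (Real.pi / q)) = θ at *
  have h5 : (y.2.1 ^ 2 + y.2.2 ^ 2) * (Real.cos θ - 1) = 0 := by
    linear_combination y.2.1 * h2 + y.2.2 * h3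
  rcases mul_eq_zero.1 h5 with h6 | h6
  · exfalso
    rw [hy2] at h6
    have := pow_pos hpos 2
    nlinarith [sq_nonneg y.2.1]
  · linarith

end HyperbolicTiling

namespace HyperbolicTiling

open Minkowski

/-! ### The tiling of the upper half plane as a Morse tiling -/

/-- The isometry from the upper half plane to the hyperboloid model. -/
def embed (z : ℍ) : Space :=
  ((1 + (z.re ^ 2 + z.im ^ 2)) / (2 * z.im), (z.re ^ 2 + z.im ^ 2 - 1) / (2 * z.im),
    -z.re / z.im)

lemma embed_injective : Function.Injective embed := by
  intro z w h
  have hz := z.im_pos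
  have hw := w.im_pos
  have h1 := congrArg (fun x : Space => x.1 - x.2.1) h
  have h2 := congrArg (fun x : Space => x.2.2) h
  simp only [embed] at h1 h2
  have e : ∀ u : ℍ, (1 + (u.re ^ 2 + u.im ^ 2)) / (2 * u.im) -
      (u.re ^ 2 + u.im ^ 2 - 1) / (2 * u.im) = 1 / u.im := by
    intro u
    have hu := u.im_pos
    field_simp
    ring
  rw [e, e, one_div, one_div, inv_inj] at h1
  rw [h1, div_left_inj' hw.ne', neg_inj] at h2
  exact UpperHalfPlane.ext (Complex.ext h2 h1)

lemma embed_I : embed UpperHalfPlane.I = centre := by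
  simp [embed, centre]

lemma embed_smul (g : SL2R) (z : ℍ) : embed (g • z) =
    ((((g 1 0 * z.re + g 1 1) ^ 2 + (g 1 0 * z.im) ^ 2) +
        ((g 0 0 * z.re + g 0 1) ^ 2 + (g 0 0 * z.im) ^ 2)) / (2 * z.im),
      (((g 0 0 * z.re + g 0 1) ^ 2 + (g 0 0 * z.im) ^ 2) -
        ((g 1 0 * z.re + g 1 1) ^ 2 + (g 1 0 * z.im) ^ 2)) / (2 * z.im),
      -((g 0 0 * z.re + g 0 1) * (g 1 0 * z.re + g 1 1) + g 0 0 * g 1 0 * z.im ^ 2) / z.im) := by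
  have hz := z.im_pos
  have hdet : g 0 0 * g 1 1 - g 0 1 * g 1 0 = 1 := by rw [← Matrix.det_fin_two, g.det_coe]
  generalize ha : g 0 0 = a at *
  generalize hb : g 0 1 = b at *
  generalize hc : g 1 0 = c at *
  generalize hd : g 1 1 = d at *
  have hD : 0 < (c * z.re + d) ^ 2 + (c * z.im) ^ 2 := by
    by_cases h : c = 0
    · subst h
      have : d ≠ 0 := by
        rintro rfl
        simp at hdet
      simp only [zero_mul, zero_add]
      positivity
    · positivity
  have hgz := UpperHalfPlane.coe_specialLinearGroup_apply g z
  rw [ha, hb, hc, hd] at hgz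
  simp only [Algebra.algebraMap_self, RingHom.id_apply] at hgz
  have hre := congrArg Complex.re hgz
  have him := congrArg Complex.im hgz
  rw [Complex.div_re] at hre
  rw [Complex.div_im] at him
  simp only [Complex.normSq_apply, Complex.add_re, Complex.add_im, Complex.re_ofReal_mul,
    Complex.im_ofReal_mul, Complex.ofReal_re, Complex.ofReal_im, add_zero,
    UpperHalfPlane.coe_re, UpperHalfPlane.coe_im] at hre him
  obtain ⟨E, hE⟩ : ∃ E, E = (c * z.re + d) ^ 2 + (c * z.im) ^ 2 := ⟨_, rfl⟩
  rw [← hE] at hD ⊢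
  rw [show (c * z.re + d) * (c * z.re + d) + c * z.im * (c * z.im) = E by rw [hE]; ring,
    ← add_div] at hre
  rw [show (c * z.re + d) * (c * z.re + d) + c * z.im * (c * z.im) = E by rw [hE]; ring,
    ← sub_div, show a * z.im * (c * z.re + d) - (a * z.re + b) * (c * z.im) = z.im by
      linear_combination z.im * hdet] at him
  have hN : (g • z).re ^ 2 + (g • z).im ^ 2 =
      ((a * z.re + b) ^ 2 + (a * z.im) ^ 2) / E := by
    rw [hre, him]
    field_simp
    rw [hE]
    linear_combination (-z.im ^ 2 * (1 + (a * d - b * c))) * hdet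
  rw [embed, hN, hre, him]
  refine Prod.ext ?_ (Prod.ext ?_ ?_) <;> dsimp only <;> field_simp

lemma embed_rotation_smul (θ : ℝ) (z : ℍ) : embed (rotation θ • z) = rot θ (embed z) := by
  have hz := z.im_pos
  have e1 : Real.cos θ = 2 * Real.cos (θ / 2) ^ 2 - 1 := by
    rw [← Real.cos_two_mul, mul_div_cancel₀ _ two_ne_zero]
  have e2 : Real.sin θ = 2 * Real.sin (θ / 2) * Real.cos (θ / 2) := by
    rw [← Real.sin_two_mul, mul_div_cancel₀ _ two_ne_zero]
  have h := Real.sin_sq_add_cos_sq (θ / 2)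
  rw [embed_smul, embed, rot_apply, e1, e2]
  simp only [rotation, Matrix.of_apply, Matrix.cons_val', Matrix.cons_val_zero, Matrix.cons_val_one,
    Matrix.cons_val_fin_one]
  generalize Real.cos (θ / 2) = c at *
  generalize Real.sin (θ / 2) = s at *
  refine Prod.ext ?_ (Prod.ext ?_ ?_) <;> dsimp only <;> field_simp
  · linear_combination (z.re ^ 2 + z.im ^ 2 + 1) * h
  · linear_combination (-(z.re ^ 2 + z.im ^ 2 - 1)) * h
  · linear_combination z.re * h

lemma embed_translation_smul (t : ℝ) (z : ℍ) : embed (translation t • z) = boost t (embed z) := by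
  have hz := z.im_pos
  have e1 : Real.exp (t / 2) * Real.exp (t / 2) = Real.exp t := by
    rw [← Real.exp_add, add_halves]
  have e2 : Real.exp (-(t / 2)) * Real.exp (-(t / 2)) = Real.exp (-t) := by
    rw [← Real.exp_add]
    ring_nf
  have e3 : Real.exp (t / 2) * Real.exp (-(t / 2)) = 1 := by
    rw [← Real.exp_add]
    simp
  rw [embed_smul, embed, boost_apply, Real.cosh_eq, Real.sinh_eq, ← e1, ← e2]
  simp only [translation, Matrix.of_apply, Matrix.cons_val', Matrix.cons_val_zero,
    Matrix.cons_val_one, Matrix.cons_val_fin_one]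
  generalize Real.exp (t / 2) = c at *
  generalize Real.exp (-(t / 2)) = s at *
  refine Prod.ext ?_ (Prod.ext ?_ ?_) <;> dsimp only <;> field_simp
  · ring
  · ring
  · linear_combination (-z.re) * e3

variable (n q : ℕ)

lemma embed_baseVertex : embed (baseVertex n q) = corner₀ n q := by
  rw [baseVertex, embed_translation_smul, embed_I, corner₀]

/-- A matrix and a permutation of Minkowski space that act in the same way on the hyperbolic
plane. -/
def SameAction (g : SL2R) (d : Equiv.Perm Space) : Prop := ∀ z : ℍ, embed (g • z) = d (embed z)

variable {n q}

lemma SameAction.mul {g g' : SL2R} {d d' : Equiv.Perm Space} (h : SameAction g d)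
    (h' : SameAction g' d') : SameAction (g * g') (d * d') := by
  intro z
  rw [mul_smul, h, h', Equiv.Perm.mul_apply]

lemma SameAction.one : SameAction 1 1 := by
  intro z
  rw [one_smul, Equiv.Perm.one_apply]

lemma SameAction.inv {g : SL2R} {d : Equiv.Perm Space} (h : SameAction g d) :
    SameAction g⁻¹ d⁻¹ := by
  intro z
  rw [eq_comm, Equiv.Perm.inv_eq_iff_eq, ← h, smul_inv_smul]

lemma SameAction.pow {g : SL2R} {d : Equiv.Perm Space} (h : SameAction g d) (j : ℕ) :
    SameAction (g ^ j) (d ^ j) := by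
  induction j with
  | zero => exact SameAction.one
  | succ j ih =>
    rw [pow_succ, pow_succ]
    exact ih.mul h

lemma sameAction_tileRotation : SameAction (tileRotation n) (rotA n) := by
  intro z
  rw [tileRotation, rotA, embed_rotation_smul, mul_div_assoc]

lemma sameAction_vertexRotation : SameAction (vertexRotation n q) (rotB n q) :=
  (SameAction.mul (embed_translation_smul _)
    (fun z => by rw [embed_rotation_smul, mul_div_assoc])).mul
    (SameAction.inv (embed_translation_smul _))

lemma exists_sameAction_of_mem_darts {d : Equiv.Perm Space} (hd : d ∈ darts n q) :
    ∃ g ∈ rotationGroup n q, SameAction g d := by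
  induction hd using Subgroup.closure_induction with
  | mem x hx =>
    rcases hx with rfl | rfl
    · exact ⟨_, Subgroup.subset_closure (Or.inl rfl), sameAction_tileRotation⟩
    · exact ⟨_, Subgroup.subset_closure (Or.inr rfl), sameAction_vertexRotation⟩
  | one => exact ⟨1, one_mem _, SameAction.one⟩
  | mul x y _ _ hx hy =>
    obtain ⟨g, hg, h⟩ := hx
    obtain ⟨g', hg', h'⟩ := hy
    exact ⟨g * g', mul_mem hg hg', h.mul h'⟩
  | inv x _ hx =>
    obtain ⟨g, hg, h⟩ := hx
    exact ⟨g⁻¹, inv_mem hg, h.inv⟩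

lemma exists_sameAction_of_mem_rotationGroup {g : SL2R} (hg : g ∈ rotationGroup n q) :
    ∃ d ∈ darts n q, SameAction g d := by
  induction hg using Subgroup.closure_induction with
  | mem x hx =>
    rcases hx with rfl | rfl
    · exact ⟨_, rotA_mem n q, sameAction_tileRotation⟩
    · exact ⟨_, rotB_mem n q, sameAction_vertexRotation⟩
  | one => exact ⟨1, one_mem _, SameAction.one⟩
  | mul x y _ _ hx hy =>
    obtain ⟨g, hg, h⟩ := hx
    obtain ⟨g', hg', h'⟩ := hy
    exact ⟨g * g', mul_mem hg hg', h.mul h'⟩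
  | inv x _ hx =>
    obtain ⟨g, hg, h⟩ := hx
    exact ⟨g⁻¹, inv_mem hg, h.inv⟩

/-- The initial vertex of a dart. -/
def dartVertex (d : darts n q) : Vertex n q :=
  ⟨(exists_sameAction_of_mem_darts d.2).choose • baseVertex n q, _,
    (exists_sameAction_of_mem_darts d.2).choose_spec.1, rfl⟩

lemma embed_dartVertex (d : darts n q) : embed (dartVertex d).1 = d.1 (corner₀ n q) := by
  rw [← embed_baseVertex]
  exact (exists_sameAction_of_mem_darts d.2).choose_spec.2 _

lemma Vertex.ext_embed {x y : Vertex n q} (h : embed x.1 = embed y.1) : x = y :=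
  Subtype.ext (embed_injective h)

lemma dartVertex_eq_iff (d d' : darts n q) :
    dartVertex d = dartVertex d' ↔ d.1 (corner₀ n q) = d'.1 (corner₀ n q) := by
  rw [← embed_dartVertex, ← embed_dartVertex]
  exact ⟨fun h => by rw [h], Vertex.ext_embed⟩

lemma dartVertex_surjective : Function.Surjective (dartVertex (n := n) (q := q)) := by
  intro x
  obtain ⟨g, hg, hx⟩ := x.2
  obtain ⟨d, hd, h⟩ := exists_sameAction_of_mem_rotationGroup hg
  exact ⟨⟨d, hd⟩, Vertex.ext_embed (by rw [embed_dartVertex, hx, h, embed_baseVertex])⟩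

variable [hn : Fact (5 ≤ n)] [hq : Fact (4 ≤ q)]

variable (n q) in
/-- The tiling `{n, q}`, the heights of its tiles being their distances from a point in general
position. -/
def morseTiling : MorseTiling n q (darts n q) (Vertex n q) where
  a := ⟨rotA n, rotA_mem n q⟩
  b := ⟨rotB n q, rotB_mem n q⟩
  v := dartVertex
  h d := height (exists_isGeneric n q).choose d.1
  five_le_n := hn.out
  four_le_q := hq.out
  a_pow := Subtype.ext (rotA_pow n)
  b_pow := Subtype.ext (rotB_pow n q)
  a_mul_b := Subtype.ext (rotA_mul_rotB_mul_self n q)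
  v_surj := dartVertex_surjective
  v_eq_iff g g' := by
    rw [dartVertex_eq_iff]
    constructor
    · intro h
      obtain ⟨i, hi⟩ := exists_eq_rotB_zpow n q (mul_mem (inv_mem g.2) g'.2)
        (by rw [Equiv.Perm.mul_apply, ← h, Equiv.Perm.inv_eq_iff_eq])
      exact ⟨i, Subtype.ext (by
        change g'.1 = g.1 * rotB n q ^ i
        rw [← hi, mul_inv_cancel_left])⟩
    · rintro ⟨i, rfl⟩
      exact congrArg g.1 (rotB_zpow_apply_corner₀ n q i).symm
  dvd_of_v_mul_a_zpow g i h := by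
    rw [dartVertex_eq_iff] at h
    exact dvd_of_rotA_zpow_corner₀ (g.1.injective h)
  dvd_of_v_mul_b_zpow_mul_a g i h := by
    rw [dartVertex_eq_iff] at h
    exact dvd_of_rotB_zpow_rotA_corner₀ (g.1.injective h)
  h_eq_iff g g' := by
    rw [(exists_isGeneric n q).choose_spec.height_eq_iff g.2 g'.2]
    exact exists_congr fun i => ⟨fun h => Subtype.ext h, fun h => congrArg Subtype.val h⟩
  finite_h_le C := by
    refine ((exists_isGeneric n q).choose_spec.finite_height_le C).subset ?_
    rintro _ ⟨⟨d, rfl⟩, hC⟩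
    exact ⟨⟨d.1, d.2, rfl⟩, hC⟩
  exists_eq_a_zpow g h := by
    obtain ⟨i, hi⟩ := exists_eq_rotA_zpow_of_height n q
      (exists_isGeneric n q).choose_spec.wall_pos g.2 h
    exact ⟨i, Subtype.ext hi⟩
  dvd_of_lower g i h1 h2 := (exists_isGeneric n q).choose_spec.dvd_of_lower g.2 i h1 h2
  dvd_of_local_min g i h1 h2 h3 h4 := dvd_of_local_min _ g.2 i h1 h2 h3 h4
  lt_of_local_min g h1 h2 := lt_of_local_min _ g.2 h1 h2

lemma sides_eq_tile (g : rotationGroup n q) (d : darts n q) (h : SameAction g.1 d.1) :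
    sides g = (morseTiling n q).tile d := by
  have hc : ∀ j, corner g j = (morseTiling n q).v (d * (morseTiling n q).a ^ j) := by
    intro j
    refine Vertex.ext_embed ?_
    change embed (((g : SL2R) * tileRotation n ^ j) • baseVertex n q) = embed (dartVertex _).1
    rw [embed_dartVertex, (h.mul (sameAction_tileRotation.pow j)) _, embed_baseVertex]
    rfl
  ext e
  simp only [sides, MorseTiling.tile, hc]

lemma tiles_eq : tiles n q = Set.range (morseTiling n q).tile := by
  ext t
  constructor
  · rintro ⟨g, rfl⟩
    obtain ⟨d, hd, h⟩ := exists_sameAction_of_mem_rotationGroup g.2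
    exact ⟨⟨d, hd⟩, (sides_eq_tile g ⟨d, hd⟩ h).symm⟩
  · rintro ⟨d, rfl⟩
    obtain ⟨g, hg, h⟩ := exists_sameAction_of_mem_darts d.2
    exact ⟨⟨g, hg⟩, sides_eq_tile ⟨g, hg⟩ d h⟩

lemma edgeGraph_eq : edgeGraph n q = (morseTiling n q).graph fun _ => True := by
  rw [← SimpleGraph.fromEdgeSet_edgeSet ((morseTiling n q).graph fun _ => True), edgeGraph]
  congr 1
  ext e
  rw [MorseTiling.mem_edgeSet_graph, Set.mem_iUnion₂, tiles_eq]
  constructor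
  · rintro ⟨_, ⟨d, rfl⟩, he⟩
    obtain ⟨i, hi⟩ := (morseTiling n q).mem_tile_iff.1 he
    exact ⟨_, trivial, hi.symm⟩
  · rintro ⟨d, -, rfl⟩
    exact ⟨_, ⟨d, rfl⟩, (morseTiling n q).mem_tile_iff.2 ⟨0, by rw [zpow_zero, mul_one]⟩⟩

end HyperbolicTiling

namespace BruhatTits

/-! ### Lattices in the plane over a local field -/

variable {K : Type*} [NormedField K]

/-- A generator of the maximal ideal of the ring of integers. -/
structure IsUniformizer (ϖ : K) : Prop where
  ne_zero : ϖ ≠ 0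
  norm_lt_one : ‖ϖ‖ < 1
  norm_le : ∀ x : K, ‖x‖ < 1 → ‖x‖ ≤ ‖ϖ‖

lemma IsUniformizer.norm_pos {ϖ : K} (hϖ : IsUniformizer ϖ) : 0 < ‖ϖ‖ := norm_pos_iff.2 hϖ.ne_zero

lemma IsUniformizer.zpow_le_zpow_iff {ϖ : K} (hϖ : IsUniformizer ϖ) {i j : ℤ} :
    ‖ϖ‖ ^ i ≤ ‖ϖ‖ ^ j ↔ j ≤ i :=
  zpow_le_zpow_iff_right_of_lt_one₀ hϖ.norm_pos hϖ.norm_lt_one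

lemma IsUniformizer.zpow_lt_zpow_iff {ϖ : K} (hϖ : IsUniformizer ϖ) {i j : ℤ} :
    ‖ϖ‖ ^ i < ‖ϖ‖ ^ j ↔ j < i :=
  zpow_lt_zpow_iff_right_of_lt_one₀ hϖ.norm_pos hϖ.norm_lt_one

lemma IsUniformizer.exists_norm_eq_zpow {ϖ : K} (hϖ : IsUniformizer ϖ) {x : K} (hx : x ≠ 0) :
    ∃ i : ℤ, ‖x‖ = ‖ϖ‖ ^ i := by
  obtain ⟨i, hi1, hi2⟩ := exists_mem_Ico_zpow (norm_pos_iff.2 hx)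
    ((one_lt_inv₀ hϖ.norm_pos).2 hϖ.norm_lt_one)
  refine ⟨-i, le_antisymm ?_ (by rwa [zpow_neg, ← inv_zpow])⟩
  have hpos := zpow_pos hϖ.norm_pos (i + 1)
  have h1 : ‖x * ϖ ^ (i + 1)‖ < 1 := by
    rw [norm_mul, norm_zpow, ← lt_div_iff₀ hpos, one_div, ← inv_zpow]
    exact hi2
  have h2 := hϖ.norm_le _ h1
  rw [norm_mul, norm_zpow, ← le_div_iff₀ hpos, zpow_add₀ hϖ.norm_pos.ne', zpow_one,
    div_mul_cancel_right₀ hϖ.norm_pos.ne'] at h2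
  rwa [zpow_neg]

lemma IsUniformizer.lt_zpow_iff {ϖ : K} (hϖ : IsUniformizer ϖ) {x : K} {i : ℤ} :
    ‖x‖ < ‖ϖ‖ ^ i ↔ ‖x‖ ≤ ‖ϖ‖ ^ (i + 1) := by
  by_cases hx : x = 0
  · subst hx
    rw [norm_zero]
    exact iff_of_true (zpow_pos hϖ.norm_pos _) (zpow_pos hϖ.norm_pos _).le
  · obtain ⟨j, hj⟩ := hϖ.exists_norm_eq_zpow hx
    rw [hj, hϖ.zpow_lt_zpow_iff, hϖ.zpow_le_zpow_iff]
    exact Iff.rfl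

/-- A bounded set of elements that are not all zero has an element of maximal norm. -/
lemma IsUniformizer.exists_max_norm {ϖ : K} (hϖ : IsUniformizer ϖ) {ι : Type*} {S : Set ι}
    (g : ι → K) {C : ℝ} (hC : ∀ i ∈ S, ‖g i‖ ≤ C) (h0 : ∃ i ∈ S, g i ≠ 0) :
    ∃ i ∈ S, ∃ m : ℤ, ‖g i‖ = ‖ϖ‖ ^ m ∧ ∀ j ∈ S, ‖g j‖ ≤ ‖ϖ‖ ^ m := by
  obtain ⟨i₀, hi₀, hne⟩ := h0
  obtain ⟨m₀, hm₀⟩ := hϖ.exists_norm_eq_zpow hne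
  have hCpos : 0 < C := (norm_pos_iff.2 hne).trans_le (hC i₀ hi₀)
  obtain ⟨N, hN1, hN2⟩ := exists_mem_Ico_zpow hCpos
    ((one_lt_inv₀ hϖ.norm_pos).2 hϖ.norm_lt_one)
  rw [inv_zpow, ← zpow_neg] at hN2
  obtain ⟨m, ⟨i, hi, him⟩, hmin⟩ := Int.exists_least_of_bdd
    (P := fun m => ∃ i ∈ S, ‖g i‖ = ‖ϖ‖ ^ m)
    ⟨-(N + 1), by
      rintro z ⟨i, hi, hz⟩
      have := (hC i hi).trans_lt hN2
      rw [hz, hϖ.zpow_lt_zpow_iff] at this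
      exact this.le⟩ ⟨m₀, i₀, hi₀, hm₀⟩
  refine ⟨i, hi, m, him, fun j hj => ?_⟩
  by_cases hj0 : g j = 0
  · rw [hj0, norm_zero]
    exact (zpow_pos hϖ.norm_pos m).le
  · obtain ⟨k, hk⟩ := hϖ.exists_norm_eq_zpow hj0
    rw [hk, hϖ.zpow_le_zpow_iff]
    exact hmin k ⟨j, hj, hk⟩

variable [IsUltrametricDist K]

lemma mem_integers_iff {x : K} : x ∈ Integers K ↔ ‖x‖ ≤ 1 := by
  rw [Valuation.mem_valuationSubring_iff, NormedField.valuation_apply]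
  exact Iff.rfl

lemma norm_integers_le (a : Integers K) : ‖(a : K)‖ ≤ 1 := mem_integers_iff.1 a.2

lemma residue_eq_zero_iff (a : Integers K) : IsLocalRing.residue (Integers K) a = 0 ↔
    ‖(a : K)‖ < 1 := by
  rw [IsLocalRing.residue_eq_zero_iff, IsLocalRing.mem_maximalIdeal, mem_nonunits_iff]
  constructor
  · intro h
    refine lt_of_le_of_ne (norm_integers_le a) fun h1 => h ?_
    have h0 : (a : K) ≠ 0 := by
      rw [← norm_ne_zero_iff, h1]
      exact one_ne_zero
    have h2 : (a : K)⁻¹ ∈ Integers K := mem_integers_iff.2 (by rw [norm_inv, h1, inv_one])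
    exact IsUnit.of_mul_eq_one ⟨_, h2⟩ (Subtype.ext (mul_inv_cancel₀ h0))
  · intro h hu
    obtain ⟨c, hc⟩ := hu.exists_right_inv
    have h1 : ‖(a : K)‖ * ‖(c : K)‖ = 1 := by
      rw [← norm_mul, ← norm_one (α := K)]
      exact congrArg (fun x : Integers K => ‖(x : K)‖) hc
    have h2 := norm_integers_le c
    nlinarith [norm_nonneg (a : K), norm_nonneg (c : K)]

/-- In a locally compact field, the elements of norm less than one form a compact set. -/
lemma exists_isUniformizer (p : ℕ) [Fact p.Prime] (K : Type*) [NormedField K]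
    [IsUltrametricDist K] [NormedAlgebra ℚ_[p] K] [FiniteDimensional ℚ_[p] K] :
    ∃ ϖ : K, IsUniformizer ϖ := by
  have : ProperSpace K := FiniteDimensional.proper ℚ_[p] K
  have hcomp : IsCompact (Metric.ball (0 : K) 1) :=
    Metric.isCompact_of_isClosed_isBounded (IsUltrametricDist.isClosed_ball _ _)
      Metric.isBounded_ball
  obtain ⟨ϖ, h1, h2⟩ := hcomp.exists_isMaxOn (Metric.nonempty_ball.2 one_pos)
    continuous_norm.continuousOn
  have h2' : ∀ x : K, ‖x‖ < 1 → ‖x‖ ≤ ‖ϖ‖ := fun x hx => h2 (mem_ball_zero_iff.2 hx)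
  refine ⟨ϖ, ⟨?_, mem_ball_zero_iff.1 h1, h2'⟩⟩
  rintro rfl
  have h3 : ‖algebraMap ℚ_[p] K p‖ = (p : ℝ)⁻¹ := by rw [norm_algebraMap', Padic.norm_p]
  have hp : 1 < (p : ℝ) := by exact_mod_cast (Fact.out : p.Prime).one_lt
  have h4 := h2' (algebraMap ℚ_[p] K p) (by rw [h3]; exact inv_lt_one_of_one_lt₀ hp)
  rw [h3, norm_zero] at h4
  exact h4.not_gt (by positivity)

lemma norm_add_le_of_le {x y : K} {r : ℝ} (hx : ‖x‖ ≤ r) (hy : ‖y‖ ≤ r) : ‖x + y‖ ≤ r :=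
  (IsUltrametricDist.norm_add_le_max x y).trans (max_le hx hy)

lemma smul_apply (a : Integers K) (v : Fin 2 → K) (i : Fin 2) : (a • v) i = a * v i := rfl

lemma smul_def (a : Integers K) (x : K) : a • x = a * x := rfl

/-- The lattice spanned by the vectors `(ϖ ^ f, 0)` and `(b * ϖ ^ e, ϖ ^ e)`. -/
def span (ϖ b : K) (e f : ℤ) : Submodule (Integers K) (Fin 2 → K) where
  carrier := {v | ‖v 1‖ ≤ ‖ϖ‖ ^ e ∧ ‖v 0 - b * v 1‖ ≤ ‖ϖ‖ ^ f}
  zero_mem' := by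
    simp only [Set.mem_ofPred_eq, Pi.zero_apply, mul_zero, sub_zero, norm_zero]
    exact ⟨by positivity, by positivity⟩
  add_mem' := by
    rintro v w ⟨h1, h2⟩ ⟨h3, h4⟩
    refine ⟨norm_add_le_of_le h1 h3, ?_⟩
    rw [Pi.add_apply, Pi.add_apply, mul_add, add_sub_add_comm]
    exact norm_add_le_of_le h2 h4
  smul_mem' := by
    rintro a v ⟨h1, h2⟩
    have ha := norm_integers_le a
    have key : ∀ (x : K) (r : ℝ), ‖x‖ ≤ r → ‖(a : K) * x‖ ≤ r := by
      intro x r hx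
      rw [norm_mul]
      exact (mul_le_of_le_one_left (norm_nonneg x) ha).trans hx
    refine ⟨key _ _ h1, ?_⟩
    rw [smul_apply, smul_apply, mul_left_comm, ← mul_sub]
    exact key _ _ h2

lemma mem_span_iff {ϖ b : K} {e f : ℤ} {v : Fin 2 → K} :
    v ∈ span ϖ b e f ↔ ‖v 1‖ ≤ ‖ϖ‖ ^ e ∧ ‖v 0 - b * v 1‖ ≤ ‖ϖ‖ ^ f := Iff.rfl

namespace IsUniformizer

variable {ϖ : K}

lemma left_mem_span (ϖ b : K) (e f : ℤ) : ![ϖ ^ f, 0] ∈ span ϖ b e f := by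
  rw [mem_span_iff]
  simp only [Matrix.cons_val_zero, Matrix.cons_val_one, mul_zero, sub_zero, norm_zero, norm_zpow]
  exact ⟨by positivity, le_rfl⟩

lemma right_mem_span (ϖ b : K) (e f : ℤ) : ![b * ϖ ^ e, ϖ ^ e] ∈ span ϖ b e f := by
  rw [mem_span_iff]
  simp only [Matrix.cons_val_zero, Matrix.cons_val_one, sub_self, norm_zero, norm_zpow]
  exact ⟨le_rfl, by positivity⟩

lemma span_eq (hϖ : IsUniformizer ϖ) (b : K) (e f : ℤ) : span ϖ b e f =
    Submodule.span (Integers K) {![ϖ ^ f, 0], ![b * ϖ ^ e, ϖ ^ e]} := by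
  refine le_antisymm (fun v hv => ?_) (Submodule.span_le.2 ?_)
  · obtain ⟨h1, h2⟩ := hv
    have he := zpow_ne_zero e hϖ.ne_zero
    have hf := zpow_ne_zero f hϖ.ne_zero
    have hc : v 1 / ϖ ^ e ∈ Integers K := mem_integers_iff.2 (by
      rw [norm_div, norm_zpow]
      exact div_le_one_of_le₀ h1 (by positivity))
    have hd : (v 0 - b * v 1) / ϖ ^ f ∈ Integers K := mem_integers_iff.2 (by
      rw [norm_div, norm_zpow]
      exact div_le_one_of_le₀ h2 (by positivity))
    refine Submodule.mem_span_pair.2 ⟨⟨_, hd⟩, ⟨_, hc⟩, ?_⟩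
    ext i
    fin_cases i
    · simp [smul_def]
      field_simp
      ring
    · simp [smul_def]
      field_simp
  · rintro _ (rfl | rfl)
    · exact left_mem_span ϖ b e f
    · exact right_mem_span ϖ b e f

lemma isLattice_span (hϖ : IsUniformizer ϖ) (b : K) (e f : ℤ) : (span ϖ b e f).IsLattice K where
  fg := by
    rw [hϖ.span_eq]
    exact Submodule.fg_span (Set.toFinite _)
  span_eq_top := by
    refine eq_top_iff.2 fun v _ => ?_
    have he := zpow_ne_zero e hϖ.ne_zero
    have hf := zpow_ne_zero f hϖ.ne_zero
    have h1 := Submodule.smul_mem (Submodule.span K (span ϖ b e f : Set (Fin 2 → K)))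
      ((v 0 - b * v 1) / ϖ ^ f) (Submodule.subset_span (left_mem_span ϖ b e f))
    have h2 := Submodule.smul_mem (Submodule.span K (span ϖ b e f : Set (Fin 2 → K)))
      (v 1 / ϖ ^ e) (Submodule.subset_span (right_mem_span ϖ b e f))
    have h3 := add_mem h1 h2
    convert h3 using 1
    ext i
    fin_cases i
    · simp
      field_simp
      ring
    · simp
      field_simp

lemma span_le_span_iff (hϖ : IsUniformizer ϖ) {b b' : K} {e e' f f' : ℤ} :
    span ϖ b' e' f' ≤ span ϖ b e f ↔ e ≤ e' ∧ f ≤ f' ∧ ‖b' - b‖ * ‖ϖ‖ ^ e' ≤ ‖ϖ‖ ^ f := by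
  constructor
  · intro h
    have h1 := (h (left_mem_span ϖ b' e' f')).2
    obtain ⟨h2, h3⟩ := h (right_mem_span ϖ b' e' f')
    simp only [Matrix.cons_val_zero, Matrix.cons_val_one, mul_zero, sub_zero, norm_zpow,
      hϖ.zpow_le_zpow_iff, ← sub_mul, norm_mul] at h1 h2 h3
    exact ⟨h2, h1, h3⟩
  · rintro ⟨h1, h2, h3⟩ v ⟨h4, h5⟩
    refine ⟨h4.trans (hϖ.zpow_le_zpow_iff.2 h1), ?_⟩
    rw [show v 0 - b * v 1 = (v 0 - b' * v 1) + (b' - b) * v 1 by ring]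
    refine norm_add_le_of_le (h5.trans (hϖ.zpow_le_zpow_iff.2 h2)) ?_
    rw [norm_mul]
    exact (mul_le_mul_of_nonneg_left h4 (norm_nonneg _)).trans h3

lemma span_eq_span_iff (hϖ : IsUniformizer ϖ) {b b' : K} {e e' f f' : ℤ} :
    span ϖ b e f = span ϖ b' e' f' ↔ e = e' ∧ f = f' ∧ ‖b - b'‖ * ‖ϖ‖ ^ e ≤ ‖ϖ‖ ^ f := by
  constructor
  · intro h
    obtain ⟨h1, h2, h3⟩ := hϖ.span_le_span_iff.1 h.le
    obtain ⟨h4, h5, -⟩ := hϖ.span_le_span_iff.1 h.ge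
    obtain rfl := le_antisymm h1 h4
    obtain rfl := le_antisymm h2 h5
    exact ⟨rfl, rfl, h3⟩
  · rintro ⟨rfl, rfl, h⟩
    refine le_antisymm (hϖ.span_le_span_iff.2 ⟨le_rfl, le_rfl, h⟩)
      (hϖ.span_le_span_iff.2 ⟨le_rfl, le_rfl, ?_⟩)
    rwa [norm_sub_rev]

lemma smul_span (hϖ : IsUniformizer ϖ) {c : Kˣ} {m : ℤ} (hc : ‖(c : K)‖ = ‖ϖ‖ ^ m) (b : K)
    (e f : ℤ) : c • span ϖ b e f = span ϖ b (e + m) (f + m) := by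
  have hpos := zpow_pos hϖ.norm_pos m
  ext v
  have hmem : v ∈ c • span ϖ b e f ↔ ∃ w ∈ span ϖ b e f, c • w = v := Iff.rfl
  rw [hmem]
  have key : ∀ w : Fin 2 → K, c • w ∈ span ϖ b (e + m) (f + m) ↔ w ∈ span ϖ b e f := by
    intro w
    rw [mem_span_iff, mem_span_iff]
    have h1 : ∀ i, (c • w) i = c * w i := fun i => rfl
    rw [h1, h1, mul_left_comm, ← mul_sub, norm_mul, norm_mul, hc, zpow_add₀ hϖ.norm_pos.ne',
      zpow_add₀ hϖ.norm_pos.ne', mul_comm _ (‖ϖ‖ ^ m), mul_comm _ (‖ϖ‖ ^ m),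
      mul_le_mul_iff_right₀ hpos, mul_le_mul_iff_right₀ hpos]
  constructor
  · rintro ⟨w, hw, rfl⟩
    exact (key w).2 hw
  · intro hv
    exact ⟨c⁻¹ • v, (key _).1 (by rwa [smul_inv_smul]), smul_inv_smul c v⟩

lemma exists_norm_le_of_fg {M : Submodule (Integers K) (Fin 2 → K)} (hM : M.FG) :
    ∃ C : ℝ, ∀ v ∈ M, ∀ i, ‖v i‖ ≤ C := by
  obtain ⟨S, rfl⟩ := hM
  obtain ⟨C, hC⟩ := (S.finite_toSet.image fun v => ‖v‖).bddAbove
  refine ⟨max C 0, fun v hv => ?_⟩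
  induction hv using Submodule.span_induction with
  | mem v hv =>
    exact fun i => ((norm_le_pi_norm v i).trans (hC ⟨v, hv, rfl⟩)).trans (le_max_left _ _)
  | zero => exact fun i => by simp
  | add v w _ _ hv hw => exact fun i => norm_add_le_of_le (hv i) (hw i)
  | smul a v _ hv =>
    intro i
    rw [smul_apply, norm_mul]
    exact (mul_le_of_le_one_left (norm_nonneg _) (norm_integers_le a)).trans (hv i)

/-- Every lattice has a triangular basis. -/
lemma exists_eq_span (hϖ : IsUniformizer ϖ) (M : Submodule (Integers K) (Fin 2 → K))
    (hM : M.IsLattice K) : ∃ b e f, M = span ϖ b e f := by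
  obtain ⟨C, hC⟩ := exists_norm_le_of_fg hM.fg
  obtain ⟨v, hv, e, hve, hve'⟩ := hϖ.exists_max_norm (S := (M : Set (Fin 2 → K))) (fun v => v 1)
    (fun v hv => hC v hv 1) (by
      by_contra! h
      have h1 : Submodule.span K (M : Set (Fin 2 → K)) ≤ LinearMap.ker (LinearMap.proj 1) :=
        Submodule.span_le.2 fun v hv => h v hv
      rw [hM.span_eq_top] at h1
      have := h1 (Submodule.mem_top (x := fun _ => (1 : K)))
      exact one_ne_zero (α := K) this)
  have hv1 : v 1 ≠ 0 := by
    rw [← norm_ne_zero_iff, hve]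
    exact zpow_ne_zero _ hϖ.norm_pos.ne'
  -- The components of the elements of `M` along the first axis.
  have hsub : ∀ w ∈ M, w - (w 1 / v 1) • v ∈ M := by
    intro w hw
    have hc : w 1 / v 1 ∈ Integers K := mem_integers_iff.2 (by
      rw [norm_div, hve]
      exact div_le_one_of_le₀ (hve' w hw) (zpow_pos hϖ.norm_pos _).le)
    exact sub_mem hw (M.smul_mem ⟨_, hc⟩ hv)
  have hx : ∀ w : Fin 2 → K, (w - (w 1 / v 1) • v) 0 = w 0 - v 0 / v 1 * w 1 := by
    intro w
    simp
    ring
  have hy : ∀ w : Fin 2 → K, (w - (w 1 / v 1) • v) 1 = 0 := by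
    intro w
    simp [hv1]
  obtain ⟨u, ⟨hu, hu1⟩, f, huf, huf'⟩ := hϖ.exists_max_norm (S := {w | w ∈ M ∧ w 1 = 0})
    (fun w => w 0) (fun w hw => hC w hw.1 0) (by
      by_contra! h
      have h1 : Submodule.span K (M : Set (Fin 2 → K)) ≤
          LinearMap.ker (LinearMap.proj 0 - (v 0 / v 1) • LinearMap.proj 1 :
            (Fin 2 → K) →ₗ[K] K) :=
        Submodule.span_le.2 fun w hw => by
          have := h _ ⟨hsub w hw, hy w⟩
          rwa [hx] at this
      rw [hM.span_eq_top] at h1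
      have := h1 (Submodule.mem_top (x := ![(1 : K), 0]))
      simp at this)
  have hu0 : u 0 ≠ 0 := by
    rw [← norm_ne_zero_iff, huf]
    exact zpow_ne_zero _ hϖ.norm_pos.ne'
  refine ⟨v 0 / v 1, e, f, le_antisymm (fun w hw => ?_) fun w hw => ?_⟩
  · refine ⟨hve' w hw, ?_⟩
    rw [← hx]
    exact huf' _ ⟨hsub w hw, hy w⟩
  · obtain ⟨h1, h2⟩ := hw
    have hc : w 1 / v 1 ∈ Integers K := mem_integers_iff.2 (by
      rw [norm_div, hve]
      exact div_le_one_of_le₀ h1 (zpow_pos hϖ.norm_pos _).le)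
    have hd : (w 0 - v 0 / v 1 * w 1) / u 0 ∈ Integers K := mem_integers_iff.2 (by
      rw [norm_div, huf]
      exact div_le_one_of_le₀ h2 (zpow_pos hϖ.norm_pos _).le)
    have h3 := add_mem (M.smul_mem ⟨_, hc⟩ hv) (M.smul_mem ⟨_, hd⟩ hu)
    convert h3 using 1
    ext i
    fin_cases i
    · simp [smul_def]
      field_simp
      ring
    · simp [smul_def, hu1]
      field_simp

end IsUniformizer

end BruhatTits

namespace BruhatTits

/-! ### The Bruhat–Tits tree -/

variable {K : Type*} [NormedField K] [IsUltrametricDist K]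

namespace IsUniformizer

variable {ϖ : K} (hϖ : IsUniformizer ϖ)

/-- The vertex that corresponds to the ball with centre `b` and radius `‖ϖ‖ ^ m`. -/
def vertex (b : K) (m : ℤ) : Vertex K :=
  Quotient.mk (homothety K) ⟨span ϖ b 0 m, hϖ.isLattice_span b 0 m⟩

lemma mk_span (b : K) (e f : ℤ) :
    Quotient.mk (homothety K) ⟨span ϖ b e f, hϖ.isLattice_span b e f⟩ = hϖ.vertex b (f - e) := by
  refine Quotient.sound ⟨Units.mk0 (ϖ ^ e) (zpow_ne_zero e hϖ.ne_zero), ?_⟩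
  have := hϖ.smul_span (c := Units.mk0 (ϖ ^ e) (zpow_ne_zero e hϖ.ne_zero)) (m := e)
    (by rw [Units.val_mk0, norm_zpow]) b 0 (f - e)
  rw [zero_add, sub_add_cancel] at this
  exact this.symm

lemma vertex_eq_iff {b b' : K} {m m' : ℤ} :
    hϖ.vertex b m = hϖ.vertex b' m' ↔ m = m' ∧ ‖b - b'‖ ≤ ‖ϖ‖ ^ m := by
  constructor
  · intro h
    obtain ⟨c, hc⟩ := Quotient.exact h
    change span ϖ b 0 m = c • span ϖ b' 0 m' at hc
    obtain ⟨k, hk⟩ := hϖ.exists_norm_eq_zpow c.ne_zero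
    rw [hϖ.smul_span hk, hϖ.span_eq_span_iff] at hc
    obtain ⟨h1, h2, h3⟩ := hc
    rw [zpow_zero, mul_one] at h3
    exact ⟨by omega, h3⟩
  · rintro ⟨rfl, h⟩
    have : span ϖ b 0 m = span ϖ b' 0 m :=
      hϖ.span_eq_span_iff.2 ⟨rfl, rfl, by rwa [zpow_zero, mul_one]⟩
    exact congrArg (Quotient.mk (homothety K)) (Subtype.ext this)

lemma exists_eq_vertex (x : Vertex K) : ∃ b m, x = hϖ.vertex b m := by
  induction x using Quotient.inductionOn with
  | h M =>
    obtain ⟨M, hM⟩ := M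
    obtain ⟨b, e, f, rfl⟩ := hϖ.exists_eq_span M hM
    exact ⟨b, f - e, hϖ.mk_span b e f⟩

lemma isSimpleModule_residue : IsSimpleModule (Integers K) (Residue K) :=
  isSimpleModule_iff_quot_maximal.2
    ⟨IsLocalRing.maximalIdeal (Integers K), inferInstance, ⟨LinearEquiv.refl _ _⟩⟩

/-- The quotient of a lattice by the next smaller one. -/
lemma nonempty_quotient_equiv (hϖ : IsUniformizer ϖ) (b : K) (e f : ℤ) :
    Nonempty ((span ϖ b e f ⧸ (span ϖ b e (f + 1)).submoduleOf (span ϖ b e f)) ≃ₗ[Integers K]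
      Residue K) := by
  have hf := zpow_ne_zero f hϖ.ne_zero
  have hmem : ∀ v : span ϖ b e f, (v.1 0 - b * v.1 1) / ϖ ^ f ∈ Integers K := fun v =>
    mem_integers_iff.2 (by
      rw [norm_div, norm_zpow]
      exact div_le_one_of_le₀ v.2.2 (by positivity))
  let g : span ϖ b e f →ₗ[Integers K] Integers K :=
    { toFun := fun v => ⟨_, hmem v⟩
      map_add' := fun v w => Subtype.ext (by
        change (v.1 0 + w.1 0 - b * (v.1 1 + w.1 1)) / ϖ ^ f =
          (v.1 0 - b * v.1 1) / ϖ ^ f + (w.1 0 - b * w.1 1) / ϖ ^ f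
        ring)
      map_smul' := fun a v => Subtype.ext (by
        change (a * v.1 0 - b * (a * v.1 1)) / ϖ ^ f = a * ((v.1 0 - b * v.1 1) / ϖ ^ f)
        ring) }
  let r : Integers K →ₗ[Integers K] Residue K := Algebra.linearMap _ _
  have hr : ∀ a, r a = IsLocalRing.residue (Integers K) a := fun a => rfl
  have hsurj : Function.Surjective (r ∘ₗ g) := by
    intro y
    obtain ⟨a, rfl⟩ := IsLocalRing.residue_surjective y
    have hv : ![a * ϖ ^ f, 0] ∈ span ϖ b e f := by
      rw [mem_span_iff]
      simp only [Matrix.cons_val_zero, Matrix.cons_val_one, mul_zero, sub_zero, norm_zero, norm_mul,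
        norm_zpow]
      exact ⟨by positivity, mul_le_of_le_one_left (by positivity) (norm_integers_le a)⟩
    refine ⟨⟨_, hv⟩, ?_⟩
    rw [LinearMap.comp_apply, hr]
    congr 1
    refine Subtype.ext ?_
    change (a * ϖ ^ f - b * 0) / ϖ ^ f = a
    rw [mul_zero, sub_zero, mul_div_cancel_right₀ _ hf]
  have hker : (span ϖ b e (f + 1)).submoduleOf (span ϖ b e f) = LinearMap.ker (r ∘ₗ g) := by
    ext v
    rw [LinearMap.mem_ker, LinearMap.comp_apply, hr, residue_eq_zero_iff]
    change (v.1 ∈ span ϖ b e (f + 1)) ↔ ‖(v.1 0 - b * v.1 1) / ϖ ^ f‖ < 1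
    rw [norm_div, norm_zpow, div_lt_one (zpow_pos hϖ.norm_pos f), hϖ.lt_zpow_iff, mem_span_iff]
    exact and_iff_right v.2.1
  exact ⟨(Submodule.quotEquivOfEq _ _ hker).trans (LinearMap.quotKerEquivOfSurjective _ hsurj)⟩

/-- A maximal sublattice of the lattice given by `b`, `e` and `f` contains the one given by `b'`,
`e + 1` and `f`, or it is given by some `b'`, `e` and `f + 1`. -/
lemma eq_of_covBy {b b' : K} {e e' f f' : ℤ} (h : span ϖ b' e' f' ⋖ span ϖ b e f) :
    hϖ.vertex b' (f' - e') = hϖ.vertex b (f - e - 1) ∨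
      hϖ.vertex b (f - e) = hϖ.vertex b' (f' - e' - 1) := by
  obtain ⟨h1, h2, h3⟩ := hϖ.span_le_span_iff.1 h.le
  have hpos : ∀ i : ℤ, 0 < ‖ϖ‖ ^ i := fun i => zpow_pos hϖ.norm_pos i
  have h4 : span ϖ b' e' f' ≤ span ϖ b e' f := hϖ.span_le_span_iff.2 ⟨le_rfl, h2, h3⟩
  have h5 : span ϖ b e' f ≤ span ϖ b e f := hϖ.span_le_span_iff.2
    ⟨h1, le_rfl, by rw [sub_self, norm_zero, zero_mul]; exact (hpos f).le⟩
  rcases h.eq_or_eq h4 h5 with h6 | h6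
  · left
    obtain ⟨-, hf, h7⟩ := hϖ.span_eq_span_iff.1 h6
    have he : e < e' := by
      refine lt_of_le_of_ne h1 ?_
      rintro rfl
      exact h.ne h6.symm
    have h8 : span ϖ b e' f ≤ span ϖ b (e + 1) f := hϖ.span_le_span_iff.2
      ⟨he, le_rfl, by rw [sub_self, norm_zero, zero_mul]; exact (hpos f).le⟩
    have h9 : span ϖ b (e + 1) f ≤ span ϖ b e f := hϖ.span_le_span_iff.2
      ⟨by omega, le_rfl, by rw [sub_self, norm_zero, zero_mul]; exact (hpos f).le⟩
    rw [← h6] at h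
    rcases h.eq_or_eq h8 h9 with h10 | h10
    · obtain ⟨h11, -, -⟩ := hϖ.span_eq_span_iff.1 h10
      rw [vertex_eq_iff]
      refine ⟨by omega, ?_⟩
      rw [← hf, zpow_sub₀ hϖ.norm_pos.ne', le_div_iff₀ (hpos _), norm_sub_rev]
      exact h7
    · obtain ⟨h11, -, -⟩ := hϖ.span_eq_span_iff.1 h10
      omega
  · right
    obtain ⟨he, -, -⟩ := hϖ.span_eq_span_iff.1 h6
    subst he
    have hf : f < f' := by
      refine lt_of_le_of_ne h2 ?_
      rintro rfl
      exact h.ne (hϖ.span_eq_span_iff.2 ⟨rfl, rfl, h3⟩)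
    have h8 : span ϖ b' e' f' ≤ span ϖ b' e' (f + 1) := hϖ.span_le_span_iff.2
      ⟨le_rfl, hf, by rw [sub_self, norm_zero, zero_mul]; exact (hpos _).le⟩
    have h9 : span ϖ b' e' (f + 1) ≤ span ϖ b e' f := hϖ.span_le_span_iff.2
      ⟨le_rfl, by omega, h3⟩
    rcases h.eq_or_eq h8 h9 with h10 | h10
    · obtain ⟨-, h11, -⟩ := hϖ.span_eq_span_iff.1 h10
      rw [vertex_eq_iff]
      refine ⟨by omega, ?_⟩
      rw [zpow_sub₀ hϖ.norm_pos.ne', le_div_iff₀ (hpos _), norm_sub_rev]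
      exact h3
    · obtain ⟨-, h11, -⟩ := hϖ.span_eq_span_iff.1 h10
      omega

/-- Adjacent vertices correspond to balls one of which is maximal in the other. -/
lemma tree_adj_iff (x y : Vertex K) : (tree K).Adj x y ↔ x ≠ y ∧
    ((∃ b m, x = hϖ.vertex b m ∧ y = hϖ.vertex b (m - 1)) ∨
      ∃ b m, y = hϖ.vertex b m ∧ x = hϖ.vertex b (m - 1)) := by
  rw [tree, SimpleGraph.fromRel_adj]
  refine and_congr_right fun _ => ?_
  have key : ∀ x y : Vertex K, (∃ M₁ M₂ : Lattice K,
      Quotient.mk (homothety K) M₁ = x ∧ Quotient.mk (homothety K) M₂ = y ∧ M₂.1 ≤ M₁.1 ∧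
        Nonempty ((M₁.1 ⧸ M₂.1.submoduleOf M₁.1) ≃ₗ[Integers K] Residue K)) →
      (∃ b m, x = hϖ.vertex b m ∧ y = hϖ.vertex b (m - 1)) ∨
        ∃ b m, y = hϖ.vertex b m ∧ x = hϖ.vertex b (m - 1) := by
    rintro _ _ ⟨⟨M₁, hM₁⟩, ⟨M₂, hM₂⟩, rfl, rfl, hle, ⟨φ⟩⟩
    dsimp only at hle φ
    have hsimple := isSimpleModule_residue (K := K)
    have hcov : M₂ ⋖ M₁ := (covBy_iff_quot_is_simple hle).2 (IsSimpleModule.congr φ)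
    obtain ⟨b, e, f, rfl⟩ := hϖ.exists_eq_span M₁ hM₁
    obtain ⟨b', e', f', rfl⟩ := hϖ.exists_eq_span M₂ hM₂
    rw [hϖ.mk_span, hϖ.mk_span]
    rcases hϖ.eq_of_covBy hcov with h | h
    · exact Or.inl ⟨b, f - e, rfl, h⟩
    · exact Or.inr ⟨b', f' - e', rfl, h⟩
  have key' : ∀ (b : K) (m : ℤ), ∃ M₁ M₂ : Lattice K,
      Quotient.mk (homothety K) M₁ = hϖ.vertex b (m - 1) ∧
        Quotient.mk (homothety K) M₂ = hϖ.vertex b m ∧ M₂.1 ≤ M₁.1 ∧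
        Nonempty ((M₁.1 ⧸ M₂.1.submoduleOf M₁.1) ≃ₗ[Integers K] Residue K) := by
    intro b m
    refine ⟨⟨_, hϖ.isLattice_span b 0 (m - 1)⟩, ⟨_, hϖ.isLattice_span b 0 (m - 1 + 1)⟩, rfl,
      by rw [sub_add_cancel]; rfl, hϖ.span_le_span_iff.2 ⟨le_rfl, by omega, ?_⟩,
      hϖ.nonempty_quotient_equiv b 0 (m - 1)⟩
    rw [sub_self, norm_zero, zero_mul]
    exact (zpow_pos hϖ.norm_pos _).le
  constructor
  · rintro (h | h)
    · exact key x y h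
    · exact (key y x h).symm
  · rintro (⟨b, m, rfl, rfl⟩ | ⟨b, m, rfl, rfl⟩)
    · exact Or.inr (key' b m)
    · exact Or.inl (key' b m)

/-- The centre of a ball that corresponds to a vertex. -/
def centre (x : Vertex K) : K := (hϖ.exists_eq_vertex x).choose

/-- The exponent of the radius of the ball that corresponds to a vertex. -/
def level (x : Vertex K) : ℤ := (hϖ.exists_eq_vertex x).choose_spec.choose

lemma vertex_centre_level (x : Vertex K) : hϖ.vertex (hϖ.centre x) (hϖ.level x) = x :=
  (hϖ.exists_eq_vertex x).choose_spec.choose_spec.symm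

/-- The vertex that corresponds to the next larger ball. -/
def parent (x : Vertex K) : Vertex K := hϖ.vertex (hϖ.centre x) (hϖ.level x - 1)

lemma level_vertex (b : K) (m : ℤ) : hϖ.level (hϖ.vertex b m) = m :=
  (hϖ.vertex_eq_iff.1 (hϖ.vertex_centre_level (hϖ.vertex b m))).1

lemma vertex_eq_of_le {b b' : K} {m i : ℤ} (h : hϖ.vertex b m = hϖ.vertex b' m) (hi : i ≤ m) :
    hϖ.vertex b i = hϖ.vertex b' i :=
  hϖ.vertex_eq_iff.2 ⟨rfl, (hϖ.vertex_eq_iff.1 h).2.trans (hϖ.zpow_le_zpow_iff.2 hi)⟩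

lemma parent_vertex (b : K) (m : ℤ) : hϖ.parent (hϖ.vertex b m) = hϖ.vertex b (m - 1) := by
  rw [parent, level_vertex]
  refine hϖ.vertex_eq_of_le (m := m) ?_ (by omega)
  nth_rw 2 [← hϖ.level_vertex b m]
  exact hϖ.vertex_centre_level _

lemma iterate_parent_vertex (b : K) (m : ℤ) (i : ℕ) :
    hϖ.parent^[i] (hϖ.vertex b m) = hϖ.vertex b (m - i) := by
  induction i with
  | zero => simp
  | succ i ih =>
    rw [Function.iterate_succ_apply', ih, parent_vertex]
    congr 1
    push_cast
    ring

lemma parent_ne (x : Vertex K) : hϖ.parent x ≠ x := by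
  intro h
  have := congrArg hϖ.level h
  rw [parent, level_vertex] at this
  omega

lemma tree_adj_iff_parent (x y : Vertex K) :
    (tree K).Adj x y ↔ x ≠ y ∧ (hϖ.parent x = y ∨ hϖ.parent y = x) := by
  rw [hϖ.tree_adj_iff]
  refine and_congr_right fun _ => ?_
  have key : ∀ x y, (∃ b m, x = hϖ.vertex b m ∧ y = hϖ.vertex b (m - 1)) ↔ hϖ.parent x = y := by
    intro x y
    constructor
    · rintro ⟨b, m, rfl, rfl⟩
      exact hϖ.parent_vertex b m
    · rintro rfl
      exact ⟨_, _, (hϖ.vertex_centre_level x).symm, rfl⟩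
  rw [key, key]

theorem isTree_tree (hϖ : IsUniformizer ϖ) : (tree K).IsTree := by
  have : Nonempty (Vertex K) := ⟨hϖ.vertex 0 0⟩
  refine SimpleGraph.isTree_of_parent (tree K) hϖ.parent hϖ.level hϖ.tree_adj_iff_parent
    (fun x _ => by rw [parent, level_vertex]; omega) fun x y => ?_
  obtain ⟨b, m, rfl⟩ := hϖ.exists_eq_vertex x
  obtain ⟨b', m', rfl⟩ := hϖ.exists_eq_vertex y
  -- A ball that contains both balls exists since the radii are unbounded.
  obtain ⟨k, hk⟩ : ∃ k : ℤ, ‖b - b'‖ ≤ ‖ϖ‖ ^ k := by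
    by_cases h : b - b' = 0
    · exact ⟨0, by rw [h, norm_zero, zpow_zero]; exact zero_le_one⟩
    · obtain ⟨k, hk⟩ := hϖ.exists_norm_eq_zpow h
      exact ⟨k, hk.le⟩
  refine ⟨(m - min k (min m m')).toNat, (m' - min k (min m m')).toNat, ?_⟩
  rw [iterate_parent_vertex, iterate_parent_vertex, Int.toNat_of_nonneg (by omega),
    Int.toNat_of_nonneg (by omega), sub_sub_cancel, sub_sub_cancel, vertex_eq_iff]
  exact ⟨rfl, hk.trans (hϖ.zpow_le_zpow_iff.2 (min_le_left _ _))⟩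

/-- The maximal balls in a ball correspond to the elements of the residue field. -/
theorem ncard_neighborSet (hϖ : IsUniformizer ϖ) [Finite (Residue K)] (x : Vertex K) :
    ((tree K).neighborSet x).ncard = Nat.card (Residue K) + 1 := by
  obtain ⟨b, m, rfl⟩ := hϖ.exists_eq_vertex x
  have hpos : ∀ i : ℤ, 0 < ‖ϖ‖ ^ i := fun i => zpow_pos hϖ.norm_pos i
  choose lift hlift using IsLocalRing.residue_surjective (R := Integers K)
  let child : Residue K → Vertex K := fun r => hϖ.vertex (b + lift r * ϖ ^ m) (m + 1)
  have heq : ∀ a a' : Integers K,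
      hϖ.vertex (b + a * ϖ ^ m) (m + 1) = hϖ.vertex (b + a' * ϖ ^ m) (m + 1) ↔
        IsLocalRing.residue (Integers K) a = IsLocalRing.residue (Integers K) a' := by
    intro a a'
    rw [← sub_eq_zero (b := IsLocalRing.residue (Integers K) a'), ← map_sub, residue_eq_zero_iff,
      vertex_eq_iff, and_iff_right rfl,
      add_sub_add_left_eq_sub, ← sub_mul, norm_mul, norm_zpow, zpow_add₀ hϖ.norm_pos.ne',
      zpow_one, mul_comm, mul_le_mul_iff_right₀ (hpos m)]
    have := hϖ.lt_zpow_iff (x := (a : K) - a') (i := 0)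
    rw [zpow_zero, zero_add, zpow_one] at this
    exact this.symm
  have hinj : Function.Injective child := by
    intro r r' h
    have := (heq _ _).1 h
    rwa [hlift, hlift] at this
  have hset : (tree K).neighborSet (hϖ.vertex b m) =
      insert (hϖ.parent (hϖ.vertex b m)) (Set.range child) := by
    ext y
    rw [SimpleGraph.mem_neighborSet, hϖ.tree_adj_iff_parent]
    constructor
    · rintro ⟨-, h | h⟩
      · exact Or.inl h.symm
      · right
        obtain ⟨b', m', rfl⟩ := hϖ.exists_eq_vertex y
        rw [parent_vertex, vertex_eq_iff] at h
        obtain ⟨h1, h2⟩ := h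
        obtain rfl : m' = m + 1 := by omega
        rw [add_sub_cancel_right] at h2
        have hm := zpow_ne_zero m hϖ.ne_zero
        have hc : (b' - b) / ϖ ^ m ∈ Integers K := mem_integers_iff.2 (by
          rw [norm_div, norm_zpow]
          exact div_le_one_of_le₀ h2 (hpos m).le)
        refine ⟨IsLocalRing.residue (Integers K) ⟨_, hc⟩, ?_⟩
        refine ((heq _ ⟨_, hc⟩).2 (hlift _)).trans ?_
        congr 1
        change b + (b' - b) / ϖ ^ m * ϖ ^ m = b'
        rw [div_mul_cancel₀ _ hm, add_sub_cancel]
    · rintro (rfl | ⟨r, rfl⟩)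
      · exact ⟨(hϖ.parent_ne _).symm, Or.inl rfl⟩
      · have h : hϖ.parent (child r) = hϖ.vertex b m := by
          rw [parent_vertex, vertex_eq_iff, add_sub_cancel_right, add_sub_cancel_left, norm_mul,
            norm_zpow]
          exact ⟨rfl, mul_le_of_le_one_left (hpos m).le (norm_integers_le _)⟩
        refine ⟨fun h' => ?_, Or.inr h⟩
        rw [h'] at h
        exact hϖ.parent_ne _ h
  rw [hset, Set.ncard_insert_of_notMem _ (Set.finite_range child), ← Set.image_univ,
    Set.ncard_image_of_injective _ hinj, Set.ncard_univ]
  rintro ⟨r, hr⟩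
  have := congrArg hϖ.level hr
  rw [parent_vertex, level_vertex, level_vertex] at this
  omega

end IsUniformizer

end BruhatTits

/-! ### The spanning tree of the tiling -/

theorem mainTheorem3 (n k : ℕ) (hn : 5 ≤ n) (hk : 3 ≤ k) :
    ∃ solid dashed : SimpleGraph (HyperbolicTiling.Vertex n (k + 1)),
      -- the edges of the tiling `{n, k + 1}` are split into solid and dashed ones
      solid ⊔ dashed = HyperbolicTiling.edgeGraph n (k + 1) ∧ Disjoint solid dashed ∧
      -- the solid edges form a spanning tree of valence `k`
      solid.IsTree ∧ (∀ v, (solid.neighborSet v).ncard = k) ∧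
      -- every vertex meets exactly one dashed edge
      (∀ v, ∃! w, dashed.Adj v w) ∧
      -- every tile has one or two dashed sides
      (∀ t ∈ HyperbolicTiling.tiles n (k + 1),
        (t ∩ dashed.edgeSet).ncard = 1 ∨ (t ∩ dashed.edgeSet).ncard = 2) ∧
      -- the tiles can be added one after the other such that each new tile introduces exactly one
      -- new dashed edge, and such that the solid edges form a tree at all steps
      (∃ T : ℕ → Set (Sym2 (HyperbolicTiling.Vertex n (k + 1))),
        Function.Injective T ∧ Set.range T = HyperbolicTiling.tiles n (k + 1) ∧
        ∀ m : ℕ, (∃! e, e ∈ T m ∧ e ∈ dashed.edgeSet ∧ ∀ i < m, e ∉ T i) ∧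
          (HyperbolicTiling.graphOfFirstTiles solid T m).IsTree) ∧
      -- for `k = q + 1`, the solid tree is the Bruhat-Tits tree of every finite extension of `ℚ_p`
      -- whose residue field has `q` elements
      (∀ (p : ℕ) [Fact p.Prime] (K : Type*) [NormedField K] [IsUltrametricDist K]
        [NormedAlgebra ℚ_[p] K] [FiniteDimensional ℚ_[p] K],
        k = Nat.card (BruhatTits.Residue K) + 1 → Nonempty (BruhatTits.tree K ≃g solid)) := by
  have : Fact (5 ≤ n) := ⟨hn⟩
  have : Fact (4 ≤ k + 1) := ⟨Nat.succ_le_succ hk⟩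
  let M := HyperbolicTiling.morseTiling n (k + 1)
  refine ⟨M.solid, M.dashed, ?_, M.disjoint_solid_dashed, M.isTree_solid,
    M.ncard_solid_neighborSet, M.existsUnique_dashed_adj, ?_, ⟨M.tileSeq, M.tileSeq_injective,
      ?_, fun m => ⟨M.existsUnique_new_dashed m, M.isTree_induce m⟩⟩, ?_⟩
  · rw [M.solid_sup_dashed, HyperbolicTiling.edgeGraph_eq]
  · rw [HyperbolicTiling.tiles_eq]
    rintro _ ⟨d, rfl⟩
    exact M.ncard_dashed_sides d
  · rw [M.range_tileSeq, HyperbolicTiling.tiles_eq]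
  · intro p _ K _ _ _ _ h
    obtain ⟨ϖ, hϖ⟩ := BruhatTits.exists_isUniformizer p K
    -- As `k ≥ 3`, the cardinality is not the junk value of an infinite type.
    have : Finite (BruhatTits.Residue K) := Nat.finite_of_card_ne_zero (by omega)
    refine SimpleGraph.IsTree.nonempty_iso_of_regular hϖ.isTree_tree M.isTree_solid
      (k := k) (by omega) (fun x => ?_) M.ncard_solid_neighborSet
    rw [hϖ.ncard_neighborSet, h]

end
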